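/- A polygon is a simple closed polygon in the Euclidean plane, regarded as a geometric graph (a straight-line drawing, without crossings, of a cycle), and its vertices are assumed to be in general position, i.e. no three of them are collinear. A compatible matching of a polygon $P$ is a set $M$ of line segments, each joining two vertices of $P$, such that every vertex of $P$ is an endpoint of at most one segment of $M$, no segment of $M$ is an edge of $P$, and the drawing $P+M$ is noncrossing (the segments may lie inside or outside $P$; two distinct edges of $P+M$ meet at most in a common endpoint). It is maximal if it is not properly contained in another compatible matching of $P$. Let $\mathrm{mm}(P)$ be the minimum number of edges of a maximal compatible matching of $P$, let $P_n$ be the family of all $n$-vertex polygons, and let $\mathrm{mm}(P_n)=\min\{\mathrm{mm}(P) : P\in P_n\}$. Theorem. Let $n\ge 4$. Every maximal compatible matching of an $n$-vertex polygon has at least $n/7$ edges; that is, $\mathrm{mm}(P_n)\ge \frac{n}{7}$. The bound is tight for infinitely many $n$: there are infinitely many $n \geq 4$ for which some $n$-vertex polygon has a maximal compatible matching with exactly $n/7$ edges, so that $\mathrm{mm}(P_n)=\frac{n}{7}$. -/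

import Mathlib

/-- The Euclidean plane. -/
abbrev Plane : Type := EuclideanSpace ℝ (Fin 2)

/-- The straight-line drawing of the graph `G` with vertex positions `pos` is noncrossing: no vertex
lies on an edge it is not an endpoint of, and two distinct edges meet at most in a common
endpoint. -/
def IsNoncrossing {V : Type*} (pos : V → Plane) (G : SimpleGraph V) : Prop :=
  (∀ a b v : V, G.Adj a b → pos v ∈ segment ℝ (pos a) (pos b) → v = a ∨ v = b) ∧
  ∀ a b c d : V, G.Adj a b → G.Adj c d → s(a, b) ≠ s(c, d) →
    segment ℝ (pos a) (pos b) ∩ segment ℝ (pos c) (pos d) ⊆ pos '' ({a, b} ∩ {c, d})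

/-- A (noncrossing) geometric graph: a graph drawn in the plane with distinct vertices and
noncrossing straight-line edges. -/
structure GeometricGraph (V : Type*) where
  pos : V → Plane
  graph : SimpleGraph V
  pos_injective : Function.Injective pos
  noncrossing : IsNoncrossing pos graph

namespace GeometricGraph

variable {V : Type*}

/-- No three vertices are collinear. -/
def InGeneralPosition (G : GeometricGraph V) : Prop :=
  ∀ a b c : V, a ≠ b → b ≠ c → a ≠ c → ¬ Collinear ℝ {G.pos a, G.pos b, G.pos c}

/-- `M` (given by its edges, as a graph on the vertices of `G`) is a matching that is compatible
with `G`: every vertex is in at most one edge of `M`, no edge of `M` is an edge of `G`, and the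
drawing of `G + M` is noncrossing. -/
structure IsCompatibleMatching (G : GeometricGraph V) (M : SimpleGraph V) : Prop where
  matching : ∀ u v w : V, M.Adj u v → M.Adj u w → v = w
  disjoint : Disjoint G.graph M
  noncrossing : IsNoncrossing G.pos (G.graph ⊔ M)

/-- A compatible matching that is not properly contained in another compatible matching. -/
def IsMaximalCompatibleMatching (G : GeometricGraph V) (M : SimpleGraph V) : Prop :=
  Maximal G.IsCompatibleMatching M

/-- The minimum number of edges of a maximal compatible matching of `G`. -/
noncomputable def mm (G : GeometricGraph V) : ℕ :=
  sInf {k : ℕ | ∃ M : SimpleGraph V, G.IsMaximalCompatibleMatching M ∧ M.edgeSet.ncard = k}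

/-- The minimum of `mm G` over all members `G` of a family of geometric graphs. -/
noncomputable def mmFamily (F : Set (GeometricGraph V)) : ℕ :=
  sInf (mm '' F)

/-- The family of all `n`-vertex simple polygons with vertices in general position, the vertices
being labelled in cyclic order along the polygon. (For `3 ≤ n`, `cycleGraph n` is the cycle on
`n` vertices.) -/
def polygons (n : ℕ) : Set (GeometricGraph (Fin n)) :=
  {P | P.graph = SimpleGraph.cycleGraph n ∧ P.InGeneralPosition}

end GeometricGraph

/-!
Let `W` be the set of vertices matched by a maximal compatible matching `M` of a polygon `P`, and
`U` the set of the other vertices; the bound says that `2 |U| ≤ 5 |W|`. Extend `P + M` to a maximal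
noncrossing graph `T`, with as few edges inside `W` as possible and, among these, with the largest
total horizontal extent of the edges. By the maximality of `M`, every edge of `T` inside
`U` is an edge of `P`.

Every vertex other than the leftmost and the rightmost one is the horizontally middle vertex of a
face on its left and of a face on its right, unless the unbounded face lies on that side. So `T` has
many faces. As two of its three vertices are both in `W` or both in `U`, each face has a side inside
`W` or inside `U`, and the faces inside `W` have three. It remains to bound the number of edges
inside `W`: such an edge is in `M` or in `P`, or lies on the hull, or cannot be flipped because it
is blocked at one end, or, by the choice of `T`, is charged to an adjacent face inside `W` with
its apex horizontally between the ends of the edge. At most two edges are blocked at a vertex of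
`W`, and none if it lies on the hull; conversely each vertex of `U` with both neighbours along `P`
in `U` is joined to some vertex of `W` by an edge that is blocked there. Since some vertex of `W`
lies on the hull, the sum of these estimates is the bound.

For equality, the unmatched vertices lie on a convex chain and, in pairs, between two vertices that
are matched with each other. The matched vertices poke through the chords of the chain, and further
edges of the matching cut the pairs off from each other. A period consists of `14` vertices and `2`
edges of the matching.
-/

/-! ### Orientations and crossings -/

section Orientation

variable {V : Type*} (pos : V → Plane)

/-- Twice the signed area of the triangle `abc`; it is positive when the triangle is
counterclockwise, that is, when `c` lies to the left of the directed line `ab`. -/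
def orient (a b c : V) : ℝ :=
  (pos b 0 - pos a 0) * (pos c 1 - pos a 1) - (pos b 1 - pos a 1) * (pos c 0 - pos a 0)

/-- The segments `ab` and `cd` cross in a point interior to both. -/
def Crosses (a b c d : V) : Prop :=
  orient pos a b c * orient pos a b d < 0 ∧ orient pos c d a * orient pos c d b < 0

/-- General position: no three distinct points are collinear. -/
def GenPos : Prop := ∀ a b c : V, a ≠ b → b ≠ c → a ≠ c → orient pos a b c ≠ 0

/-- `d` lies strictly inside the counterclockwise triangle `abc`. -/
def Inside (a b c d : V) : Prop :=
  0 < orient pos b c d ∧ 0 < orient pos c a d ∧ 0 < orient pos a b d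

/-- The point `(1 - t) p + t q` of the open segment `pq` lies strictly inside the counterclockwise
triangle `abc`. -/
structure InsideAt (a b c p q : V) (t : ℝ) : Prop where
  pos_param : 0 < t
  param_lt_one : t < 1
  pos_bc : 0 < (1 - t) * orient pos b c p + t * orient pos b c q
  pos_ca : 0 < (1 - t) * orient pos c a p + t * orient pos c a q
  pos_ab : 0 < (1 - t) * orient pos a b p + t * orient pos a b q

variable {pos}

lemma orient_swap (a b c : V) : orient pos a c b = -orient pos a b c := by
  simp only [orient]; ring

lemma orient_swap' (a b c : V) : orient pos b a c = -orient pos a b c := by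
  simp only [orient]; ring

lemma orient_rot (a b c : V) : orient pos b c a = orient pos a b c := by
  simp only [orient]; ring

lemma orient_rot' (a b c : V) : orient pos c a b = orient pos a b c := by
  simp only [orient]; ring

lemma orient_rev (a b c : V) : orient pos c b a = -orient pos a b c := by
  simp only [orient]; ring

@[simp] lemma orient_self_left (a b : V) : orient pos a a b = 0 := by simp [orient]

@[simp] lemma orient_self_right (a b : V) : orient pos a b b = 0 := by simp only [orient]; ring

@[simp] lemma orient_self_mid (a b : V) : orient pos a b a = 0 := by simp [orient]

lemma orient_sum (a b c d : V) :
    orient pos b c d + orient pos c a d + orient pos a b d = orient pos a b c := by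
  simp only [orient]; ring

lemma orient_sub_orient (a b c d : V) :
    orient pos a b c - orient pos a b d = orient pos c d b - orient pos c d a := by
  simp only [orient]; ring

-- The areas cut off by `x` are its barycentric coordinates with respect to `abc`, and `orient p q`
-- is affine.
lemma orient_bary (a b c x p q : V) :
    orient pos b c x * orient pos p q a + orient pos c a x * orient pos p q b
      + orient pos a b x * orient pos p q c = orient pos a b c * orient pos p q x := by
  simp only [orient]; ring

lemma orient_bary_smul (a b c x : V) :
    orient pos b c x • pos a + orient pos c a x • pos b + orient pos a b x • pos c
      = orient pos a b c • pos x := by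
  ext i
  fin_cases i <;> simp [orient] <;> ring

lemma orient_combination {a b c d : V} {t s : ℝ}
    (h : (1 - t) • pos a + t • pos b = (1 - s) • pos c + s • pos d) (p q : V) :
    (1 - t) * orient pos p q a + t * orient pos p q b
      = (1 - s) * orient pos p q c + s * orient pos p q d := by
  have h0 := congr($h 0)
  have h1 := congr($h 1)
  simp only [PiLp.add_apply, PiLp.smul_apply, smul_eq_mul] at h0 h1
  simp only [orient]
  linear_combination (pos q 0 - pos p 0) * h1 - (pos q 1 - pos p 1) * h0

lemma orient_pos_of_nonneg (hg : GenPos pos) {a b c : V} (hab : a ≠ b) (hbc : b ≠ c) (hac : a ≠ c)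
    (h : 0 ≤ orient pos a b c) : 0 < orient pos a b c :=
  lt_of_le_of_ne h (hg a b c hab hbc hac).symm

lemma orient_neg_of_nonpos (hg : GenPos pos) {a b c : V} (hab : a ≠ b) (hbc : b ≠ c) (hac : a ≠ c)
    (h : orient pos a b c ≤ 0) : orient pos a b c < 0 :=
  lt_of_le_of_ne h (hg a b c hab hbc hac)

lemma Inside.rot {a b c d : V} (h : Inside pos a b c d) : Inside pos b c a d :=
  ⟨h.2.1, h.2.2, h.1⟩

lemma InsideAt.rot {a b c p q : V} {t : ℝ} (h : InsideAt pos a b c p q t) :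
    InsideAt pos b c a p q t :=
  ⟨h.pos_param, h.param_lt_one, h.pos_ca, h.pos_ab, h.pos_bc⟩

lemma InsideAt.symm {a b c p q : V} {t : ℝ} (h : InsideAt pos a b c p q t) :
    InsideAt pos a b c q p (1 - t) := by
  obtain ⟨h0, h1, h2, h3, h4⟩ := h
  constructor <;> linarith

lemma Crosses.symm {a b c d : V} (h : Crosses pos a b c d) : Crosses pos c d a b := ⟨h.2, h.1⟩

lemma Crosses.swap_left {a b c d : V} (h : Crosses pos a b c d) : Crosses pos b a c d := by
  obtain ⟨h1, h2⟩ := h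
  refine ⟨?_, by rwa [mul_comm]⟩
  rwa [orient_swap' a b c, orient_swap' a b d, neg_mul_neg]

lemma Crosses.swap_right {a b c d : V} (h : Crosses pos a b c d) : Crosses pos a b d c :=
  h.symm.swap_left.symm

lemma Crosses.ne {a b c d : V} (h : Crosses pos a b c d) :
    a ≠ b ∧ c ≠ d ∧ a ≠ c ∧ a ≠ d ∧ b ≠ c ∧ b ≠ d := by
  obtain ⟨h1, h2⟩ := h
  refine ⟨?_, ?_, ?_, ?_, ?_, ?_⟩ <;> rintro rfl <;> simp at h1 h2

lemma Crosses.exists_combination {a b c d : V} (h : Crosses pos a b c d) :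
    ∃ t s : ℝ, 0 < t ∧ t < 1 ∧ 0 < s ∧ s < 1 ∧
      (1 - t) • pos a + t • pos b = (1 - s) • pos c + s • pos d := by
  obtain ⟨h1, h2⟩ := h
  have key : ∀ u v : ℝ, u * v < 0 → u - v ≠ 0 ∧ 0 < u / (u - v) ∧ u / (u - v) < 1 := by
    intro u v huv
    rcases mul_neg_iff.1 huv with ⟨hu, hv⟩ | ⟨hu, hv⟩
    · refine ⟨by linarith, div_pos hu (by linarith), ?_⟩
      rw [div_lt_one (by linarith)]; linarith
    · refine ⟨by linarith, div_pos_of_neg_of_neg hu (by linarith), ?_⟩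
      rw [div_lt_one_of_neg (by linarith)]; linarith
  obtain ⟨n1, p1, q1⟩ := key _ _ h1
  obtain ⟨n2, p2, q2⟩ := key _ _ h2
  refine ⟨_, _, p2, q2, p1, q1, ?_⟩
  have e : orient pos a b c - orient pos a b d = -(orient pos c d a - orient pos c d b) := by
    rw [orient_sub_orient, neg_sub]
  rw [e] at n1 ⊢
  ext i
  simp only [PiLp.add_apply, PiLp.smul_apply, smul_eq_mul]
  field_simp
  fin_cases i <;> simp only [orient, Fin.zero_eta, Fin.mk_one] <;> ring

lemma Crosses.of_combination (hg : GenPos pos) {a b c d : V} {t s : ℝ} (ht0 : 0 < t) (ht1 : t < 1)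
    (hs0 : 0 < s) (hs1 : s < 1) (h : (1 - t) • pos a + t • pos b = (1 - s) • pos c + s • pos d)
    (hab : a ≠ b) (hcd : c ≠ d) (hac : a ≠ c) (hbc : b ≠ c) (had : a ≠ d) :
    Crosses pos a b c d := by
  have opposite : ∀ {u v r : ℝ}, u ≠ 0 → 0 < r → r < 1 → (1 - r) * u + r * v = 0 → u * v < 0 := by
    intro u v r hu hr0 hr1 huv
    have : r * (u * v) = -((1 - r) * u ^ 2) := by linear_combination u * huv
    have : 0 < (1 - r) * u ^ 2 := mul_pos (by linarith) (by positivity)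
    exact neg_of_mul_neg_right (by linarith : r * (u * v) < 0) hr0.le
  have hab' := orient_combination h a b
  have hcd' := orient_combination h c d
  simp only [orient_self_mid, orient_self_right, mul_zero, add_zero] at hab' hcd'
  exact ⟨opposite (hg a b c hab hbc hac) hs0 hs1 hab'.symm,
    opposite (hg c d a hcd had.symm hac.symm) ht0 ht1 hcd'⟩

/-! ### Segments meeting a triangle -/

-- `y` and `p` stand for barycentric coordinates of two points on a line, `L` for the positions of
-- the corners of the triangle relative to that line.
lemma exists_neg_of_sum_mul_eq_zero {y₁ y₂ y₃ p₁ p₂ p₃ L₁ L₂ L₃ : ℝ} (hy₁ : 0 < y₁) (hy₂ : 0 < y₂)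
    (hy₃ : 0 < y₃) (hy : y₁ * L₁ + y₂ * L₂ + y₃ * L₃ = 0) (hp : p₁ * L₁ + p₂ * L₂ + p₃ * L₃ = 0)
    (hp₁ : p₁ < 0) (hL : 0 < L₂ * L₃) : (p₂ < 0 ∧ L₃ * L₁ < 0) ∨ (p₃ < 0 ∧ L₁ * L₂ < 0) := by
  have h₁₂ : L₁ * L₂ < 0 := by
    have : y₁ * (L₁ * L₂) = -(y₂ * L₂ ^ 2 + y₃ * (L₂ * L₃)) := by linear_combination L₂ * hy
    exact neg_of_mul_neg_right (by rw [this]; exact neg_neg_of_pos (by positivity)) hy₁.le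
  have h₃₁ : L₃ * L₁ < 0 := by
    have : y₁ * (L₃ * L₁) = -(y₂ * (L₂ * L₃) + y₃ * L₃ ^ 2) := by linear_combination L₃ * hy
    exact neg_of_mul_neg_right (by rw [this]; exact neg_neg_of_pos (by positivity)) hy₁.le
  by_contra! h
  have hp₂ : 0 ≤ p₂ := not_lt.1 fun hlt => (h.1 hlt).not_gt h₃₁
  have hp₃ : 0 ≤ p₃ := not_lt.1 fun hlt => (h.2 hlt).not_gt h₁₂
  have : p₁ * (L₁ * L₂) + (p₂ * L₂ ^ 2 + p₃ * (L₂ * L₃)) = 0 := by linear_combination L₂ * hp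
  have := mul_pos_of_neg_of_neg hp₁ h₁₂
  have : 0 ≤ p₂ * L₂ ^ 2 + p₃ * (L₂ * L₃) := by positivity
  linarith

lemma InsideAt.exists_crosses_of_neg (hg : GenPos pos) {a b c p q : V} {t : ℝ}
    (h : InsideAt pos a b c p q t) (hpq : p ≠ q) (hpb : p ≠ b) (hpc : p ≠ c)
    (hp : orient pos b c p < 0) :
    Crosses pos b c p q ∨ (orient pos c a p < 0 ∧ Crosses pos c a p q) ∨
      (orient pos a b p < 0 ∧ Crosses pos a b p q) := by
  obtain ⟨ht0, ht1, hbc, hca, hab⟩ := h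
  have pos_end : ∀ {u v : ℝ}, 0 < (1 - t) * u + t * v → u < 0 → 0 < v := by
    intro u v huv hu
    have := mul_neg_of_pos_of_neg (sub_pos.2 ht1) hu
    exact pos_of_mul_pos_right (by linarith : 0 < t * v) ht0.le
  have hq := pos_end hbc hp
  have hb : orient pos p q b ≠ 0 := hg p q b hpq (by rintro rfl; simp at hq) hpb
  have hc : orient pos p q c ≠ 0 := hg p q c hpq (by rintro rfl; simp at hq) hpc
  have hbaryp := orient_bary (pos := pos) a b c p p q
  have hbaryq := orient_bary (pos := pos) a b c q p q
  simp only [orient_self_mid, orient_self_right, mul_zero] at hbaryp hbaryq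
  rcases lt_or_gt_of_ne (mul_ne_zero hb hc) with hL | hL
  · exact .inl ⟨mul_neg_of_neg_of_pos hp hq, hL⟩
  refine .inr ((exists_neg_of_sum_mul_eq_zero hbc hca hab
    (by linear_combination (1 - t) * hbaryp + t * hbaryq) hbaryp hp hL).imp ?_ ?_)
  · exact fun ⟨h1, h2⟩ => ⟨h1, mul_neg_of_neg_of_pos h1 (pos_end hca h1), h2⟩
  · exact fun ⟨h1, h2⟩ => ⟨h1, mul_neg_of_neg_of_pos h1 (pos_end hab h1), h2⟩

lemma InsideAt.exists_crosses (hg : GenPos pos) {a b c p q : V} {t : ℝ}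
    (h : InsideAt pos a b c p q t) (hpq : p ≠ q) (hpa : p ≠ a) (hpb : p ≠ b) (hpc : p ≠ c)
    (habc : 0 < orient pos a b c) (hp : ¬ Inside pos a b c p) :
    (orient pos b c p < 0 ∧ Crosses pos b c p q) ∨ (orient pos c a p < 0 ∧ Crosses pos c a p q) ∨
      (orient pos a b p < 0 ∧ Crosses pos a b p q) := by
  have hab : a ≠ b := by rintro rfl; simp at habc
  have hbc : b ≠ c := by rintro rfl; simp at habc
  have hca : c ≠ a := by rintro rfl; simp at habc
  by_cases h1 : orient pos b c p < 0
  · exact (h.exists_crosses_of_neg hg hpq hpb hpc h1).imp_left fun h' => ⟨h1, h'⟩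
  by_cases h2 : orient pos c a p < 0
  · rcases h.rot.exists_crosses_of_neg hg hpq hpc hpa h2 with h' | h' | h'
    · exact .inr (.inl ⟨h2, h'⟩)
    · exact .inr (.inr h')
    · exact .inl h'
  by_cases h3 : orient pos a b p < 0
  · rcases h.rot.rot.exists_crosses_of_neg hg hpq hpa hpb h3 with h' | h' | h'
    · exact .inr (.inr ⟨h3, h'⟩)
    · exact .inl h'
    · exact .inr (.inl h')
  exact absurd ⟨orient_pos_of_nonneg hg hbc hpc.symm hpb.symm (not_lt.1 h1),
    orient_pos_of_nonneg hg hca hpa.symm hpc.symm (not_lt.1 h2),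
    orient_pos_of_nonneg hg hab hpb.symm hpa.symm (not_lt.1 h3)⟩ hp

lemma eventually_pos_combination {u v t : ℝ} (h : 0 < (1 - t) * u + t * v) :
    ∀ᶠ r in nhds t, 0 < (1 - r) * u + r * v :=
  (by fun_prop : ContinuousAt (fun r : ℝ => (1 - r) * u + r * v) t).eventually_const_lt h

/-- If `pq` crosses the side `ab` of the triangle `vab` and `p` lies on the side of `v`, outside the
triangle, then `pq` crosses another side: apply Pasch's axiom to a point of `pq` slightly before the
crossing. -/
lemma Crosses.exists_crosses_side (hg : GenPos pos) {v a b p q : V} (hv : 0 < orient pos v a b)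
    (hcr : Crosses pos a b p q) (hp : 0 < orient pos a b p) (hpv : p ≠ v)
    (hin : ¬ Inside pos v a b p) : Crosses pos v a p q ∨ Crosses pos b v p q := by
  obtain ⟨t, s, ht0, ht1, hs0, hs1, hx⟩ := hcr.exists_combination
  obtain ⟨-, hpq, hap, -, hbp, -⟩ := hcr.ne
  have hq : orient pos a b q < 0 := neg_of_mul_neg_right hcr.1 hp.le
  have hab := orient_combination hx a b
  have hbv := orient_combination hx b v
  have hva := orient_combination hx v a
  simp only [orient_self_mid, orient_self_right, mul_zero, add_zero, zero_add,
    orient_rot' v a b] at hab hbv hva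
  have near_bv := eventually_pos_combination (hbv ▸ mul_pos (sub_pos.2 ht1) hv)
  have near_va := eventually_pos_combination (hva ▸ mul_pos ht0 hv)
  obtain ⟨r, ⟨hr0, hrbv, hrva⟩, hrs⟩ :=
    (((eventually_gt_nhds hs0).and (near_bv.and near_va)).filter_mono nhdsWithin_le_nhds
      |>.and (self_mem_nhdsWithin (s := Set.Iio s))).exists
  have hrab : 0 < (1 - r) * orient pos a b p + r * orient pos a b q := by
    have : 0 < (s - r) * (orient pos a b p - orient pos a b q) :=
      mul_pos (sub_pos.2 hrs) (by linarith)
    linarith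
  have hr : InsideAt pos v a b p q r := ⟨hr0, hrs.trans hs1, hrab, hrbv, hrva⟩
  rcases hr.exists_crosses hg hpq hpv hap.symm hbp.symm hv hin with h | h | h
  · exact absurd h.1 hp.not_gt
  · exact .inr h.2
  · exact .inl h.2

/-! ### Angular order -/

-- The directions of `d` and `e` are compared through their cotangents with respect to the ray `vc`.
lemma cot_lt_cot_iff {v c d e : V} (h : 0 < orient pos v c d * orient pos v c e) :
    inner ℝ (pos c - pos v) (pos d - pos v) / orient pos v c d
      < inner ℝ (pos c - pos v) (pos e - pos v) / orient pos v c e ↔ 0 < orient pos v e d := by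
  have hd : orient pos v c d ≠ 0 := left_ne_zero_of_mul h.ne'
  have he : orient pos v c e ≠ 0 := right_ne_zero_of_mul h.ne'
  have hc : 0 < inner ℝ (pos c - pos v) (pos c - pos v) := by
    refine real_inner_self_pos.2 (sub_ne_zero.2 fun hcv => hd ?_)
    simp [orient, hcv]
  have hde : inner ℝ (pos c - pos v) (pos e - pos v) * orient pos v c d
      - orient pos v c e * inner ℝ (pos c - pos v) (pos d - pos v)
        = inner ℝ (pos c - pos v) (pos c - pos v) * orient pos v e d := by
    simp only [PiLp.inner_apply, Fin.sum_univ_two, PiLp.sub_apply, RCLike.inner_apply,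
      conj_trivial, orient]
    ring
  rw [← sub_pos, div_sub_div _ _ he hd, mul_comm (orient pos v c e) (orient pos v c d),
    div_pos_iff_of_pos_right h, hde, mul_pos_iff_of_pos_left hc]

lemma exists_clockwise_most {v c : V} {S : Set V} (hfin : S.Finite) (hS : S.Nonempty)
    (hside : ∀ d ∈ S, ∀ e ∈ S, 0 < orient pos v c d * orient pos v c e) :
    ∃ d ∈ S, ∀ e ∈ S, orient pos v e d ≤ 0 := by
  obtain ⟨d, hd, hmax⟩ := hfin.exists_maximalFor
    (fun d => inner ℝ (pos c - pos v) (pos d - pos v) / orient pos v c d) S hS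
  refine ⟨d, hd, fun e he => not_lt.1 fun hlt => ?_⟩
  have hcot := (cot_lt_cot_iff (hside d hd e he)).2 hlt
  exact (hmax he hcot.le).not_gt hcot

lemma exists_counterclockwise_most {v c : V} {S : Set V} (hfin : S.Finite) (hS : S.Nonempty)
    (hside : ∀ d ∈ S, ∀ e ∈ S, 0 < orient pos v c d * orient pos v c e) :
    ∃ d ∈ S, ∀ e ∈ S, 0 ≤ orient pos v e d := by
  obtain ⟨d, hd, hmin⟩ := hfin.exists_minimalFor
    (fun d => inner ℝ (pos c - pos v) (pos d - pos v) / orient pos v c d) S hS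
  refine ⟨d, hd, fun e he => ?_⟩
  rw [orient_swap, neg_nonneg]
  refine not_lt.1 fun hlt => ?_
  have hcot := (cot_lt_cot_iff (hside e he d hd)).2 hlt
  exact (hmin he hcot.le).not_gt hcot

end Orientation

/-! ### Maximal noncrossing graphs and their faces -/

section Triangulation

variable {V : Type*} {pos : V → Plane} {T : SimpleGraph V}

variable (pos T) in
/-- `T` is a maximal noncrossing straight-line graph on points in general position. -/
structure IsTriangulation : Prop where
  genPos : GenPos pos
  noncrossing : ∀ a b c d, T.Adj a b → T.Adj c d → ¬ Crosses pos a b c d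
  maximal : ∀ a b, a ≠ b → (∀ c d, T.Adj c d → ¬ Crosses pos a b c d) → T.Adj a b

variable (pos T) in
/-- `abc` is a counterclockwise triangle of `T` without vertices in its interior. -/
structure IsFace (a b c : V) : Prop where
  adj_ab : T.Adj a b
  adj_bc : T.Adj b c
  adj_ca : T.Adj c a
  ccw : 0 < orient pos a b c
  empty : ∀ d, ¬ Inside pos a b c d

lemma IsFace.rot {a b c : V} (h : IsFace pos T a b c) : IsFace pos T b c a :=
  ⟨h.adj_bc, h.adj_ca, h.adj_ab, by rw [orient_rot]; exact h.ccw,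
    fun d hd => h.empty d hd.rot.rot⟩

namespace IsTriangulation

lemma mem_of_insideAt_face (hT : IsTriangulation pos T) {a b c p q : V} {t : ℝ}
    (hf : IsFace pos T a b c) (hpq : T.Adj p q) (h : InsideAt pos a b c p q t) :
    p = a ∨ p = b ∨ p = c := by
  by_contra! hp
  rcases h.exists_crosses hT.genPos hpq.ne hp.1 hp.2.1 hp.2.2 hf.ccw (hf.empty p) with h | h | h
  · exact hT.noncrossing _ _ _ _ hf.adj_bc hpq h.2
  · exact hT.noncrossing _ _ _ _ hf.adj_ca hpq h.2
  · exact hT.noncrossing _ _ _ _ hf.adj_ab hpq h.2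

lemma not_insideAt_face (hT : IsTriangulation pos T) {a b c p q : V} {t : ℝ}
    (hf : IsFace pos T a b c) (hpq : T.Adj p q) : ¬ InsideAt pos a b c p q t := by
  intro h
  have hne := hpq.ne
  have := h.pos_bc
  have := h.pos_ca
  have := h.pos_ab
  rcases hT.mem_of_insideAt_face hf hpq h with rfl | rfl | rfl <;>
    rcases hT.mem_of_insideAt_face hf hpq.symm h.symm with rfl | rfl | rfl <;> simp_all

lemma not_adj_in_wedge (hT : IsTriangulation pos T) {v a b e : V} (hf : IsFace pos T v a b)
    (he : T.Adj v e) (hae : 0 < orient pos v a e) (heb : 0 < orient pos v e b) : False := by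
  have near : ∀ᶠ t in nhds (0 : ℝ), 0 < (1 - t) * orient pos a b v + t * orient pos a b e :=
    eventually_pos_combination (by simpa [orient_rot] using hf.ccw)
  obtain ⟨t, ⟨ht, ht1⟩, ht0⟩ := ((near.and (eventually_lt_nhds one_pos)).filter_mono
    nhdsWithin_le_nhds |>.and (self_mem_nhdsWithin (s := Set.Ioi (0 : ℝ)))).exists
  refine hT.not_insideAt_face hf he ⟨ht0, ht1, ht, ?_, ?_⟩
  · simpa [orient_rot' v e b] using mul_pos ht0 heb
  · simpa using mul_pos ht0 hae

lemma face_unique (hT : IsTriangulation pos T) {a b c c' : V} (hf : IsFace pos T a b c)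
    (hf' : IsFace pos T a b c') : c = c' := by
  by_contra hne
  have hbc : orient pos b c c' < 0 := by
    refine orient_neg_of_nonpos hT.genPos hf.adj_bc.ne hne hf'.adj_bc.ne (not_lt.1 fun h => ?_)
    exact hT.not_adj_in_wedge hf.rot hf'.adj_bc h (by rw [orient_rot]; exact hf'.ccw)
  have hca : orient pos c a c' < 0 := by
    refine orient_neg_of_nonpos hT.genPos hf.adj_ca.ne hf'.adj_ca.ne.symm hne
      (not_lt.1 fun h => ?_)
    exact hT.not_adj_in_wedge hf hf'.adj_ca.symm hf'.ccw (by rwa [← orient_rot'])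
  refine hf'.empty c ⟨?_, ?_, hf.ccw⟩
  · rw [orient_swap]; exact neg_pos.2 hbc
  · rw [orient_rev]; exact neg_pos.2 hca

/-! ### Consecutive edges at a vertex -/

lemma not_insideAt_of_farthest (hT : IsTriangulation pos T) {v a b c p q : V} {s : ℝ}
    (ha : T.Adj v a) (hb : T.Adj v b) (hpq : T.Adj p q) (hvp : p ≠ v)
    (hc : 0 < orient pos a b c) (hp : orient pos a b c < orient pos a b p)
    (hmax : ∀ d, Inside pos v a b d → orient pos a b d ≤ orient pos a b c) :
    ¬ InsideAt pos v a b p q s := by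
  intro h
  have hap : p ≠ a := by rintro rfl; simp at hp; linarith
  have hbp : p ≠ b := by rintro rfl; simp at hp; linarith
  have hvab : 0 < orient pos v a b := by
    linear_combination h.pos_bc + h.pos_ca + h.pos_ab + (1 - s) * orient_sum (pos := pos) v a b p +
      s * orient_sum (pos := pos) v a b q
  rcases h.exists_crosses hT.genPos hpq.ne hvp hap hbp hvab (fun h => (hmax p h).not_gt hp)
    with h | h | h
  · linarith [h.1]
  · exact hT.noncrossing _ _ _ _ hb.symm hpq h.2
  · exact hT.noncrossing _ _ _ _ ha hpq h.2

/-- A vertex in the triangle spanned by two edges `va` and `vb` which is farthest from the line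
`ab` is visible from `v`: an edge crossing `vc` would have an end still farther from `ab`, and
could leave the triangle only through one of the edges `va` and `vb`. -/
lemma adj_of_farthest (hT : IsTriangulation pos T) {v a b c : V} (ha : T.Adj v a)
    (hb : T.Adj v b) (hc : Inside pos v a b c)
    (hmax : ∀ d, Inside pos v a b d → orient pos a b d ≤ orient pos a b c) : T.Adj v c := by
  obtain ⟨hab, hbv, hva⟩ := hc
  have hsum := orient_sum (pos := pos) v a b c
  refine hT.maximal v c (by rintro rfl; simp at hva) fun p q hpq hcr => ?_
  obtain ⟨t, s, ht0, ht1, hs0, hs1, hx⟩ := hcr.exists_combination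
  obtain ⟨-, -, hvp, hvq, -, -⟩ := hcr.ne
  have hx_ab := orient_combination hx a b
  have hx_far : orient pos a b c < (1 - s) * orient pos a b p + s * orient pos a b q := by
    have : 0 < (1 - t) * (orient pos v a b - orient pos a b c) :=
      mul_pos (by linarith) (by linarith)
    rw [orient_rot v a b] at hx_ab
    linarith
  have hin : InsideAt pos v a b p q s := by
    refine ⟨hs0, hs1, hab.trans hx_far, ?_, ?_⟩
    · rw [← orient_combination hx b v]; simpa using mul_pos ht0 hbv
    · rw [← orient_combination hx v a]; simpa using mul_pos ht0 hva
  rcases lt_or_ge (orient pos a b c) (orient pos a b p) with hp | hp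
  · exact hT.not_insideAt_of_farthest ha hb hpq hvp.symm hab hp hmax hin
  rcases lt_or_ge (orient pos a b c) (orient pos a b q) with hq | hq
  · exact hT.not_insideAt_of_farthest ha hb hpq.symm hvq.symm hab hq hmax hin.symm
  have := mul_le_mul_of_nonneg_left hp (sub_nonneg.2 hs1.le)
  have := mul_le_mul_of_nonneg_left hq hs0.le
  linarith

section Consecutive

variable {v a b : V}

lemma not_inside_of_consecutive [Finite V] (hT : IsTriangulation pos T) (ha : T.Adj v a)
    (hb : T.Adj v b) (hw : ∀ e, T.Adj v e → 0 < orient pos v a e → ¬ 0 < orient pos v e b)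
    (d : V) : ¬ Inside pos v a b d := by
  intro hd
  obtain ⟨c, hc, hmax⟩ := (Set.toFinite {d | Inside pos v a b d}).exists_maximalFor
    (fun d => orient pos a b d) _ ⟨d, hd⟩
  have hvc := hT.adj_of_farthest ha hb hc fun e he => not_lt.1 fun h => (hmax he h.le).not_gt h
  exact hw c hvc hc.2.2 (by rw [← orient_rot']; exact hc.2.1)

lemma not_crosses_of_consecutive [Finite V] (hT : IsTriangulation pos T) (ha : T.Adj v a)
    (hb : T.Adj v b) (hab : 0 < orient pos v a b)
    (hw : ∀ e, T.Adj v e → 0 < orient pos v a e → ¬ 0 < orient pos v e b) {p q : V}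
    (hpq : T.Adj p q) (hp : 0 < orient pos a b p) : ¬ Crosses pos a b p q := by
  intro hcr
  by_cases hpv : p = v
  · subst hpv
    have hL := orient_sub_orient (pos := pos) a b p q
    have hq := neg_of_mul_neg_right hcr.1 hp.le
    rcases mul_neg_iff.1 hcr.2 with h | h
    · linarith
    · exact hw q hpq (by rw [orient_swap]; exact neg_pos.2 h.1) h.2
  rcases hcr.exists_crosses_side hT.genPos hab hp hpv
    (hT.not_inside_of_consecutive ha hb hw p) with h | h
  · exact hT.noncrossing _ _ _ _ ha hpq h
  · exact hT.noncrossing _ _ _ _ hb.symm hpq h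

lemma isFace_of_consecutive [Finite V] (hT : IsTriangulation pos T) (ha : T.Adj v a)
    (hb : T.Adj v b) (hab : 0 < orient pos v a b)
    (hw : ∀ e, T.Adj v e → 0 < orient pos v a e → ¬ 0 < orient pos v e b) :
    IsFace pos T v a b := by
  have hne : a ≠ b := by rintro rfl; simp at hab
  refine ⟨ha, hT.maximal a b hne fun p q hpq hcr => ?_, hb.symm, hab,
    hT.not_inside_of_consecutive ha hb hw⟩
  rcases mul_neg_iff.1 hcr.1 with h | h
  · exact hT.not_crosses_of_consecutive ha hb hab hw hpq h.1 hcr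
  · exact hT.not_crosses_of_consecutive ha hb hab hw hpq.symm h.2 hcr.swap_right

end Consecutive

lemma exists_face_left [Finite V] (hT : IsTriangulation pos T) {v c d : V}
    (hc : T.Adj v c) (hd : T.Adj v d) (h : 0 < orient pos v c d) :
    ∃ e, IsFace pos T v c e ∧ (e = d ∨ 0 < orient pos v e d) := by
  obtain ⟨e, ⟨he, hce⟩, hfirst⟩ := exists_clockwise_most (pos := pos) (v := v) (c := c)
    (S := {e | T.Adj v e ∧ 0 < orient pos v c e}) (Set.toFinite _) ⟨d, hd, h⟩
    fun x hx y hy => mul_pos hx.2 hy.2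
  refine ⟨e, hT.isFace_of_consecutive hc he hce fun x hx hcx => (hfirst x ⟨hx, hcx⟩).not_gt,
    or_iff_not_imp_left.2 fun hed => ?_⟩
  rw [orient_swap, neg_pos]
  exact orient_neg_of_nonpos hT.genPos hd.ne (Ne.symm hed) he.ne (hfirst d ⟨hd, h⟩)

lemma exists_face_right [Finite V] (hT : IsTriangulation pos T) {v c d : V}
    (hc : T.Adj v c) (hd : T.Adj v d) (h : orient pos v c d < 0) :
    ∃ e, IsFace pos T v e c ∧ (e = d ∨ 0 < orient pos v d e) := by
  obtain ⟨e, ⟨he, hce⟩, hlast⟩ := exists_counterclockwise_most (pos := pos) (v := v) (c := c)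
    (S := {e | T.Adj v e ∧ orient pos v c e < 0}) (Set.toFinite _) ⟨d, hd, h⟩
    fun x hx y hy => mul_pos_of_neg_of_neg hx.2 hy.2
  refine ⟨e, hT.isFace_of_consecutive he hc (by rw [orient_swap]; exact neg_pos.2 hce)
    fun x hx hex hxc => ?_, or_iff_not_imp_left.2 fun hed => ?_⟩
  · rw [orient_swap, neg_pos] at hex hxc
    exact (hlast x ⟨hx, hxc⟩).not_gt hex
  · exact orient_pos_of_nonneg hT.genPos hd.ne (Ne.symm hed) he.ne (hlast d ⟨hd, h⟩)

end IsTriangulation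

end Triangulation

/-! ### Hull edges and blocked edges -/

section Darts

variable {V : Type*} {pos : V → Plane} {T : SimpleGraph V}

variable (pos T) in
/-- All other edges of `T` at `z` lie to the right of the directed edge `zc`. In a triangulation
these are the directed edges with the unbounded face on their left. -/
def Bare (z c : V) : Prop := T.Adj z c ∧ ∀ d, T.Adj z d → d ≠ c → orient pos z c d < 0

variable (pos T) in
/-- The edge `zx` has faces `zax` and `zxb` on its two sides, and `z` lies inside the triangle
`xab`. These are the edges that cannot be flipped because of their end `z`. -/
structure BlockedBy (z x a b : V) : Prop where
  face_right : IsFace pos T z a x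
  face_left : IsFace pos T z x b
  wedge : 0 < orient pos z b a

variable (pos T) in
/-- The edge `zx` is blocked at `z` by the apexes of the two faces containing it. -/
def Blocked (z x : V) : Prop := ∃ a b, BlockedBy pos T z x a b

lemma orient_plucker (z a x b e : V) :
    orient pos z x b * orient pos z e a + orient pos z b a * orient pos z e x
      + orient pos z a x * orient pos z e b = 0 := by
  simp only [orient]; ring

lemma IsFace.not_bare {a b c : V} (h : IsFace pos T a b c) : ¬ Bare pos T a b := fun hb =>
  h.ccw.not_gt (hb.2 c h.adj_ca.symm h.adj_bc.ne.symm)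

namespace Bare

lemma orient_nonpos {z c e : V} (h : Bare pos T z c) (he : T.Adj z e) : orient pos z c e ≤ 0 := by
  rcases eq_or_ne e c with rfl | hne
  · simp
  · exact (h.2 e he hne).le

lemma unique {z c c' : V} (h : Bare pos T z c) (h' : Bare pos T z c') : c = c' := by
  by_contra hne
  have h1 := h.2 c' h'.1 (Ne.symm hne)
  have h2 := h'.2 c h.1 hne
  rw [orient_swap] at h2
  linarith

lemma orient_pos [Finite V] (hT : IsTriangulation pos T) {z c e : V} (h : Bare pos T z c)
    (he : T.Adj c e) (hne : e ≠ z) : 0 < orient pos c z e := by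
  refine orient_pos_of_nonneg hT.genPos h.1.symm.ne hne.symm he.ne (not_lt.1 fun hlt => ?_)
  obtain ⟨d, hd, -⟩ := hT.exists_face_right h.1.symm he hlt
  exact hd.rot.rot.not_bare h

lemma exists_next [Finite V] (hT : IsTriangulation pos T) {z c e : V} (h : Bare pos T z c)
    (he : T.Adj c e) (hne : e ≠ z) : ∃ c', Bare pos T c c' ∧ c' ≠ z := by
  obtain ⟨d, ⟨hd, hdz⟩, hlast⟩ := exists_counterclockwise_most (pos := pos) (v := c) (c := z)
    (S := {e | T.Adj c e ∧ e ≠ z}) (Set.toFinite _) ⟨e, he, hne⟩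
    fun x hx y hy => mul_pos (h.orient_pos hT hx.1 hx.2) (h.orient_pos hT hy.1 hy.2)
  refine ⟨d, ⟨hd, fun x hx hxd => ?_⟩, hdz⟩
  rw [orient_swap, neg_neg_iff_pos]
  rcases eq_or_ne x z with rfl | hxz
  · exact h.orient_pos hT hd hdz
  · exact orient_pos_of_nonneg hT.genPos hx.ne hxd hd.ne (hlast x ⟨hx, hxz⟩)

lemma head_injective [Finite V] (hT : IsTriangulation pos T) {z z' c : V}
    (h : Bare pos T z c) (h' : Bare pos T z' c) : z = z' := by
  by_contra hne
  have h1 := h.orient_pos hT h'.1.symm (Ne.symm hne)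
  have h2 := h'.orient_pos hT h.1.symm hne
  rw [orient_swap] at h2
  linarith

end Bare

lemma Blocked.not_bare {z x c : V} (h : Blocked pos T z x) : ¬ Bare pos T z c := by
  obtain ⟨a, b, h1, h2, h3⟩ := h
  intro hc
  have plucker := orient_plucker (pos := pos) z a x b c
  have pa := mul_nonpos_of_nonneg_of_nonpos h2.ccw.le (hc.orient_nonpos h1.adj_ab)
  have px := mul_nonpos_of_nonneg_of_nonpos h3.le (hc.orient_nonpos h2.adj_ab)
  have pb := mul_nonpos_of_nonneg_of_nonpos h1.ccw.le (hc.orient_nonpos h2.adj_ca.symm)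
  rcases eq_or_ne a c with rfl | hac
  · linarith [mul_neg_of_pos_of_neg h3 (hc.2 x h2.adj_ab h1.adj_bc.ne.symm)]
  · linarith [mul_neg_of_pos_of_neg h2.ccw (hc.2 a h1.adj_ab hac)]

namespace IsTriangulation

lemma exists_face_of_not_bare [Finite V] (hT : IsTriangulation pos T) {z c : V}
    (hc : T.Adj z c) (h : ¬ Bare pos T z c) : ∃ e, IsFace pos T z c e := by
  simp only [Bare, hc, true_and, not_forall, not_lt] at h
  obtain ⟨d, hd, hne, h⟩ := h
  obtain ⟨e, he, -⟩ := hT.exists_face_left hc hd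
    (orient_pos_of_nonneg hT.genPos hc.ne hne.symm hd.ne h)
  exact ⟨e, he⟩

lemma wedge_of_blockedBy (hT : IsTriangulation pos T) {z x a b e : V}
    (h : BlockedBy pos T z x a b) (he : T.Adj z e) (hea : e ≠ a) (hex : e ≠ x) (heb : e ≠ b) :
    0 < orient pos z b e ∧ 0 < orient pos z e a := by
  obtain ⟨h1, h2, h3⟩ := h
  have plucker := orient_plucker (pos := pos) z a x b e
  have not_right : 0 < orient pos z e x → 0 < orient pos z e a := fun hx => by
    refine orient_pos_of_nonneg hT.genPos he.ne hea h1.adj_ab.ne (not_lt.1 fun ha => ?_)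
    exact hT.not_adj_in_wedge h1 he (by rw [orient_swap]; exact neg_pos.2 ha) hx
  have not_left : orient pos z e x < 0 → orient pos z e b < 0 := fun hx => by
    refine orient_neg_of_nonpos hT.genPos he.ne heb h2.adj_ca.symm.ne (not_lt.1 fun hb => ?_)
    exact hT.not_adj_in_wedge h2 he (by rw [orient_swap]; exact neg_pos.2 hx) hb
  rw [orient_swap z e b, neg_pos]
  rcases lt_or_gt_of_ne (hT.genPos z e x he.ne hex h2.adj_ab.ne) with hx | hx
  · have hb := not_left hx
    have := mul_neg_of_pos_of_neg h3 hx
    have := mul_neg_of_pos_of_neg h1.ccw hb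
    exact ⟨hb, pos_of_mul_pos_right (a := orient pos z x b) (by linarith) h2.ccw.le⟩
  · have ha := not_right hx
    have := mul_pos h3 hx
    have := mul_pos h2.ccw ha
    exact ⟨neg_of_mul_neg_right (a := orient pos z a x) (by linarith) h1.ccw.le, ha⟩

lemma eq_or_eq_of_blockedBy_of_blocked (hT : IsTriangulation pos T) {z x a b x' : V}
    (h : BlockedBy pos T z x a b) (hx' : Blocked pos T z x') (hne : x' ≠ x) :
    x' = a ∨ x' = b := by
  by_contra! hcon
  obtain ⟨a', b', h1', h2', h3'⟩ := hx'
  have hxa' : a' ≠ x := by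
    rintro rfl
    exact hcon.2 (hT.face_unique h1' h.face_left)
  have hxb' : b' ≠ x := by
    rintro rfl
    exact hcon.1 (hT.face_unique h2'.rot.rot h.face_right.rot.rot)
  have left_of_b : ∀ e, T.Adj z e → e ≠ x → 0 ≤ orient pos z b e := by
    intro e he hex
    by_cases hea : e = a
    · exact hea ▸ h.wedge.le
    by_cases heb : e = b
    · simp [heb]
    exact (hT.wedge_of_blockedBy h he hea hex heb).1.le
  have plucker := orient_plucker (pos := pos) z a' x' b' b
  have pa := mul_nonneg h2'.ccw.le (left_of_b a' h1'.adj_ab hxa')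
  have px := mul_pos h3' (hT.wedge_of_blockedBy h h2'.adj_ab hcon.1 hne hcon.2).1
  have pb := mul_nonneg h1'.ccw.le (left_of_b b' h2'.adj_ca.symm hxb')
  linarith

lemma eq_of_blockedBy_blocked (hT : IsTriangulation pos T) {z x a b e : V}
    (h : BlockedBy pos T z x a b) (ha : Blocked pos T z a) (hb : Blocked pos T z b)
    (he : T.Adj z e) : e = x ∨ e = a ∨ e = b := by
  by_contra! hcon
  obtain ⟨hbe, hea⟩ := hT.wedge_of_blockedBy h he hcon.2.1 hcon.1 hcon.2.2
  obtain ⟨a', b', ha'⟩ := ha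
  have hab : b ≠ a := by rintro rfl; simpa using h.wedge
  obtain rfl : x = b' := hT.face_unique h.face_right ha'.face_left
  rcases hT.eq_or_eq_of_blockedBy_of_blocked ha' hb hab with rfl | rfl
  · exact hT.not_adj_in_wedge ha'.face_right he hbe hea
  · exact h.face_left.adj_bc.ne rfl

lemma eq_of_three_blocked (hT : IsTriangulation pos T) {z x₁ x₂ x₃ e : V}
    (h₁ : Blocked pos T z x₁) (h₂ : Blocked pos T z x₂) (h₃ : Blocked pos T z x₃)
    (h₁₂ : x₁ ≠ x₂) (h₁₃ : x₁ ≠ x₃) (h₂₃ : x₂ ≠ x₃) (he : T.Adj z e) :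
    e = x₁ ∨ e = x₂ ∨ e = x₃ := by
  obtain ⟨a, b, h⟩ := h₁
  rcases hT.eq_or_eq_of_blockedBy_of_blocked h h₂ h₁₂.symm with rfl | rfl <;>
    rcases hT.eq_or_eq_of_blockedBy_of_blocked h h₃ h₁₃.symm with rfl | rfl
  · exact absurd rfl h₂₃
  · exact hT.eq_of_blockedBy_blocked h h₂ h₃ he
  · exact (hT.eq_of_blockedBy_blocked h h₃ h₂ he).imp_right Or.symm
  · exact absurd rfl h₂₃

end IsTriangulation

end Darts

/-! ### Common points of edges and flips -/

section CommonPoint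

variable {V : Type*} {pos : V → Plane} {T : SimpleGraph V}

lemma GenPos.eq_or_eq_of_orient_eq_zero (hg : GenPos pos) {r s p : V} (hrs : r ≠ s)
    (hp : orient pos r s p = 0) : p = r ∨ p = s := by
  by_contra! h
  exact hg r s p hrs h.2.symm h.1.symm hp

lemma GenPos.edge_eq_of_orient_eq_zero (hg : GenPos pos) {p q r s : V} (hpq : p ≠ q) (hrs : r ≠ s)
    (hp : orient pos r s p = 0) (hq : orient pos r s q = 0) : s(p, q) = s(r, s) := by
  rcases hg.eq_or_eq_of_orient_eq_zero hrs hp with rfl | rfl <;>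
    rcases hg.eq_or_eq_of_orient_eq_zero hrs hq with rfl | rfl
  · exact absurd rfl hpq
  · rfl
  · exact Sym2.eq_swap
  · exact absurd rfl hpq

lemma GenPos.crosses_or_eq_of_common_point (hg : GenPos pos) {p q r s : V} (hpq : p ≠ q)
    (hrs : r ≠ s) {t u : ℝ} (ht0 : 0 < t) (ht1 : t < 1) (hu0 : 0 < u) (hu1 : u < 1)
    (h : (1 - t) • pos p + t • pos q = (1 - u) • pos r + u • pos s) :
    Crosses pos p q r s ∨ s(p, q) = s(r, s) := by
  refine or_iff_not_imp_right.2 fun hne => ?_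
  have hline := orient_combination h r s
  simp only [orient_self_mid, orient_self_right, mul_zero, add_zero] at hline
  have hp : orient pos r s p ≠ 0 := fun hp => by
    have hq : orient pos r s q = 0 := by simpa [hp, ht0.ne'] using hline
    exact hne (hg.edge_eq_of_orient_eq_zero hpq hrs hp hq)
  have hq : orient pos r s q ≠ 0 := fun hq => hp (by simpa [hq, sub_ne_zero.2 ht1.ne'] using hline)
  refine Crosses.of_combination hg ht0 ht1 hu0 hu1 h hpq hrs ?_ ?_ ?_ <;>
    rintro rfl <;> simp at hp hq

lemma IsTriangulation.eq_of_common_point (hT : IsTriangulation pos T) {p q r s : V}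
    (hpq : T.Adj p q) (hrs : T.Adj r s) {t u : ℝ} (ht0 : 0 < t) (ht1 : t < 1) (hu0 : 0 < u)
    (hu1 : u < 1) (h : (1 - t) • pos p + t • pos q = (1 - u) • pos r + u • pos s) :
    s(p, q) = s(r, s) :=
  (hT.genPos.crosses_or_eq_of_common_point hpq.ne hrs.ne ht0 ht1 hu0 hu1 h).resolve_left
    (hT.noncrossing p q r s hpq hrs)

lemma crosses_of_convex {z z' a b : V} (ha : 0 < orient pos z' z a) (hb : 0 < orient pos z z' b)
    (hz : 0 < orient pos z a b) (hz' : 0 < orient pos z' b a) : Crosses pos a b z z' := by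
  constructor
  · rw [orient_rot z a b, orient_rev z' b a]
    exact mul_neg_of_pos_of_neg hz (by linarith)
  · rw [orient_swap' z' z a]
    exact mul_neg_of_neg_of_pos (by linarith) hb

/-- A segment from the apex `a` of a face over `zz'` to `b`, beyond `zz'`, runs inside the face
until it crosses `zz'`, so no edge meets it there. -/
lemma IsTriangulation.param_le_of_common_point (hT : IsTriangulation pos T) {z z' a b p q : V}
    (ha : IsFace pos T z' z a) (hb : orient pos z' z b < 0) (hz : 0 < orient pos z a b)
    (hz' : 0 < orient pos z' b a) (hpq : T.Adj p q) {t s t' s' : ℝ} (ht0 : 0 < t) (hs0 : 0 < s)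
    (hs1 : s < 1) (h : (1 - t) • pos a + t • pos b = (1 - s) • pos p + s • pos q)
    (h' : (1 - t') • pos a + t' • pos b = (1 - s') • pos z + s' • pos z') : t' ≤ t := by
  by_contra! hlt
  have hzz := orient_combination h' z' z
  simp only [orient_self_mid, orient_self_right, mul_zero, add_zero] at hzz
  refine hT.not_insideAt_face ha hpq ⟨hs0, hs1, ?_, ?_, ?_⟩ <;> rw [← orient_combination h]
  · simpa using mul_pos ht0 hz
  · simpa [orient_rot' z' b a] using mul_pos ht0 hz'
  · have : 0 < (t' - t) * (orient pos z' z a - orient pos z' z b) :=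
      mul_pos (by linarith) (by linarith [ha.ccw])
    linarith

lemma IsTriangulation.edge_eq_of_crosses_flip (hT : IsTriangulation pos T) {z z' a b p q : V}
    (hb : IsFace pos T z z' b) (ha : IsFace pos T z' z a) (hz : 0 < orient pos z a b)
    (hz' : 0 < orient pos z' b a) (hpq : T.Adj p q) (hcr : Crosses pos a b p q) :
    s(p, q) = s(z, z') := by
  obtain ⟨t, s, ht0, ht1, hs0, hs1, h⟩ := hcr.exists_combination
  obtain ⟨t', s', -, -, hs0', hs1', h'⟩ :=
    (crosses_of_convex ha.ccw hb.ccw hz hz').exists_combination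
  have reverse : ∀ {r u : ℝ} {c d : V}, (1 - r) • pos a + r • pos b = (1 - u) • pos c + u • pos d →
      (1 - (1 - r)) • pos b + (1 - r) • pos a = (1 - u) • pos c + u • pos d := fun hr => by
    rw [← hr, sub_sub_cancel, add_comm]
  have ha' : orient pos z z' a < 0 := by rw [orient_swap' z' z]; exact neg_neg_of_pos ha.ccw
  have hb' : orient pos z' z b < 0 := by rw [orient_swap' z z']; exact neg_neg_of_pos hb.ccw
  have hle := hT.param_le_of_common_point ha hb' hz hz' hpq ht0 hs0 hs1 h h'
  have hge := hT.param_le_of_common_point (t' := 1 - t') (s' := 1 - s') hb ha' hz' hz hpq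
    (sub_pos.2 ht1) hs0 hs1 (reverse h) (by rw [reverse h', sub_sub_cancel, add_comm])
  obtain rfl : t = t' := by linarith
  exact hT.eq_of_common_point hpq hb.adj_ab hs0 hs1 hs0' hs1' (h.symm.trans h')

/-! ### Horizontal order -/

/-- The value `m` lies strictly between `u` and `w`, in either order. -/
def Between (u m w : ℝ) : Prop := (u < m ∧ m < w) ∨ (w < m ∧ m < u)

lemma between_or_between {a b u w t s : ℝ} (ht0 : 0 < t) (ht1 : t < 1) (hs0 : 0 < s) (hs1 : s < 1)
    (hau : a ≠ u) (haw : a ≠ w) (hbu : b ≠ u) (hbw : b ≠ w) (hle : |a - b| ≤ |u - w|)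
    (h : (1 - t) * a + t * b = (1 - s) * u + s * w) : Between u a w ∨ Between u b w := by
  wlog hab : a ≤ b generalizing a b t
  · exact (this (sub_pos.2 ht1) (by linarith) hbu hbw hau haw (abs_sub_comm b a ▸ hle)
      (by linarith) (not_le.1 hab).le).symm
  wlog huw : u ≤ w generalizing u w s
  · exact (this (sub_pos.2 hs1) (by linarith) haw hau hbw hbu (abs_sub_comm w u ▸ hle)
      (by linarith) (not_le.1 huw).le).imp Or.symm Or.symm
  rw [abs_of_nonpos (by linarith), abs_of_nonpos (by linarith)] at hle
  by_contra! hcon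
  simp only [Between, not_or, not_and, not_lt] at hcon
  have ha := mul_nonneg ht0.le (sub_nonneg.2 hab)
  have hb := mul_nonneg (sub_nonneg.2 ht1.le) (sub_nonneg.2 hab)
  have hu := mul_nonneg hs0.le (sub_nonneg.2 huw)
  have hw := mul_nonneg (sub_nonneg.2 hs1.le) (sub_nonneg.2 huw)
  rcases lt_or_gt_of_ne hau with h1 | h1
  · rcases lt_or_gt_of_ne hbu with h2 | h2
    · linarith
    · have := lt_of_le_of_ne (hcon.2.1 h2) hbw.symm
      linarith
  · have := lt_of_le_of_ne (hcon.1.1 h1) haw.symm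
    linarith

lemma Crosses.exists_between {ℓ : Plane →ₗ[ℝ] ℝ} (hℓ : Function.Injective (ℓ ∘ pos)) {a b z z' : V}
    (h : Crosses pos a b z z')
    (hle : |ℓ (pos a) - ℓ (pos b)| ≤ |ℓ (pos z) - ℓ (pos z')|) :
    Between (ℓ (pos z)) (ℓ (pos a)) (ℓ (pos z')) ∨
      Between (ℓ (pos z)) (ℓ (pos b)) (ℓ (pos z')) := by
  obtain ⟨-, -, haz, haz', hbz, hbz'⟩ := h.ne
  obtain ⟨t, s, ht0, ht1, hs0, hs1, hx⟩ := h.exists_combination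
  exact between_or_between ht0 ht1 hs0 hs1 (hℓ.ne haz) (hℓ.ne haz') (hℓ.ne hbz) (hℓ.ne hbz') hle
    (by simpa using congr(ℓ $hx))

end CommonPoint

/-! ### Neighbours on both sides -/

section Visibility

variable {V : Type*} {pos : V → Plane} {T : SimpleGraph V}

lemma exists_first_in_wedge {v c q : V} {S : Set V} (hfin : S.Finite) (hS : S.Nonempty)
    (hside : ∀ d ∈ S, 0 < orient pos v c q * orient pos v c d) :
    ∃ d ∈ S, ∀ e ∈ S, 0 ≤ orient pos v c q * orient pos v d e := by
  rcases le_or_gt 0 (orient pos v c q) with hσ | hσ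
  · obtain ⟨d, hd, hfirst⟩ := exists_clockwise_most (pos := pos) (v := v) (c := c) hfin hS
      fun d hd e he => mul_pos (pos_of_mul_pos_right (hside d hd) hσ)
        (pos_of_mul_pos_right (hside e he) hσ)
    refine ⟨d, hd, fun e he => mul_nonneg hσ ?_⟩
    rw [orient_swap, neg_nonneg]
    exact hfirst e he
  · obtain ⟨d, hd, hfirst⟩ := exists_counterclockwise_most (pos := pos) (v := v) (c := c) hfin hS
      fun d hd e he => mul_pos_of_neg_of_neg (neg_of_mul_pos_right (hside d hd) hσ.le)
        (neg_of_mul_pos_right (hside e he) hσ.le)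
    refine ⟨d, hd, fun e he => mul_nonneg_of_nonpos_of_nonpos hσ.le ?_⟩
    rw [orient_swap, neg_nonpos]
    exact hfirst e he

lemma exists_root {f₀ f₁ u : ℝ} (hu : 0 < u) (hf : 0 < (1 - u) * f₀ + u * f₁) (h₀ : f₀ ≤ 0) :
    ∃ w, 0 ≤ w ∧ w < u ∧ (1 - w) * f₀ + w * f₁ = 0 ∧ ∀ r, w < r → 0 < (1 - r) * f₀ + r * f₁ := by
  have slope : 0 < f₁ - f₀ :=
    pos_of_mul_pos_right (by linarith : 0 < u * (f₁ - f₀)) hu.le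
  have root : f₀ / (f₀ - f₁) * (f₁ - f₀) = -f₀ := by
    rw [← neg_sub f₁ f₀, div_neg, neg_mul, div_mul_cancel₀ _ slope.ne']
  have after : ∀ r, f₀ / (f₀ - f₁) < r → 0 < (1 - r) * f₀ + r * f₁ := fun r hr => by
    linarith [mul_pos (sub_pos.2 hr) slope]
  refine ⟨f₀ / (f₀ - f₁), div_nonneg_of_nonpos h₀ (by linarith), not_le.1 fun hle => ?_,
    by linarith, after⟩
  linarith [mul_nonneg (sub_nonneg.2 hle) slope.le]

/-- Two affine functions which are positive at `u` and not both nonnegative at `0`: the last point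
at which one of them vanishes. -/
lemma exists_last_root {f₀ f₁ g₀ g₁ u : ℝ} (hu0 : 0 < u) (hf : 0 < (1 - u) * f₀ + u * f₁)
    (hg : 0 < (1 - u) * g₀ + u * g₁) (h₀ : 0 < f₀ → g₀ < 0) :
    ∃ w, 0 ≤ w ∧ w < u ∧
      (((1 - w) * f₀ + w * f₁ = 0 ∧ 0 ≤ (1 - w) * g₀ + w * g₁) ∨
        (0 < (1 - w) * f₀ + w * f₁ ∧ (1 - w) * g₀ + w * g₁ = 0)) := by
  rcases le_or_gt f₀ 0 with hf₀ | hf₀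
  · obtain ⟨w, hw0, hwu, hw, after_w⟩ := exists_root hu0 hf hf₀
    rcases le_or_gt 0 ((1 - w) * g₀ + w * g₁) with hgw | hgw
    · exact ⟨w, hw0, hwu, .inl ⟨hw, hgw⟩⟩
    have hg₀ : g₀ ≤ 0 := by
      refine not_lt.1 fun hg₀ => ?_
      have := mul_pos (sub_pos.2 hwu) hg₀
      have := mul_nonneg hw0 hg.le
      have := mul_neg_of_pos_of_neg hu0 hgw
      linarith
    obtain ⟨w', hw0', hwu', hw', after_w'⟩ := exists_root hu0 hg hg₀
    refine ⟨w', hw0', hwu', .inr ⟨after_w w' (lt_of_le_of_ne (not_lt.1 fun h => ?_) ?_), hw'⟩⟩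
    · exact (after_w' w h).not_gt hgw
    · rintro rfl
      exact hgw.ne hw'
  · obtain ⟨w, hw0, hwu, hw, -⟩ := exists_root hu0 hg (h₀ hf₀).le
    refine ⟨w, hw0, hwu, .inr ⟨?_, hw⟩⟩
    have := mul_pos (sub_pos.2 hwu) hf₀
    have := mul_nonneg hw0 hf.le
    exact pos_of_mul_pos_right (by linarith : 0 < u * ((1 - w) * f₀ + w * f₁)) hu0.le

lemma exists_combination_of_orient_eq_zero {v c q r s : V} {w : ℝ} (hq : orient pos v c q ≠ 0)
    (h : (1 - w) * orient pos v c r + w * orient pos v c s = 0) :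
    ∃ t : ℝ, (1 - t) • pos v + t • pos c = (1 - w) • pos r + w • pos s := by
  refine ⟨((1 - w) * orient pos q v r + w * orient pos q v s) / orient pos v c q, ?_⟩
  have hr := orient_bary_smul (pos := pos) v c q r
  have hs := orient_bary_smul (pos := pos) v c q s
  have hr' := orient_sum (pos := pos) v c q r
  have hs' := orient_sum (pos := pos) v c q s
  ext i
  have hri := congr($hr i)
  have hsi := congr($hs i)
  simp only [PiLp.add_apply, PiLp.smul_apply, smul_eq_mul] at hri hsi ⊢
  field_simp
  linear_combination (1 - w) * hri + w * hsi - pos v i * ((1 - w) * hr' + w * hs')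
    + (pos v i - pos q i) * h

variable (pos T) in
/-- Walking from `v` to `c`, the first edge that is crossed is `pq`, at the point
`(1 - t) v + t c = (1 - s) p + s q`. -/
structure FirstCrossing (v c p q : V) (t s : ℝ) : Prop where
  adj : T.Adj p q
  crosses : Crosses pos v c p q
  pos_left : 0 < t
  left_lt_one : t < 1
  pos_right : 0 < s
  right_lt_one : s < 1
  combination : (1 - t) • pos v + t • pos c = (1 - s) • pos p + s • pos q
  first : ∀ (p' q' : V) (t' s' : ℝ), T.Adj p' q' → 0 < t' → t' < 1 → 0 < s' → s' < 1 →
    (1 - t') • pos v + t' • pos c = (1 - s') • pos p' + s' • pos q' → t ≤ t'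

lemma FirstCrossing.symm {v c p q : V} {t s : ℝ} (h : FirstCrossing pos T v c p q t s) :
    FirstCrossing pos T v c q p t (1 - s) where
  adj := h.adj.symm
  crosses := h.crosses.swap_right
  pos_left := h.pos_left
  left_lt_one := h.left_lt_one
  pos_right := sub_pos.2 h.right_lt_one
  right_lt_one := by linarith [h.pos_right]
  combination := by rw [h.combination, sub_sub_cancel, add_comm]
  first := h.first

namespace IsTriangulation

lemma exists_firstCrossing [Finite V] (hT : IsTriangulation pos T) {v c : V} (hvc : v ≠ c)
    (hnot : ¬ T.Adj v c) : ∃ p q t s, FirstCrossing pos T v c p q t s := by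
  have param_eq : ∀ {p q : V} {t s : ℝ}, Crosses pos v c p q →
      (1 - t) • pos v + t • pos c = (1 - s) • pos p + s • pos q →
        orient pos p q v / (orient pos p q v - orient pos p q c) = t := fun {p q t s} hcr h => by
    have hpq := orient_combination h p q
    simp only [orient_self_mid, orient_self_right, mul_zero, add_zero] at hpq
    have : orient pos p q v - orient pos p q c ≠ 0 := fun h0 =>
      hcr.2.not_ge (by rw [sub_eq_zero.1 h0]; exact mul_self_nonneg _)
    rw [div_eq_iff this]
    linear_combination hpq
  obtain ⟨p₀, q₀, hpq₀, hcr₀⟩ : ∃ p q, T.Adj p q ∧ Crosses pos v c p q := by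
    by_contra! h
    exact hnot (hT.maximal v c hvc h)
  obtain ⟨⟨p, q⟩, ⟨hpq, hcr⟩, hmin⟩ := (Set.toFinite
    {e : V × V | T.Adj e.1 e.2 ∧ Crosses pos v c e.1 e.2}).exists_minimalFor
      (fun e => orient pos e.1 e.2 v / (orient pos e.1 e.2 v - orient pos e.1 e.2 c)) _
      ⟨(p₀, q₀), hpq₀, hcr₀⟩
  obtain ⟨t, s, ht0, ht1, hs0, hs1, h⟩ := hcr.exists_combination
  refine ⟨p, q, t, s, hpq, hcr, ht0, ht1, hs0, hs1, h,
    fun p' q' t' s' hpq' ht0' ht1' hs0' hs1' h' => ?_⟩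
  rcases hT.genPos.crosses_or_eq_of_common_point hvc hpq'.ne ht0' ht1' hs0' hs1' h' with hcr' | heq
  · rw [← param_eq hcr h, ← param_eq hcr' h']
    exact le_of_not_gt fun hlt => (hmin (j := (p', q')) ⟨hpq', hcr'⟩ hlt.le).not_gt hlt
  · exact absurd ((T.adj_congr_of_sym2 heq).2 hpq') hnot

end IsTriangulation

namespace FirstCrossing

variable {v c p q d r s : V} {t u w x y : ℝ}

lemma false_of_hits_ray (hT : IsTriangulation pos T) (h : FirstCrossing pos T v c p q t x)
    (hrs : T.Adj r s) (hne : s(r, s) ≠ s(p, q)) (hw0 : 0 ≤ w) (hw1 : w < 1)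
    (hd : 0 < orient pos v c q * orient pos v c d)
    (hvd : orient pos v c q * ((1 - w) * orient pos v d r + w * orient pos v d s) < 0)
    (hvc : (1 - w) * orient pos v c r + w * orient pos v c s = 0)
    (hpq : 0 ≤ orient pos p q v * ((1 - w) * orient pos p q r + w * orient pos p q s)) : False := by
  have hx := orient_combination h.combination p q
  simp only [orient_self_mid, orient_self_right, mul_zero, add_zero] at hx
  obtain ⟨y, hy⟩ := exists_combination_of_orient_eq_zero (right_ne_zero_of_mul h.crosses.1.ne) hvc
  have hyd := orient_combination hy v d
  rw [orient_self_mid, mul_zero, zero_add, orient_swap v c d] at hyd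
  rw [← hyd] at hvd
  rw [← orient_combination hy p q] at hpq
  have hy0 : 0 < y := pos_of_mul_pos_left (b := orient pos v c q * orient pos v c d)
    (by linarith) hd.le
  have hyt : y ≤ t := by
    have hv : 0 < orient pos p q v ^ 2 := by
      have := left_ne_zero_of_mul h.crosses.2.ne
      positivity
    have : (t - y) * orient pos p q v ^ 2 = t * (orient pos p q v *
        ((1 - y) * orient pos p q v + y * orient pos p q c)) := by
      linear_combination -y * orient pos p q v * hx
    have := mul_nonneg h.pos_left.le hpq
    exact sub_nonneg.1 (nonneg_of_mul_nonneg_left (by linarith) hv)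
  have hy1 := hyt.trans_lt h.left_lt_one
  have hw0 : 0 < w := by
    refine lt_of_le_of_ne hw0 ?_
    rintro rfl
    have hcd := right_ne_zero_of_mul hd.ne'
    rw [sub_zero, one_mul, zero_mul, add_zero] at hvc hyd
    rcases hT.genPos.eq_or_eq_of_orient_eq_zero h.crosses.ne.1 hvc with rfl | rfl
    · simp [hcd, hy0.ne'] at hyd
    · rw [orient_swap _ r d] at hyd
      exact hy1.ne (mul_right_cancel₀ (neg_ne_zero.2 hcd) (hyd.trans (one_mul _).symm))
  obtain rfl : y = t := hyt.antisymm (h.first r s y w hrs hy0 hy1 hw0 hw1 hy)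
  exact hne (hT.eq_of_common_point hrs h.adj hw0 hw1 h.pos_right h.right_lt_one
    (hy.symm.trans h.combination))

lemma right_lt_of_same_side (h : FirstCrossing pos T v c p q t x)
    (hvc : 0 < orient pos v c q * ((1 - y) * orient pos v c p + y * orient pos v c q)) :
    x < y := by
  have hx := orient_combination h.combination v c
  simp only [orient_self_mid, orient_self_right, mul_zero, add_zero] at hx
  have hq : 0 < orient pos v c q ^ 2 := by
    have := right_ne_zero_of_mul h.crosses.1.ne
    positivity
  have : (y - x) * orient pos v c q ^ 2 = (1 - x) * (orient pos v c q *
      ((1 - y) * orient pos v c p + y * orient pos v c q)) := by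
    linear_combination (1 - y) * orient pos v c q * hx
  have := mul_pos (sub_pos.2 h.right_lt_one) hvc
  exact sub_pos.1 (pos_of_mul_pos_left (by linarith) hq.le)

lemma lt_one_of_opposite_side (h : FirstCrossing pos T v c p q t x)
    (hd : 0 < orient pos v c q * orient pos v c d)
    (hq : 0 ≤ orient pos v c q * orient pos v d q) (hxy : x ≤ y)
    (hvd : orient pos v c q * ((1 - y) * orient pos v d p + y * orient pos v d q) < 0) :
    y < 1 := by
  have hx := orient_combination h.combination v d
  simp only [orient_self_mid, mul_zero, zero_add, orient_swap v c d] at hx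
  refine not_le.1 fun hy1 => ?_
  have : 0 ≤ (y - 1) * (t * (orient pos v c q * orient pos v c d)) :=
    mul_nonneg (sub_nonneg.2 hy1) (mul_nonneg h.pos_left.le hd.le)
  have := mul_nonneg (sub_nonneg.2 hxy) hq
  have := mul_neg_of_pos_of_neg (sub_pos.2 h.right_lt_one) hvd
  have e : (1 - x) * (orient pos v c q * ((1 - y) * orient pos v d p + y * orient pos v d q)) =
      (y - 1) * (t * (orient pos v c q * orient pos v c d))
        + (y - x) * (orient pos v c q * orient pos v d q) := by
    linear_combination (y - 1) * orient pos v c q * hx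
  linarith

lemma false_of_hits_edge (hT : IsTriangulation pos T) (h : FirstCrossing pos T v c p q t x)
    (hrs : T.Adj r s) (hne : s(r, s) ≠ s(p, q)) (hw0 : 0 ≤ w) (hw1 : w < 1)
    (hd : 0 < orient pos v c q * orient pos v c d)
    (hq : 0 ≤ orient pos v c q * orient pos v d q)
    (hvd : orient pos v c q * ((1 - w) * orient pos v d r + w * orient pos v d s) < 0)
    (hvc : 0 < orient pos v c q * ((1 - w) * orient pos v c r + w * orient pos v c s))
    (hpq : (1 - w) * orient pos p q r + w * orient pos p q s = 0) : False := by
  obtain ⟨y, hy⟩ := exists_combination_of_orient_eq_zero (left_ne_zero_of_mul h.crosses.2.ne) hpq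
  have hyc := orient_combination hy v c
  have hyd := orient_combination hy v d
  rw [← hyd] at hvd
  rw [← hyc] at hvc
  have hxy := h.right_lt_of_same_side hvc
  have hy1 := h.lt_one_of_opposite_side hd hq hxy.le hvd
  have hy0 := h.pos_right.trans hxy
  have hw0 : 0 < w := by
    refine lt_of_le_of_ne hw0 ?_
    rintro rfl
    have hpq' : orient pos v c q - orient pos v c p ≠ 0 := fun h0 =>
      h.crosses.1.not_ge (by rw [sub_eq_zero.1 h0]; exact mul_self_nonneg _)
    rw [sub_zero, one_mul, zero_mul, add_zero] at hpq hyc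
    rcases hT.genPos.eq_or_eq_of_orient_eq_zero h.adj.ne hpq with rfl | rfl
    · exact mul_ne_zero hy0.ne' hpq' (by linear_combination hyc)
    · exact mul_ne_zero (sub_pos.2 hy1).ne' hpq' (by linear_combination -hyc)
  exact hne (hT.eq_of_common_point hrs h.adj hw0 hw1 hy0 hy1 hy.symm)

/-- Among the vertices on one side of `vc` and not beyond `pq`, let `d` be the first one in angular
order at `v`. An edge crossing `vd` would have to leave the empty triangle before `vd` through `vc`
or through `pq`. -/
lemma not_crosses_of_first (hT : IsTriangulation pos T) (h : FirstCrossing pos T v c p q t x)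
    (hd : 0 < orient pos v c q * orient pos v c d) (hdpq : 0 ≤ orient pos p q v * orient pos p q d)
    (hfirst : ∀ e, 0 < orient pos v c q * orient pos v c e →
      0 ≤ orient pos p q v * orient pos p q e → 0 ≤ orient pos v c q * orient pos v d e)
    (hrs : T.Adj r s) (hr : orient pos v c q * orient pos v d r < 0) : ¬ Crosses pos v d r s := by
  intro hcr
  obtain ⟨y, u, hy0, hy1, hu0, hu1, hx⟩ := hcr.exists_combination
  have hxc := orient_combination hx v c
  have hxd := orient_combination hx v d
  have hxpq := orient_combination hx p q
  simp only [orient_self_mid, orient_self_right, mul_zero, add_zero, zero_add] at hxc hxd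
  have hqc := right_ne_zero_of_mul h.crosses.1.ne
  have hpv := left_ne_zero_of_mul h.crosses.2.ne
  have hτ : 0 < (1 - u) * (orient pos p q v * orient pos p q r)
      + u * (orient pos p q v * orient pos p q s) := by
    have : 0 < (1 - y) * orient pos p q v ^ 2 := mul_pos (sub_pos.2 hy1) (by positivity)
    have := mul_nonneg hy0.le hdpq
    linear_combination this + ‹0 < (1 - y) * _› + orient pos p q v * hxpq
  have hσ : 0 < (1 - u) * (orient pos v c q * orient pos v c r)
      + u * (orient pos v c q * orient pos v c s) := by
    linear_combination mul_pos hy0 hd + orient pos v c q * hxc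
  have hne : s(r, s) ≠ s(p, q) := by
    intro heq
    rcases Sym2.eq_iff.1 heq with ⟨rfl, rfl⟩ | ⟨rfl, rfl⟩ <;> simp at hτ
  obtain ⟨w, hw0, hwu, hw⟩ := exists_last_root hu0 hσ hτ
    fun hr' => not_le.1 fun hr'' => (hfirst r hr' hr'').not_gt hr
  have hwd : orient pos v c q * ((1 - w) * orient pos v d r + w * orient pos v d s) < 0 := by
    refine neg_of_mul_neg_right (a := u) ?_ hu0.le
    linear_combination mul_neg_of_pos_of_neg (sub_pos.2 hwu) hr - w * orient pos v c q * hxd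
  simp only [mul_left_comm _ (orient pos v c q), mul_left_comm _ (orient pos p q v), ← mul_add,
    mul_eq_zero, hqc, hpv, false_or] at hw
  rcases hw with ⟨hw, hw'⟩ | ⟨hw, hw'⟩
  · exact h.false_of_hits_ray hT hrs hne hw0 (hwu.trans hu1) hd hwd hw hw'
  · have hq := hfirst q (mul_self_pos.2 hqc) (by simp)
    exact h.false_of_hits_edge hT hrs hne hw0 (hwu.trans hu1) hd hq hwd hw hw'

lemma adj_of_first (hT : IsTriangulation pos T) (h : FirstCrossing pos T v c p q t x)
    (hd : 0 < orient pos v c q * orient pos v c d) (hdpq : 0 ≤ orient pos p q v * orient pos p q d)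
    (hfirst : ∀ e, 0 < orient pos v c q * orient pos v c e →
      0 ≤ orient pos p q v * orient pos p q e → 0 ≤ orient pos v c q * orient pos v d e) :
    T.Adj v d := by
  have hvd : v ≠ d := by rintro rfl; simp at hd
  refine hT.maximal v d hvd fun r s hrs hcr => ?_
  have hq : 0 < orient pos v c q ^ 2 := by
    have := left_ne_zero_of_mul hd.ne'
    positivity
  have hprod := mul_neg_of_pos_of_neg hq hcr.1
  rcases lt_or_ge (orient pos v c q * orient pos v d r) 0 with hr | hr
  · exact h.not_crosses_of_first hT hd hdpq hfirst hrs hr hcr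
  · exact h.not_crosses_of_first hT hd hdpq hfirst hrs.symm
      (neg_of_mul_neg_right (by linarith) hr) hcr.swap_right

end FirstCrossing

lemma IsTriangulation.exists_adj_left [Finite V] (hT : IsTriangulation pos T)
    {ℓ : Plane →ₗ[ℝ] ℝ} {v c : V} (hc : ℓ (pos c) < ℓ (pos v)) :
    ∃ d, T.Adj v d ∧ ℓ (pos d) < ℓ (pos v) := by
  by_cases hnot : T.Adj v c
  · exact ⟨c, hnot, hc⟩
  have hvc : v ≠ c := by rintro rfl; exact hc.false
  obtain ⟨p, q, t, x, h⟩ := hT.exists_firstCrossing hvc hnot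
  wlog hq : ℓ (pos q) < ℓ (pos v) generalizing p q x
  · refine this q p (1 - x) h.symm (not_le.1 fun hp => ?_)
    have hx := congr(ℓ $h.combination)
    simp only [map_add, map_smul, smul_eq_mul] at hx
    have := mul_pos h.pos_left (sub_pos.2 hc)
    have := mul_nonneg h.pos_right.le (sub_nonneg.2 (not_lt.1 hq))
    have := mul_nonneg (sub_pos.2 h.right_lt_one).le (sub_nonneg.2 hp)
    linarith
  have hqc := right_ne_zero_of_mul h.crosses.1.ne
  obtain ⟨d, ⟨hd, hdpq⟩, hfirst⟩ := exists_first_in_wedge (pos := pos) (v := v) (c := c) (q := q)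
    (S := {d | 0 < orient pos v c q * orient pos v c d ∧
      0 ≤ orient pos p q v * orient pos p q d}) (Set.toFinite _)
    ⟨q, mul_self_pos.2 hqc, by simp⟩ fun d hd => hd.1
  refine ⟨d, h.adj_of_first hT hd hdpq fun e he he' => hfirst e ⟨he, he'⟩, ?_⟩
  have hdq := hfirst q ⟨mul_self_pos.2 hqc, by simp⟩
  have hbary := congr(ℓ $(orient_bary_smul (pos := pos) v c q d))
  have hsum := orient_sum (pos := pos) v c q d
  simp only [map_add, map_smul, smul_eq_mul] at hbary
  have h1 := mul_nonneg hdq (sub_nonneg.2 hc.le)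
  have h2 := mul_pos hd (sub_pos.2 hq)
  refine sub_pos.1 (pos_of_mul_pos_right (a := orient pos v c q ^ 2) ?_ (sq_nonneg _))
  rw [orient_swap v q d] at h1
  rw [orient_swap' v q d] at hbary hsum
  linear_combination h1 + h2 - orient pos v c q * hbary + orient pos v c q * ℓ (pos v) * hsum

end Visibility

section Existence

variable {V : Type*} {pos : V → Plane}

variable (pos) in
/-- No two edges of the graph `G` cross each other. -/
def CrossingFree (G : SimpleGraph V) : Prop :=
  ∀ a b c d, G.Adj a b → G.Adj c d → ¬ Crosses pos a b c d

lemma CrossingFree.mono {G H : SimpleGraph V} (hH : CrossingFree pos H) (hle : G ≤ H) :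
    CrossingFree pos G := fun a b c d hab hcd => hH a b c d (hle hab) (hle hcd)

lemma CrossingFree.sup_edge {G : SimpleGraph V} (hG : CrossingFree pos G) {a b : V}
    (hab : ∀ c d, G.Adj c d → ¬ Crosses pos a b c d) :
    CrossingFree pos (G ⊔ SimpleGraph.edge a b) := by
  have main : ∀ p q r s, s(a, b) = s(p, q) → (G ⊔ SimpleGraph.edge a b).Adj r s →
      ¬ Crosses pos p q r s := by
    intro p q r s hpq hrs hcr
    obtain ⟨-, -, hpr, hps, -, -⟩ := hcr.ne
    rcases hrs with hrs | hrs
    · rcases Sym2.eq_iff.1 hpq with ⟨rfl, rfl⟩ | ⟨rfl, rfl⟩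
      · exact hab _ _ hrs hcr
      · exact hab _ _ hrs hcr.swap_left
    · rcases Sym2.eq_iff.1 (hpq.symm.trans ((SimpleGraph.adj_edge _ _).1 hrs).1) with h | h
      · exact hpr h.1
      · exact hps h.1
  intro p q r s hpq hrs hcr
  rcases hpq with hpq' | hpq'
  · rcases hrs with hrs' | hrs'
    · exact hG _ _ _ _ hpq' hrs' hcr
    · exact main _ _ _ _ ((SimpleGraph.adj_edge _ _).1 hrs').1 (.inl hpq') hcr.symm
  · exact main _ _ _ _ ((SimpleGraph.adj_edge _ _).1 hpq').1 hrs hcr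

lemma finsum_mem_edgeSet_sup_edge [Finite V] {G : SimpleGraph V} {a b : V} (hne : a ≠ b)
    (hab : ¬ G.Adj a b) (w : Sym2 V → ℝ) :
    ∑ᶠ e ∈ (G ⊔ SimpleGraph.edge a b).edgeSet, w e = w s(a, b) + ∑ᶠ e ∈ G.edgeSet, w e := by
  rw [SimpleGraph.edgeSet_sup, SimpleGraph.edgeSet_edge_of_ne hne, Set.union_singleton,
    finsum_mem_insert w (by simpa using hab) (Set.toFinite _)]

lemma finsum_mem_edgeSet_deleteEdges [Finite V] {G : SimpleGraph V} {a b : V} (hab : G.Adj a b)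
    (w : Sym2 V → ℝ) :
    w s(a, b) + ∑ᶠ e ∈ (G.deleteEdges {s(a, b)}).edgeSet, w e = ∑ᶠ e ∈ G.edgeSet, w e := by
  rw [SimpleGraph.edgeSet_deleteEdges,
    ← finsum_mem_insert w (fun h => h.2 rfl) (Set.toFinite _), Set.insert_sdiff_singleton,
    Set.insert_eq_of_mem (by simpa using hab)]

/-- An extension of maximal total weight. -/
lemma CrossingFree.exists_isTriangulation [Finite V] (hg : GenPos pos) {G : SimpleGraph V}
    (hG : CrossingFree pos G) (w : Sym2 V → ℝ) (hw : ∀ e, 0 < w e) :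
    ∃ T : SimpleGraph V, G ≤ T ∧ IsTriangulation pos T ∧
      ∀ z z' a b, T.Adj z z' → ¬ G.Adj z z' → Crosses pos a b z z' →
        (∀ p q, T.Adj p q → Crosses pos a b p q → s(p, q) = s(z, z')) →
        w s(a, b) ≤ w s(z, z') := by
  obtain ⟨T, ⟨hGT, hT⟩, hTmax⟩ :=
    (Set.toFinite {T : SimpleGraph V | G ≤ T ∧ CrossingFree pos T}).exists_maximalFor
      (fun T => ∑ᶠ e ∈ T.edgeSet, w e) _ ⟨G, le_rfl, hG⟩
  have hmax : ∀ T', G ≤ T' → CrossingFree pos T' →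
      ∑ᶠ e ∈ T'.edgeSet, w e ≤ ∑ᶠ e ∈ T.edgeSet, w e := fun T' h h' =>
    not_lt.1 fun hlt => (hTmax ⟨h, h'⟩ hlt.le).not_gt hlt
  refine ⟨T, hGT, ⟨hg, hT, fun a b hne hcr => ?_⟩, fun z z' a b hzz hzG hcr honly => ?_⟩
  · by_contra hab
    have hle := hmax _ (hGT.trans le_sup_left) (hT.sup_edge hcr)
    rw [finsum_mem_edgeSet_sup_edge hne hab] at hle
    exact ((hw _).trans_le (by linarith)).false
  · have hab : ¬ T.Adj a b := fun h => hT _ _ _ _ h hzz hcr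
    let T₀ := T.deleteEdges {s(z, z')}
    have hT₀T : T₀ ≤ T := T.deleteEdges_le _
    have hGT₀ : G ≤ T₀ := fun p q hpq => SimpleGraph.deleteEdges_adj.2 ⟨hGT hpq, fun h =>
      hzG ((SimpleGraph.adj_congr_of_sym2 G h).1 hpq)⟩
    have hcross : ∀ p q, T₀.Adj p q → ¬ Crosses pos a b p q := fun p q hpq h =>
      (SimpleGraph.deleteEdges_adj.1 hpq).2 (honly p q (hT₀T hpq) h)
    have hle := hmax _ (hGT₀.trans le_sup_left) ((hT.mono hT₀T).sup_edge hcross)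
    rw [finsum_mem_edgeSet_sup_edge hcr.ne.1 fun h => hab (hT₀T h)] at hle
    linarith [finsum_mem_edgeSet_deleteEdges hzz w]

namespace IsTriangulation

variable {T : SimpleGraph V} {u a b z : V}

lemma exists_faces_in_wedge [Finite V] (hT : IsTriangulation pos T) (ha : T.Adj u a)
    (hb : T.Adj u b) (hz : T.Adj u z) (hab : 0 < orient pos u a b) (haz : 0 < orient pos u a z)
    (hzb : 0 < orient pos u z b) : ∃ p q, IsFace pos T u p z ∧ IsFace pos T u z q ∧
      (p = a ∨ 0 < orient pos u a p) ∧ 0 < orient pos u p b ∧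
      0 < orient pos u a q ∧ (q = b ∨ 0 < orient pos u q b) := by
  obtain ⟨q, hq, hqb⟩ := hT.exists_face_left hz hb hzb
  obtain ⟨p, hp, hap⟩ := hT.exists_face_right hz ha (by rw [orient_swap]; exact neg_neg_of_pos haz)
  have hba : orient pos u b a < 0 := by rw [orient_swap]; exact neg_neg_of_pos hab
  refine ⟨p, q, hp, hq, hap, ?_, ?_, hqb⟩
  · rcases hap with rfl | hap
    · exact hab
    have hpl := orient_plucker (pos := pos) u a z b p
    rw [orient_swap u a p] at hpl
    have := mul_neg_of_neg_of_pos hba hp.ccw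
    have := mul_pos hzb hap
    exact pos_of_mul_pos_right (a := orient pos u a z) (by linarith) haz.le
  · rcases hqb with rfl | hqb
    · exact hab
    have hpl := orient_plucker (pos := pos) u a z b q
    rw [orient_swap u a q, orient_swap u z q] at hpl
    have := mul_neg_of_neg_of_pos hba hq.ccw
    have := mul_pos haz hqb
    exact pos_of_mul_pos_right (a := orient pos u z b) (by linarith) hzb.le

/-- The apexes of the faces on the two sides of `uz` are no farther from the line `ab` than `z`, and
`u` is: so `z` is a reflex vertex of the union of these faces. -/
lemma blocked_of_farthest [Finite V] (hT : IsTriangulation pos T) (ha : T.Adj u a)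
    (hb : T.Adj u b) (hab : 0 < orient pos u a b) (hz : Inside pos u a b z)
    (hmax : ∀ e, Inside pos u a b e → orient pos a b e ≤ orient pos a b z) :
    Blocked pos T z u := by
  have huz := hT.adj_of_farthest ha hb hz hmax
  have hsum := orient_sum (pos := pos) u a b z
  obtain ⟨hz_ab, hz_bu, hz_ua⟩ := hz
  obtain ⟨p, q, hp, hq, hap, hpb, haq, hqb⟩ := hT.exists_faces_in_wedge ha hb huz hab hz_ua
    (by rwa [← orient_rot'])
  have hle : ∀ e, (e = a ∨ 0 < orient pos u a e) → (e = b ∨ 0 < orient pos u e b) →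
      orient pos a b e ≤ orient pos a b z := by
    rintro e (rfl | hae) heb
    · simpa using hz_ab.le
    rcases heb with rfl | heb
    · simpa using hz_ab.le
    · refine le_of_not_gt fun hlt => hlt.not_ge (hmax e ⟨hz_ab.trans hlt, ?_, hae⟩)
      rwa [← orient_rot' u e b] at heb
  have hle_p := sub_nonneg.2 (hle p hap (.inr hpb))
  have hle_q := sub_nonneg.2 (hle q (.inr haq) hqb)
  have hlt_u : 0 < orient pos a b u - orient pos a b z := by
    rw [orient_rot u a b]; linarith
  have hpq : p ≠ q := by
    rintro rfl
    have := hp.ccw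
    rw [orient_swap] at this
    linarith [hq.ccw]
  refine ⟨q, p, hq.rot, hp.rot.rot, ?_⟩
  refine orient_pos_of_nonneg hT.genPos hp.adj_bc.ne.symm hpq hq.adj_bc.ne (not_lt.1 fun hneg => ?_)
  have hbary : orient pos u z q * (orient pos a b z - orient pos a b p)
      + orient pos u p z * (orient pos a b z - orient pos a b q)
        = orient pos z p q * (orient pos a b u - orient pos a b z) := by
    simp only [orient]; ring
  linarith [mul_nonneg hq.ccw.le hle_p, mul_nonneg hp.ccw.le hle_q,
    mul_neg_of_neg_of_pos hneg hlt_u]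

end IsTriangulation

variable (pos) in
/-- A polygon `P` with more than three vertices and a maximal compatible matching `M` of it, in
terms of the crossing relation. -/
structure PolygonMatching (P M : SimpleGraph V) : Prop where
  genPos : GenPos pos
  crossingFree : CrossingFree pos (P ⊔ M)
  matching : ∀ u v w, M.Adj u v → M.Adj u w → v = w
  ncard_neighborSet : ∀ v, (P.neighborSet v).ncard = 2
  connected : P.Connected
  cliqueFree : P.CliqueFree 3
  maximal : ∀ u v, u ≠ v → u ∉ M.support → v ∉ M.support → ¬ P.Adj u v →
    ∃ c d, (P ⊔ M).Adj c d ∧ Crosses pos u v c d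

variable {P M T : SimpleGraph V} {ℓ : Plane →ₗ[ℝ] ℝ}

variable (pos ℓ) in
/-- A triangulation `T` containing `P` and `M` such that an edge between matched vertices which is
neither in `P` nor in `M` can only be flipped to another such edge, and only to one of no larger
horizontal extent. The horizontal coordinate is a linear functional `ℓ`. -/
structure OptTriangulation (P M T : SimpleGraph V) : Prop extends IsTriangulation pos T where
  le : P ⊔ M ≤ T
  flip_opt : ∀ z z' a b, z ∈ M.support → z' ∈ M.support → T.Adj z z' → ¬ (P ⊔ M).Adj z z' →
    Crosses pos a b z z' → (∀ p q, T.Adj p q → Crosses pos a b p q → s(p, q) = s(z, z')) →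
    a ∈ M.support ∧ b ∈ M.support ∧ |ℓ (pos a) - ℓ (pos b)| ≤ |ℓ (pos z) - ℓ (pos z')|

-- The number of edges between matched vertices counts more than all horizontal extents.
lemma PolygonMatching.exists_optTriangulation [Finite V] (h : PolygonMatching pos P M) :
    ∃ T, OptTriangulation pos ℓ P M T := by
  classical
  let len : V → V → ℝ := fun a b => |ℓ (pos a) - ℓ (pos b)|
  obtain ⟨B, hB⟩ := (Set.finite_range fun p : V × V => len p.1 p.2).bddAbove
  have hB : ∀ a b, len a b ≤ B := fun a b => hB ⟨(a, b), rfl⟩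
  let w : Sym2 V → ℝ := Sym2.lift
    ⟨fun a b => (if a ∈ M.support ∧ b ∈ M.support then 0 else B + 1) + (len a b + 1), fun a b => by
      simp only [len, abs_sub_comm (ℓ (pos a)), and_comm]⟩
  have hw : ∀ a b, w s(a, b) =
    (if a ∈ M.support ∧ b ∈ M.support then 0 else B + 1) + (len a b + 1) := fun _ _ => rfl
  have hlen : ∀ a b, 0 ≤ len a b := fun _ _ => abs_nonneg _
  obtain ⟨T, hle, hT, hflip⟩ := h.crossingFree.exists_isTriangulation h.genPos w fun e => by
    induction e using Sym2.ind with
    | _ a b =>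
      rw [hw]
      split_ifs <;> linarith [hlen a b, hB a b]
  refine ⟨T, hT, hle, fun z z' a b hz hz' hzz hPM hcr honly => ?_⟩
  have hopt := hflip z z' a b hzz hPM hcr honly
  rw [hw a b, hw z z', if_pos (show z ∈ M.support ∧ z' ∈ M.support from ⟨hz, hz'⟩)] at hopt
  split_ifs at hopt with hab
  · exact ⟨hab.1, hab.2, by linarith⟩
  · linarith [hlen a b, hB z z']

lemma OptTriangulation.adj_of_notMem_support (hP : PolygonMatching pos P M)
    (hT : OptTriangulation pos ℓ P M T) {u v : V} (h : T.Adj u v) (hu : u ∉ M.support)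
    (hv : v ∉ M.support) : P.Adj u v := by
  by_contra hadj
  obtain ⟨c, d, hcd, hcr⟩ := hP.maximal u v h.ne hu hv hadj
  exact hT.noncrossing _ _ _ _ h (hT.le hcd) hcr

lemma PolygonMatching.exists_neighborSet_eq (hP : PolygonMatching pos P M) (u : V) :
    ∃ a b, P.neighborSet u = {a, b} ∧ 0 < orient pos u a b := by
  obtain ⟨a, b, hab, h⟩ := Set.ncard_eq_two.1 (hP.ncard_neighborSet u)
  have ha : P.Adj u a := h.ge (.inl rfl)
  have hb : P.Adj u b := h.ge (.inr rfl)
  rcases lt_or_gt_of_ne (hP.genPos u a b ha.ne hab hb.ne) with hneg | hpos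
  · exact ⟨b, a, by rw [h, Set.pair_comm], by rw [orient_swap]; exact neg_pos.2 hneg⟩
  · exact ⟨a, b, h, hpos⟩

lemma PolygonMatching.exists_inside (hP : PolygonMatching pos P M) {u a b : V}
    (hu : u ∉ M.support) (ha : a ∉ M.support) (hb : b ∉ M.support)
    (hN : P.neighborSet u = {a, b}) (hab : 0 < orient pos u a b) : ∃ d, Inside pos u a b d := by
  classical
  by_contra! hin
  have hua : P.Adj u a := hN.ge (.inl rfl)
  have hub : P.Adj u b := hN.ge (.inr rfl)
  have hNu : ∀ c, (P ⊔ M).Adj u c → c = a ∨ c = b := fun c hc =>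
    hc.elim (fun h => hN.le h) fun h => absurd ⟨c, h⟩ hu
  have hnot : ∀ c d, (P ⊔ M).Adj c d → Crosses pos a b c d → ¬ 0 < orient pos a b c := by
    intro c d hcd hcr hc
    obtain ⟨-, -, -, had, -, hbd⟩ := hcr.ne
    have hcu : c ≠ u := by
      rintro rfl
      exact (hNu d hcd).elim had.symm hbd.symm
    rcases hcr.exists_crosses_side hP.genPos hab hc hcu (hin c) with h | h
    · exact hP.crossingFree _ _ _ _ (.inl hua) hcd h
    · exact hP.crossingFree _ _ _ _ (.inl hub.symm) hcd h
  have hPab : ¬ P.Adj a b := fun h =>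
    hP.cliqueFree {u, a, b} (SimpleGraph.is3Clique_triple_iff.2 ⟨hua, hub, h⟩)
  obtain ⟨c, d, hcd, hcr⟩ := hP.maximal a b (by rintro rfl; simp at hab) ha hb hPab
  rcases mul_neg_iff.1 hcr.1 with h | h
  · exact hnot c d hcd hcr h.1
  · exact hnot d c hcd.symm hcr.swap_right h.2

lemma OptTriangulation.exists_blocked [Finite V] (hP : PolygonMatching pos P M)
    (hT : OptTriangulation pos ℓ P M T) {u : V} (hu : u ∉ M.support)
    (hN : ∀ a, P.Adj u a → a ∉ M.support) : ∃ z ∈ M.support, Blocked pos T z u := by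
  obtain ⟨a, b, hNu, hab⟩ := hP.exists_neighborSet_eq u
  have hua : P.Adj u a := hNu.ge (.inl rfl)
  have hub : P.Adj u b := hNu.ge (.inr rfl)
  have hTa := hT.le (.inl hua)
  have hTb := hT.le (.inl hub)
  obtain ⟨z, hz, hmax⟩ := (Set.toFinite {d | Inside pos u a b d}).exists_maximalFor
    (fun d => orient pos a b d) _ (hP.exists_inside hu (hN a hua) (hN b hub) hNu hab)
  have hmax' : ∀ e, Inside pos u a b e → orient pos a b e ≤ orient pos a b z := fun e he =>
    not_lt.1 fun h => (hmax he h.le).not_gt h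
  refine ⟨z, ?_, hT.blocked_of_farthest hTa hTb hab hz hmax'⟩
  by_contra hzM
  have huz := hT.adj_of_notMem_support hP (hT.adj_of_farthest hTa hTb hz hmax') hu hzM
  have hz_ab := hz.1
  rcases hNu.le huz with rfl | rfl <;> simp at hz_ab

end Existence

/-! ### Faces around a middle vertex -/

section Middle

variable {V : Type*} {pos : V → Plane} {T : SimpleGraph V} {ℓ : Plane →ₗ[ℝ] ℝ}

lemma exists_eq_coord_combination (ℓ : Plane →ₗ[ℝ] ℝ) :
    ∃ α β : ℝ, ∀ p : Plane, ℓ p = α * p 0 + β * p 1 := by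
  refine ⟨ℓ (EuclideanSpace.single 0 1), ℓ (EuclideanSpace.single 1 1), fun p => ?_⟩
  have hp : p = p 0 • EuclideanSpace.single 0 1 + p 1 • EuclideanSpace.single 1 1 := by
    ext i; fin_cases i <;> simp
  conv_lhs => rw [hp]
  simp [mul_comm]

lemma exists_steepest {v : V} {S : Set V} (hfin : S.Finite) (hS : S.Nonempty)
    (hright : ∀ d ∈ S, ℓ (pos v) < ℓ (pos d)) : ∃ r ∈ S, ∀ e ∈ S, orient pos v r e ≤ 0 := by
  obtain ⟨α, β, hℓ⟩ := exists_eq_coord_combination ℓ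
  let m : V → ℝ := fun d => α * pos d 1 - β * pos d 0
  obtain ⟨r, hr, hmax⟩ := hfin.exists_maximalFor
    (fun d => (m d - m v) / (ℓ (pos d) - ℓ (pos v))) S hS
  refine ⟨r, hr, fun e he => not_lt.1 fun hlt => ?_⟩
  have horient : (α ^ 2 + β ^ 2) * orient pos v r e =
      (ℓ (pos r) - ℓ (pos v)) * (m e - m v) - (ℓ (pos e) - ℓ (pos v)) * (m r - m v) := by
    simp only [hℓ, m, orient]; ring
  have hne : 0 < α ^ 2 + β ^ 2 := by
    refine (by positivity : 0 ≤ α ^ 2 + β ^ 2).lt_of_ne' fun h0 => ?_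
    have := hright r hr
    obtain rfl : α = 0 := by nlinarith
    obtain rfl : β = 0 := by nlinarith
    simp [hℓ] at this
  have hslope : (m r - m v) / (ℓ (pos r) - ℓ (pos v)) < (m e - m v) / (ℓ (pos e) - ℓ (pos v)) := by
    rw [div_lt_div_iff₀ (sub_pos.2 (hright r hr)) (sub_pos.2 (hright e he))]
    linarith [mul_pos hne hlt]
  exact (hmax he hslope.le).not_gt hslope

lemma IsTriangulation.right_cases [Finite V] (hT : IsTriangulation pos T)
    (hℓ : Function.Injective (ℓ ∘ pos)) (v : V) :
    (∃ b c, IsFace pos T v b c ∧ ℓ (pos v) < ℓ (pos b) ∧ ℓ (pos c) < ℓ (pos v)) ∨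
      (∃ r, Bare pos T v r ∧ ℓ (pos v) < ℓ (pos r)) ∨ ∀ d, ℓ (pos d) ≤ ℓ (pos v) := by
  by_cases hmax : ∀ d, ℓ (pos d) ≤ ℓ (pos v)
  · exact .inr (.inr hmax)
  push Not at hmax
  obtain ⟨c, hc⟩ := hmax
  obtain ⟨d, hvd, hd⟩ := hT.exists_adj_left (ℓ := -ℓ) (v := v) (c := c) (by simpa using hc)
  obtain ⟨r, ⟨hvr, hr⟩, hsteepest⟩ := exists_steepest (pos := pos) (ℓ := ℓ) (v := v)
    (S := {d | T.Adj v d ∧ ℓ (pos v) < ℓ (pos d)}) (Set.toFinite _) ⟨d, hvd, by simpa using hd⟩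
    fun d hd => hd.2
  by_cases hb : Bare pos T v r
  · exact .inr (.inl ⟨r, hb, hr⟩)
  obtain ⟨e, he⟩ := hT.exists_face_of_not_bare hvr hb
  refine .inl ⟨r, e, he, hr, (hℓ.ne he.adj_ca.ne).lt_or_gt.resolve_right fun hlt => ?_⟩
  exact (hsteepest e ⟨he.adj_ca.symm, hlt⟩).not_gt he.ccw

end Middle

/-! ### Counting faces -/

section Counting

variable {V : Type*}

/-- The number of pairs in the relation `r` with first entry in `S` and second entry in `S'`. -/
noncomputable def pairCard (r : V → V → Prop) (S S' : Set V) : ℕ :=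
  {p : V × V | r p.1 p.2 ∧ p.1 ∈ S ∧ p.2 ∈ S'}.ncard

lemma pairCard_flip (r : V → V → Prop) (S S' : Set V) :
    pairCard (flip r) S S' = pairCard r S' S :=
  Set.ncard_congr (fun p _ => p.swap) (fun _ hp => ⟨hp.1, hp.2.symm⟩)
    (fun _ _ _ _ h => Prod.swap_injective h)
    fun p hp => ⟨p.swap, ⟨hp.1, hp.2.symm⟩, p.swap_swap⟩

variable {pos : V → Plane} {T : SimpleGraph V} {ℓ : Plane →ₗ[ℝ] ℝ}

variable (pos T ℓ) in
/-- The faces, as triples of vertices in counterclockwise order, whose first vertex is the middle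
one with respect to `ℓ`; thus every face occurs once. -/
def midFaces : Set (V × V × V) :=
  {f | IsFace pos T f.1 f.2.1 f.2.2 ∧ Between (ℓ (pos f.2.1)) (ℓ (pos f.1)) (ℓ (pos f.2.2))}

lemma midFaces_neg : midFaces pos T (-ℓ) = midFaces pos T ℓ := by
  ext f
  simp [midFaces, Between, and_comm, or_comm]

/-- Moves the second vertex of a triple to the front. -/
def rotate : V × V × V ≃ V × V × V where
  toFun f := (f.2.1, f.2.2, f.1)
  invFun f := (f.2.2, f.1, f.2.1)

lemma rotate_notMem_midFaces {f : V × V × V} (hf : f ∈ midFaces pos T ℓ) :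
    rotate f ∉ midFaces pos T ℓ := by
  rintro ⟨-, hf'⟩
  have hf := hf.2
  simp only [rotate, Equiv.coe_fn_mk, Between] at hf hf'
  rcases hf with hf | hf <;> rcases hf' with hf' | hf' <;> linarith

variable [Finite V]

lemma pairCard_mono {r r' : V → V → Prop} {S S' : Set V}
    (h : ∀ a ∈ S, ∀ b ∈ S', r a b → r' a b) : pairCard r S S' ≤ pairCard r' S S' :=
  Set.ncard_le_ncard fun _ hp => ⟨h _ hp.2.1 _ hp.2.2 hp.1, hp.2⟩

lemma pairCard_or_le (r r' : V → V → Prop) (S S' : Set V) :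
    pairCard (fun a b => r a b ∨ r' a b) S S' ≤ pairCard r S S' + pairCard r' S S' := by
  refine (Set.ncard_le_ncard fun p hp => ?_).trans (Set.ncard_union_le _ _)
  exact hp.1.imp (fun h => ⟨h, hp.2⟩) fun h => ⟨h, hp.2⟩

lemma pairCard_or_flip_le (r : V → V → Prop) (S : Set V) :
    pairCard (fun a b => r a b ∨ r b a) S S ≤ 2 * pairCard r S S := by
  refine (pairCard_or_le r (flip r) S S).trans ?_
  rw [pairCard_flip, two_mul]

lemma pairCard_and_add_pairCard_and_not (r p : V → V → Prop) (S S' : Set V) :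
    pairCard (fun a b => r a b ∧ p a b) S S' + pairCard (fun a b => r a b ∧ ¬ p a b) S S'
      = pairCard r S S' := by
  rw [pairCard, pairCard, pairCard, ← Set.ncard_inter_add_ncard_sdiff_eq_ncard
    {q : V × V | r q.1 q.2 ∧ q.1 ∈ S ∧ q.2 ∈ S'} {q | p q.1 q.2}]
  congr 2 <;> ext q <;> simp only [Set.mem_ofPred_eq, Set.mem_inter_iff, Set.mem_sdiff] <;> tauto

lemma pairCard_add_compl_right (r : V → V → Prop) (S S' : Set V) :
    pairCard r S S' + pairCard r S S'ᶜ = pairCard r S Set.univ := by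
  rw [← pairCard_and_add_pairCard_and_not r (fun _ b => b ∈ S') S Set.univ]
  congr 1 <;> unfold pairCard <;> congr 1 <;> ext q <;>
    simp only [Set.mem_ofPred_eq, Set.mem_univ, Set.mem_compl_iff] <;> tauto

lemma pairCard_add_compl_left (r : V → V → Prop) (S S' : Set V) :
    pairCard r S S' + pairCard r Sᶜ S' = pairCard r Set.univ S' := by
  simpa only [pairCard_flip] using pairCard_add_compl_right (flip r) S' S

lemma pairCard_le_ncard {r : V → V → Prop} {S S' R : Set V}
    (h : ∀ a ∈ S, ∀ b ∈ S', r a b → a ∈ R) (hunique : ∀ a b b', r a b → r a b' → b = b') :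
    pairCard r S S' ≤ R.ncard :=
  Set.ncard_le_ncard_of_injOn Prod.fst (fun _ hp => h _ hp.2.1 _ hp.2.2 hp.1) fun p hp q hq hpq =>
    Prod.ext hpq (hunique _ _ _ hp.1 (by rw [hpq]; exact hq.1))

lemma ncard_le_pairCard {r : V → V → Prop} {S S' : Set V} (h : ∀ a ∈ S, ∃ b ∈ S', r a b) :
    S.ncard ≤ pairCard r S S' := by
  refine (Set.ncard_le_ncard fun a ha => ?_).trans (Set.ncard_image_le (f := Prod.fst))
  obtain ⟨b, hb, hab⟩ := h a ha
  exact ⟨(a, b), ⟨hab, ha, hb⟩, rfl⟩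

lemma IsTriangulation.natCard_le_of_right (hT : IsTriangulation pos T)
    (hℓ : Function.Injective (ℓ ∘ pos)) :
    Nat.card V ≤ {f ∈ midFaces pos T ℓ | ℓ (pos f.1) < ℓ (pos f.2.1)}.ncard
      + pairCard (fun v r => Bare pos T v r ∧ ℓ (pos v) < ℓ (pos r)) Set.univ Set.univ + 1 := by
  let last : Set V := {v | ∀ d, ℓ (pos d) ≤ ℓ (pos v)}
  have hlast : last.ncard ≤ 1 := (Set.ncard_le_one_iff (Set.toFinite _)).2 fun {v w} hv hw =>
    hℓ ((hw v).antisymm (hv w))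
  have hcover : (Set.univ : Set V) ⊆
      Prod.fst '' {f ∈ midFaces pos T ℓ | ℓ (pos f.1) < ℓ (pos f.2.1)} ∪
      Prod.fst '' {p : V × V | (Bare pos T p.1 p.2 ∧ ℓ (pos p.1) < ℓ (pos p.2)) ∧ True ∧ True} ∪
      last := by
    rintro v -
    rcases hT.right_cases hℓ v with ⟨b, c, hf, hb, hc⟩ | ⟨r, hr⟩ | hv
    · exact .inl (.inl ⟨(v, b, c), ⟨⟨hf, .inr ⟨hc, hb⟩⟩, hb⟩, rfl⟩)
    · exact .inl (.inr ⟨(v, r), ⟨hr, trivial, trivial⟩, rfl⟩)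
    · exact .inr hv
  rw [← Set.ncard_univ]
  exact (Set.ncard_le_ncard hcover).trans <| (Set.ncard_union_le _ _).trans <| add_le_add
    ((Set.ncard_union_le _ _).trans <| add_le_add Set.ncard_image_le Set.ncard_image_le) hlast

lemma IsTriangulation.two_mul_natCard_le (hT : IsTriangulation pos T)
    (hℓ : Function.Injective (ℓ ∘ pos)) :
    2 * Nat.card V ≤
      (midFaces pos T ℓ).ncard + pairCard (Bare pos T) Set.univ Set.univ + 2 := by
  have hright := hT.natCard_le_of_right hℓ
  have hleft := hT.natCard_le_of_right (ℓ := -ℓ) (neg_injective.comp hℓ)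
  simp only [midFaces_neg, LinearMap.neg_apply, neg_lt_neg_iff] at hleft
  have hfaces : {f ∈ midFaces pos T ℓ | ℓ (pos f.1) < ℓ (pos f.2.1)}.ncard
      + {f ∈ midFaces pos T ℓ | ℓ (pos f.2.1) < ℓ (pos f.1)}.ncard
        ≤ (midFaces pos T ℓ).ncard := by
    rw [← Set.ncard_union_eq (Set.disjoint_left.2 fun f h h' => h.2.not_gt h'.2)]
    exact Set.ncard_le_ncard (Set.union_subset (Set.sep_subset _ _) (Set.sep_subset _ _))
  have hbare := pairCard_and_add_pairCard_and_not (Bare pos T)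
    (fun v r => ℓ (pos v) < ℓ (pos r)) Set.univ Set.univ
  have hbare_left : pairCard (fun v r => Bare pos T v r ∧ ℓ (pos r) < ℓ (pos v)) Set.univ Set.univ ≤
      pairCard (fun v r => Bare pos T v r ∧ ¬ ℓ (pos v) < ℓ (pos r)) Set.univ Set.univ :=
    pairCard_mono fun _ _ _ _ h => ⟨h.1, h.2.not_gt⟩
  omega

/-! ### Monochromatic edges of faces -/

variable (pos T) in
/-- The faces, with a choice of first vertex, whose first edge has both ends in `W` or none. -/
def monoFaces (W : Set V) : Set (V × V × V) :=
  {f | IsFace pos T f.1 f.2.1 f.2.2 ∧ (f.1 ∈ W ↔ f.2.1 ∈ W)}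

lemma IsTriangulation.ncard_monoFaces_le (hT : IsTriangulation pos T) (W : Set V) :
    (monoFaces pos T W).ncard ≤ pairCard (fun a b => ∃ c, IsFace pos T a b c) W W
      + pairCard (fun a b => ∃ c, IsFace pos T a b c) Wᶜ Wᶜ := by
  refine (Set.ncard_le_ncard_of_injOn (fun f => (f.1, f.2.1)) (fun f hf => ?_) ?_).trans
    (Set.ncard_union_le _ _)
  · by_cases ha : f.1 ∈ W
    · exact .inl ⟨⟨_, hf.1⟩, ha, hf.2.1 ha⟩
    · exact .inr ⟨⟨_, hf.1⟩, ha, fun hb => ha (hf.2.2 hb)⟩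
  · rintro ⟨a, b, c⟩ hf ⟨a', b', c'⟩ hf' h
    obtain ⟨rfl, rfl⟩ := Prod.mk.inj h
    obtain rfl := hT.face_unique hf.1 hf'.1
    rfl

variable (W : Set V)

lemma ncard_rotations_le :
    {f ∈ midFaces pos T ℓ | f ∈ monoFaces pos T W}.ncard
      + {f ∈ midFaces pos T ℓ | rotate f ∈ monoFaces pos T W}.ncard
      + {f ∈ midFaces pos T ℓ | rotate (rotate f) ∈ monoFaces pos T W}.ncard
        ≤ (monoFaces pos T W).ncard := by
  rw [← Set.ncard_image_of_injective {f ∈ _ | rotate f ∈ _} rotate.injective,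
    ← Set.ncard_image_of_injective {f ∈ _ | rotate (rotate f) ∈ _}
      (rotate.injective.comp rotate.injective), ← Set.ncard_union_eq, ← Set.ncard_union_eq]
  · refine Set.ncard_le_ncard ?_
    rintro _ ((⟨-, hf⟩ | ⟨f, ⟨-, hf⟩, rfl⟩) | ⟨f, ⟨-, hf⟩, rfl⟩) <;> exact hf
  · rw [Set.disjoint_left]
    rintro _ (⟨hf, -⟩ | ⟨f, ⟨hf, -⟩, rfl⟩) ⟨g, ⟨hg, -⟩, hgf⟩
    · exact rotate_notMem_midFaces hf (by rw [← hgf]; exact hg)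
    · exact rotate_notMem_midFaces hg (by rwa [← rotate.injective hgf] at hf)
  · rw [Set.disjoint_left]
    rintro _ ⟨hf, -⟩ ⟨g, ⟨hg, -⟩, rfl⟩
    exact rotate_notMem_midFaces hg hf

/-- Every face has an edge whose ends have the same colour, and a face with all vertices of the same
colour has three. -/
lemma IsTriangulation.ncard_midFaces_add_le (hT : IsTriangulation pos T) :
    (midFaces pos T ℓ).ncard + 2 * {f ∈ midFaces pos T ℓ | f.1 ∈ W ∧ f.2.1 ∈ W ∧ f.2.2 ∈ W}.ncard ≤
      pairCard (fun a b => ∃ c, IsFace pos T a b c) W W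
        + pairCard (fun a b => ∃ c, IsFace pos T a b c) Wᶜ Wᶜ := by
  let A := {f ∈ midFaces pos T ℓ | f ∈ monoFaces pos T W}
  let B := {f ∈ midFaces pos T ℓ | rotate f ∈ monoFaces pos T W}
  let C := {f ∈ midFaces pos T ℓ | rotate (rotate f) ∈ monoFaces pos T W}
  let D := {f ∈ midFaces pos T ℓ | f.1 ∈ W ∧ f.2.1 ∈ W ∧ f.2.2 ∈ W}
  have hcover : midFaces pos T ℓ ⊆ A ∪ B ∪ C := by
    intro f hf
    by_cases ha : f.1 ∈ W ↔ f.2.1 ∈ W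
    · exact .inl (.inl ⟨hf, hf.1, ha⟩)
    by_cases hb : f.2.1 ∈ W ↔ f.2.2 ∈ W
    · exact .inl (.inr ⟨hf, hf.1.rot, hb⟩)
    · exact .inr ⟨hf, hf.1.rot.rot, by tauto⟩
  have hDA : D ⊆ A := fun f ⟨hf, ha, hb, _⟩ => ⟨hf, hf.1, iff_of_true ha hb⟩
  have hDB : D ⊆ B := fun f ⟨hf, _, hb, hc⟩ => ⟨hf, hf.1.rot, iff_of_true hb hc⟩
  have hDC : D ⊆ C := fun f ⟨hf, ha, _, hc⟩ => ⟨hf, hf.1.rot.rot, iff_of_true hc ha⟩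
  have h₁ := Set.ncard_union_add_ncard_inter A B
  have h₂ := Set.ncard_union_add_ncard_inter (A ∪ B) C
  have h₃ := Set.ncard_le_ncard hcover
  have h₄ := Set.ncard_le_ncard (Set.subset_inter hDA hDB)
  have h₅ := Set.ncard_le_ncard (Set.subset_inter (hDA.trans (Set.subset_union_left (t := B))) hDC)
  have h₆ := ncard_rotations_le (pos := pos) (T := T) (ℓ := ℓ) W
  have h₇ := hT.ncard_monoFaces_le W
  lia

end Counting

/-! ### At least two sevenths of the vertices are matched -/

section LowerBound

variable {V : Type*} {pos : V → Plane} {P M T : SimpleGraph V} {ℓ : Plane →ₗ[ℝ] ℝ}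

lemma PolygonMatching.exists_adj_ne (hP : PolygonMatching pos P M) (v z : V) :
    ∃ e, P.Adj v e ∧ e ≠ z := by
  obtain ⟨e, he, hez⟩ := Set.exists_ne_of_one_lt_ncard (by rw [hP.ncard_neighborSet v]; simp) z
  exact ⟨e, he, hez⟩

/-- The edge `zx` is blocked at `z` and is not an edge of `P`. -/
def BlockedChord (pos : V → Plane) (P T : SimpleGraph V) (z x : V) : Prop :=
  Blocked pos T z x ∧ ¬ P.Adj z x

lemma IsTriangulation.not_three_blockedChord (hP : PolygonMatching pos P M)
    (hT : IsTriangulation pos T) (hle : P ≤ T) {z x₁ x₂ x₃ : V} (h₁ : BlockedChord pos P T z x₁)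
    (h₂ : BlockedChord pos P T z x₂) (h₃ : BlockedChord pos P T z x₃) :
    x₁ = x₂ ∨ x₁ = x₃ ∨ x₂ = x₃ := by
  by_contra! hne
  obtain ⟨e, he, -⟩ := hP.exists_adj_ne z z
  rcases hT.eq_of_three_blocked h₁.1 h₂.1 h₃.1 hne.1 hne.2.1 hne.2.2 (hle he) with rfl | rfl | rfl
  exacts [h₁.2 he, h₂.2 he, h₃.2 he]

lemma OptTriangulation.between_of_not_blocked (hT : OptTriangulation pos ℓ P M T)
    (hℓ : Function.Injective (ℓ ∘ pos)) {z z' a b : V} (hz : z ∈ M.support)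
    (hz' : z' ∈ M.support) (hPM : ¬ (P ⊔ M).Adj z z') (fb : IsFace pos T z z' b)
    (fa : IsFace pos T z' z a) (hB : ¬ Blocked pos T z z') (hB' : ¬ Blocked pos T z' z) :
    (a ∈ M.support ∧ Between (ℓ (pos z)) (ℓ (pos a)) (ℓ (pos z'))) ∨
      (b ∈ M.support ∧ Between (ℓ (pos z)) (ℓ (pos b)) (ℓ (pos z'))) := by
  have hTT := hT.toIsTriangulation
  have hab : a ≠ b := by
    rintro rfl
    have := fa.ccw
    rw [orient_swap'] at this
    linarith [fb.ccw]
  have not_wedge : ∀ {z z' a b}, IsFace pos T z z' b → IsFace pos T z' z a → a ≠ b →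
      ¬ Blocked pos T z z' → 0 < orient pos z a b := fun {z z' a b} fb fa hab hB => by
    refine orient_pos_of_nonneg hT.genPos fa.adj_bc.ne hab fb.adj_ca.ne.symm
      (not_lt.1 fun h => hB ⟨a, b, fa.rot, fb, ?_⟩)
    rw [orient_swap]
    exact neg_pos.2 h
  have convex := not_wedge fb fa hab hB
  have convex' := not_wedge fa fb hab.symm hB'
  have hcr := crosses_of_convex fa.ccw fb.ccw convex convex'
  obtain ⟨ha, hb, hle⟩ := hT.flip_opt z z' a b hz hz' fb.adj_ab hPM hcr fun p q hpq h =>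
    hTT.edge_eq_of_crosses_flip fb fa convex convex' hpq h
  exact (hcr.exists_between hℓ hle).imp (.intro ha) (.intro hb)

variable [Finite V]

lemma PolygonMatching.pairCard_adj_univ (hP : PolygonMatching pos P M) (S : Set V) :
    pairCard P.Adj S Set.univ = 2 * S.ncard := by
  choose a b hN hab using hP.exists_neighborSet_eq
  have hne : ∀ v, a v ≠ b v := fun v h => by
    have := hab v
    simp [h] at this
  have hpairs : {p : V × V | P.Adj p.1 p.2 ∧ p.1 ∈ S ∧ p.2 ∈ Set.univ} =
      (fun v => (v, a v)) '' S ∪ (fun v => (v, b v)) '' S := by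
    ext ⟨v, w⟩
    have hvw : P.Adj v w ↔ w = a v ∨ w = b v := Set.ext_iff.1 (hN v) w
    simp only [hvw, Set.mem_ofPred_eq, Set.mem_univ, and_true, Set.mem_union, Set.mem_image,
      Prod.mk.injEq]
    grind
  rw [pairCard, hpairs, Set.ncard_union_eq,
    Set.ncard_image_of_injective _ fun v w h => (Prod.mk.inj h).1,
    Set.ncard_image_of_injective _ fun v w h => (Prod.mk.inj h).1, two_mul]
  rw [Set.disjoint_left]
  rintro - ⟨v, -, rfl⟩ ⟨w, -, h⟩
  obtain ⟨rfl, h⟩ := Prod.mk.inj h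
  exact hne w h.symm

lemma PolygonMatching.pairCard_adj_add (hP : PolygonMatching pos P M) (W : Set V) :
    pairCard P.Adj W W + pairCard P.Adj Wᶜ Wᶜ + 2 * pairCard P.Adj Wᶜ W = 2 * Nat.card V := by
  have hW := hP.pairCard_adj_univ W
  have hU := hP.pairCard_adj_univ Wᶜ
  have hswap : pairCard P.Adj W Wᶜ = pairCard P.Adj Wᶜ W := by
    rw [← pairCard_flip]
    congr 1
    ext a b
    exact P.adj_comm b a
  have := pairCard_add_compl_right P.Adj W W
  have := pairCard_add_compl_right P.Adj Wᶜ W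
  have := Set.ncard_add_ncard_compl W
  lia

/-! ### Hull vertices -/

variable (pos T) in
/-- The vertices on the unbounded face. -/
def hull : Set V := {v | ∃ c, Bare pos T v c}

lemma PolygonMatching.exists_bare_next (hP : PolygonMatching pos P M) (hT : IsTriangulation pos T)
    (hle : P ≤ T) {z c : V} (h : Bare pos T z c) : ∃ c', Bare pos T c c' ∧ c' ≠ z :=
  let ⟨_, he, hez⟩ := hP.exists_adj_ne c z
  h.exists_next hT (hle he) hez

lemma PolygonMatching.exists_bare_prev (hP : PolygonMatching pos P M) (hT : IsTriangulation pos T)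
    (hle : P ≤ T) {v : V} (hv : v ∈ hull pos T) : ∃ u, Bare pos T u v := by
  choose f hf using fun v : hull pos T => v.2
  let next : hull pos T → hull pos T := fun v =>
    ⟨f v, (hP.exists_bare_next hT hle (hf v)).imp fun _ h => h.1⟩
  have hnext : Function.Injective next := fun v v' h => by
    have hff : f v = f v' := congr(($h).1)
    exact Subtype.ext ((hf v).head_injective hT (by rw [hff]; exact hf v'))
  obtain ⟨u, hu⟩ := Finite.surjective_of_injective hnext ⟨v, hv⟩
  have huv : f u = v := congr(($hu).1)
  exact ⟨u, huv ▸ hf u⟩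

lemma PolygonMatching.hull_nonempty (hP : PolygonMatching pos P M) (hT : IsTriangulation pos T)
    (hℓ : Function.Injective (ℓ ∘ pos)) : (hull pos T).Nonempty := by
  have := hP.connected.nonempty
  obtain ⟨v, hv⟩ := Finite.exists_min (ℓ ∘ pos)
  rcases hT.right_cases hℓ v with ⟨b, c, -, -, h⟩ | ⟨r, h, -⟩ | h
  · exact absurd (hv c) h.not_ge
  · exact ⟨v, r, h⟩
  · obtain ⟨e, -, hev⟩ := hP.exists_adj_ne v v
    exact absurd (hℓ ((h e).antisymm (hv e))) hev

/-- If no matched vertex is on the hull, then the hull edges are polygon edges, so they form the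
whole polygon. -/
lemma OptTriangulation.exists_mem_hull (hP : PolygonMatching pos P M)
    (hT : OptTriangulation pos ℓ P M T) (hℓ : Function.Injective (ℓ ∘ pos))
    (hM : M.support.Nonempty) : ∃ z ∈ M.support, z ∈ hull pos T := by
  by_contra! hcon
  have hTT := hT.toIsTriangulation
  have hle : P ≤ T := le_sup_left.trans hT.le
  have hadj : ∀ {z c}, Bare pos T z c → P.Adj z c := fun {z c} h => by
    obtain ⟨c', hc', -⟩ := hP.exists_bare_next hTT hle h
    exact hT.adj_of_notMem_support hP h.1 (fun hz => hcon _ hz ⟨c, h⟩) fun hc => hcon _ hc ⟨c', hc'⟩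
  obtain ⟨w, hw⟩ := hM
  obtain ⟨v₀, hv₀⟩ := hP.hull_nonempty hTT hℓ
  obtain ⟨p⟩ := hP.connected v₀ w
  obtain ⟨⟨⟨v, x⟩, hvx⟩, -, hv, hx⟩ := p.exists_boundary_dart (hull pos T) hv₀ (hcon w hw)
  obtain ⟨u, hu⟩ := hP.exists_bare_prev hTT hle hv
  obtain ⟨c, hc, hcu⟩ := hP.exists_bare_next hTT hle hu
  obtain ⟨a, b, hN, -⟩ := hP.exists_neighborSet_eq v
  have hxuc : x = u ∨ x = c := by
    have := hN.le (hadj hu).symm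
    have := hN.le (hadj hc)
    have := hN.le hvx
    grind
  rcases hxuc with rfl | rfl
  · exact hx ⟨v, hu⟩
  · exact hx ((hP.exists_bare_next hTT hle hc).imp fun _ h => h.1)

lemma OptTriangulation.pairCard_bare_add_le (hP : PolygonMatching pos P M)
    (hT : OptTriangulation pos ℓ P M T) :
    pairCard (Bare pos T) Set.univ Set.univ + pairCard (Bare pos T) M.support M.support ≤
      2 * (M.support ∩ hull pos T).ncard
        + pairCard (fun a b => P.Adj a b ∧ Bare pos T a b) M.supportᶜ M.supportᶜ := by
  have hTT := hT.toIsTriangulation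
  have tail : pairCard (Bare pos T) M.support Set.univ ≤ (M.support ∩ hull pos T).ncard :=
    pairCard_le_ncard (fun a ha b _ h => ⟨ha, b, h⟩) fun _ _ _ h h' => h.unique h'
  have head : pairCard (Bare pos T) Set.univ M.support ≤ (M.support ∩ hull pos T).ncard := by
    rw [← pairCard_flip]
    exact pairCard_le_ncard (fun c hc z _ h => ⟨hc, (hP.exists_bare_next hTT
      (le_sup_left.trans hT.le) h).imp fun _ h => h.1⟩) fun _ _ _ h h' => h.head_injective hTT h'
  have unmatched : pairCard (Bare pos T) M.supportᶜ M.supportᶜ ≤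
      pairCard (fun a b => P.Adj a b ∧ Bare pos T a b) M.supportᶜ M.supportᶜ :=
    pairCard_mono fun a ha b hb h => ⟨hT.adj_of_notMem_support hP h.1 ha hb, h⟩
  have := pairCard_add_compl_left (Bare pos T) M.support Set.univ
  have := pairCard_add_compl_right (Bare pos T) M.supportᶜ M.support
  have := pairCard_add_compl_left (Bare pos T) M.support M.support
  lia

/-! ### Blocked chords -/

lemma OptTriangulation.pairCard_blockedChord_le (hP : PolygonMatching pos P M)
    (hT : OptTriangulation pos ℓ P M T) :
    pairCard (BlockedChord pos P T) M.support Set.univ ≤ 2 * (M.support \ hull pos T).ncard := by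
  classical
  have := Fintype.ofFinite V
  rw [pairCard, Set.ncard_eq_toFinset_card', Set.ncard_eq_toFinset_card']
  refine Finset.card_le_mul_card_image_of_maps_to (f := Prod.fst) (fun p hp => ?_) 2 fun z _ => ?_
  · rw [Set.mem_toFinset] at hp ⊢
    exact ⟨hp.2.1, fun ⟨c, hc⟩ => hp.1.1.not_bare hc⟩
  · by_contra! hcard
    obtain ⟨⟨_, x₁⟩, h₁, ⟨_, x₂⟩, h₂, ⟨_, x₃⟩, h₃, h₁₂, h₁₃, h₂₃⟩ := Finset.two_lt_card.1 hcard
    simp only [Finset.mem_filter, Set.mem_toFinset] at h₁ h₂ h₃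
    obtain ⟨⟨h₁, -⟩, rfl⟩ := h₁
    obtain ⟨⟨h₂, -⟩, rfl⟩ := h₂
    obtain ⟨⟨h₃, -⟩, rfl⟩ := h₃
    rcases hT.toIsTriangulation.not_three_blockedChord hP (le_sup_left.trans hT.le) h₁ h₂ h₃
      with rfl | rfl | rfl
    exacts [h₁₂ rfl, h₁₃ rfl, h₂₃ rfl]

lemma OptTriangulation.ncard_compl_support_le (hP : PolygonMatching pos P M)
    (hT : OptTriangulation pos ℓ P M T) :
    M.supportᶜ.ncard ≤ pairCard P.Adj M.supportᶜ M.support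
      + pairCard (BlockedChord pos P T) M.support M.supportᶜ := by
  rw [← pairCard_flip (BlockedChord pos P T)]
  refine (ncard_le_pairCard fun u hu => ?_).trans (pairCard_or_le _ _ _ _)
  by_cases h : ∃ a ∈ M.support, P.Adj u a
  · obtain ⟨a, ha, hua⟩ := h
    exact ⟨a, ha, .inl hua⟩
  · push Not at h
    obtain ⟨z, hz, hB⟩ := hT.exists_blocked hP hu fun a hua ha => h a ha hua
    exact ⟨z, hz, .inr ⟨hB, fun hzu => h z hz hzu.symm⟩⟩

/-! ### Edges between matched vertices -/

variable (pos ℓ) in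
/-- The directed edge `zz'` has on its left a face with apex in `W` which is horizontally between
`z` and `z'`. -/
def HasMiddleApex (T : SimpleGraph V) (W : Set V) (z z' : V) : Prop :=
  ∃ a ∈ W, IsFace pos T z z' a ∧ Between (ℓ (pos z)) (ℓ (pos a)) (ℓ (pos z'))

lemma pairCard_hasMiddleApex_le (W : Set V) : pairCard (HasMiddleApex pos ℓ T W) W W ≤
    {f ∈ midFaces pos T ℓ | f.1 ∈ W ∧ f.2.1 ∈ W ∧ f.2.2 ∈ W}.ncard := by
  refine (Set.ncard_le_ncard fun p hp => ?_).trans (Set.ncard_image_le (f := Prod.snd))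
  obtain ⟨⟨a, ha, hf, hm⟩, hp⟩ := hp
  exact ⟨(a, p), ⟨⟨hf.rot.rot, hm⟩, ha, hp⟩, rfl⟩

lemma OptTriangulation.cases_of_isFace (hT : OptTriangulation pos ℓ P M T)
    (hℓ : Function.Injective (ℓ ∘ pos)) {z z' b : V} (hz : z ∈ M.support) (hz' : z' ∈ M.support)
    (fb : IsFace pos T z z' b) : (((M.Adj z z' ∨ P.Adj z z') ∨ Bare pos T z' z) ∨
      (BlockedChord pos P T z z' ∨ BlockedChord pos P T z' z)) ∨
      (HasMiddleApex pos ℓ T M.support z z' ∨ HasMiddleApex pos ℓ T M.support z' z) := by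
  by_cases hPM : (P ⊔ M).Adj z z'
  · exact .inl (.inl (.inl (Or.symm hPM)))
  by_cases hbare : Bare pos T z' z
  · exact .inl (.inl (.inr hbare))
  obtain ⟨a, fa⟩ := hT.toIsTriangulation.exists_face_of_not_bare fb.adj_ab.symm hbare
  by_cases hB : Blocked pos T z z'
  · exact .inl (.inr (.inl ⟨hB, fun h => hPM (.inl h)⟩))
  by_cases hB' : Blocked pos T z' z
  · exact .inl (.inr (.inr ⟨hB', fun h => hPM (.inl h.symm)⟩))
  rcases hT.between_of_not_blocked hℓ hz hz' hPM fb fa hB hB' with ⟨ha, h⟩ | ⟨hb, h⟩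
  · exact .inr (.inr ⟨a, ha, fa, h.symm⟩)
  · exact .inr (.inl ⟨b, hb, fb, h⟩)

lemma OptTriangulation.pairCard_isFace_support_le (hP : PolygonMatching pos P M)
    (hT : OptTriangulation pos ℓ P M T) (hℓ : Function.Injective (ℓ ∘ pos)) :
    pairCard (fun a b => ∃ c, IsFace pos T a b c) M.support M.support ≤
      M.support.ncard + pairCard P.Adj M.support M.support
        + pairCard (Bare pos T) M.support M.support
        + 2 * pairCard (BlockedChord pos P T) M.support M.support
        + 2 * {f ∈ midFaces pos T ℓ |
          f.1 ∈ M.support ∧ f.2.1 ∈ M.support ∧ f.2.2 ∈ M.support}.ncard := by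
  set W := M.support
  have hM : pairCard M.Adj W W ≤ W.ncard := pairCard_le_ncard (fun _ ha _ _ _ => ha) hP.matching
  have hmid := pairCard_hasMiddleApex_le (pos := pos) (T := T) (ℓ := ℓ) W
  have hcases := pairCard_mono (r := fun a b => ∃ c, IsFace pos T a b c)
    fun z hz z' hz' ⟨b, fb⟩ => hT.cases_of_isFace hℓ hz hz' fb
  have hP_M := pairCard_or_le M.Adj P.Adj W W
  have hbare := pairCard_or_le (fun z z' => M.Adj z z' ∨ P.Adj z z') (flip (Bare pos T)) W W
  have hblocked := pairCard_or_flip_le (BlockedChord pos P T) W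
  have happex := pairCard_or_flip_le (HasMiddleApex pos ℓ T W) W
  have hor := pairCard_or_le (fun z z' => (M.Adj z z' ∨ P.Adj z z') ∨ Bare pos T z' z)
    (fun z z' => BlockedChord pos P T z z' ∨ BlockedChord pos P T z' z) W W
  have hor' := pairCard_or_le (fun z z' => ((M.Adj z z' ∨ P.Adj z z') ∨ Bare pos T z' z) ∨
    (BlockedChord pos P T z z' ∨ BlockedChord pos P T z' z))
    (fun z z' => HasMiddleApex pos ℓ T W z z' ∨ HasMiddleApex pos ℓ T W z' z) W W
  rw [pairCard_flip] at hbare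
  simp only [flip] at hbare
  lia

lemma OptTriangulation.pairCard_isFace_compl_support_le (hP : PolygonMatching pos P M)
    (hT : OptTriangulation pos ℓ P M T) :
    pairCard (fun a b => ∃ c, IsFace pos T a b c) M.supportᶜ M.supportᶜ
      + pairCard (fun a b => P.Adj a b ∧ Bare pos T a b) M.supportᶜ M.supportᶜ ≤
        pairCard P.Adj M.supportᶜ M.supportᶜ := by
  rw [← pairCard_and_add_pairCard_and_not P.Adj (Bare pos T), add_comm]
  exact add_le_add_right (pairCard_mono fun a ha b hb ⟨c, hf⟩ =>
    ⟨hT.adj_of_notMem_support hP hf.adj_ab ha hb, hf.not_bare⟩) _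

theorem PolygonMatching.two_mul_natCard_le (hP : PolygonMatching pos P M)
    (hℓ : Function.Injective (ℓ ∘ pos)) : 2 * Nat.card V ≤ 7 * M.support.ncard := by
  obtain ⟨T, hT⟩ := hP.exists_optTriangulation (ℓ := ℓ)
  have hTT := hT.toIsTriangulation
  have hM : M.support.Nonempty := by
    obtain ⟨u⟩ := hP.connected.nonempty
    by_contra! h
    obtain ⟨z, hz, -⟩ := hT.exists_blocked hP (u := u) (by simp [h]) (by simp [h])
    simp [h] at hz
  have hhull : 0 < (M.support ∩ hull pos T).ncard :=
    (Set.ncard_pos (Set.toFinite _)).2 (hT.exists_mem_hull hP hℓ hM)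
  have hsplit := Set.ncard_inter_add_ncard_sdiff_eq_ncard M.support (hull pos T)
  have hcompl := Set.ncard_add_ncard_compl M.support
  have hmiddle := hTT.two_mul_natCard_le hℓ
  have hfaces := hTT.ncard_midFaces_add_le (ℓ := ℓ) M.support
  have hmatched := hT.pairCard_isFace_support_le hP hℓ
  have hunmatched := hT.pairCard_isFace_compl_support_le hP
  have hbare := hT.pairCard_bare_add_le hP
  have hpolygon := hP.pairCard_adj_add M.support
  have hblocked := hT.pairCard_blockedChord_le hP
  have hchords := pairCard_add_compl_right (BlockedChord pos P T) M.support M.support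
  have hvertices := hT.ncard_compl_support_le hP
  lia

end LowerBound

section Bridge

variable {V : Type*} {pos : V → Plane}

lemma collinear_iff_orient_eq_zero {a b c : V} :
    Collinear ℝ {pos a, pos b, pos c} ↔ orient pos a b c = 0 := by
  rw [collinear_iff_of_mem (p₀ := pos a) (by simp)]
  constructor
  · rintro ⟨v, hv⟩
    obtain ⟨r, hr⟩ := hv (pos b) (by simp)
    obtain ⟨s, hs⟩ := hv (pos c) (by simp)
    simp only [orient, hr, hs, vadd_eq_add, PiLp.add_apply, PiLp.smul_apply, smul_eq_mul]
    ring
  · intro h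
    rcases eq_or_ne (pos b) (pos a) with hba | hba
    · rw [← collinear_iff_of_mem (by simp), hba, Set.insert_eq_of_mem (by simp)]
      exact collinear_pair ℝ _ _
    -- `pos c - pos a` is its own orthogonal projection to the line spanned by `pos b - pos a`
    have hsq : (pos b 0 - pos a 0) ^ 2 + (pos b 1 - pos a 1) ^ 2 ≠ 0 := by
      contrapose! hba
      ext i
      fin_cases i <;> simp only [Fin.zero_eta, Fin.mk_one] <;> nlinarith
    refine ⟨pos b - pos a, ?_⟩
    simp only [Set.mem_insert_iff, Set.mem_singleton_iff, forall_eq_or_imp, forall_eq]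
    refine ⟨⟨0, by simp⟩, ⟨1, by simp⟩,
      ⟨((pos b 0 - pos a 0) * (pos c 0 - pos a 0) + (pos b 1 - pos a 1) * (pos c 1 - pos a 1)) /
        ((pos b 0 - pos a 0) ^ 2 + (pos b 1 - pos a 1) ^ 2), ?_⟩⟩
    simp only [orient] at h
    ext i
    fin_cases i <;>
      simp only [Fin.zero_eta, Fin.mk_one, vadd_eq_add, PiLp.add_apply, PiLp.smul_apply,
        smul_eq_mul, PiLp.sub_apply] <;>
      field_simp
    · linear_combination -(pos b 1 - pos a 1) * h
    · linear_combination (pos b 0 - pos a 0) * h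

lemma GeometricGraph.InGeneralPosition.genPos {G : GeometricGraph V} (h : G.InGeneralPosition) :
    GenPos G.pos := fun a b c hab hbc hac h0 =>
  h a b c hab hbc hac (collinear_iff_orient_eq_zero.2 h0)

lemma IsNoncrossing.crossingFree {G : SimpleGraph V} (h : IsNoncrossing pos G) :
    CrossingFree pos G := by
  intro a b c d hab hcd hcr
  obtain ⟨-, -, hac, had, hbc, hbd⟩ := hcr.ne
  obtain ⟨t, s, ht0, ht1, hs0, hs1, hp⟩ := hcr.exists_combination
  have hmem : (1 - t) • pos a + t • pos b ∈ segment ℝ (pos a) (pos b) :=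
    ⟨1 - t, t, by linarith, ht0.le, by ring, rfl⟩
  have hmem' : (1 - t) • pos a + t • pos b ∈ segment ℝ (pos c) (pos d) :=
    ⟨1 - s, s, by linarith, hs0.le, by ring, hp.symm⟩
  obtain ⟨v, ⟨hv, hv'⟩, -⟩ := h.2 a b c d hab hcd (by simp [hac, had]) ⟨hmem, hmem'⟩
  simp only [Set.mem_insert_iff, Set.mem_singleton_iff] at hv hv'
  rcases hv with rfl | rfl <;> rcases hv' with rfl | rfl <;> contradiction

lemma GenPos.eq_or_eq_of_mem_segment (hg : GenPos pos) {a b v : V} (hab : a ≠ b)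
    (h : pos v ∈ segment ℝ (pos a) (pos b)) : v = a ∨ v = b := by
  refine hg.eq_or_eq_of_orient_eq_zero hab (collinear_iff_orient_eq_zero.1 ?_)
  rw [Set.pair_comm]
  exact (mem_segment_iff_wbtw.1 h).collinear

lemma CrossingFree.isNoncrossing (hg : GenPos pos) {G : SimpleGraph V} (h : CrossingFree pos G) :
    IsNoncrossing pos G := by
  refine ⟨fun a b v hab hv => hg.eq_or_eq_of_mem_segment hab.ne hv, ?_⟩
  rintro a b c d hab hcd hne p ⟨hp, hp'⟩
  have of_vertex : ∀ v, p = pos v → p ∈ pos '' ({a, b} ∩ {c, d}) := by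
    rintro v rfl
    exact ⟨v, ⟨hg.eq_or_eq_of_mem_segment hab.ne hp, hg.eq_or_eq_of_mem_segment hcd.ne hp'⟩, rfl⟩
  rw [segment_eq_image] at hp hp'
  obtain ⟨t, ⟨ht0, ht1⟩, hpt⟩ := hp
  obtain ⟨s, ⟨hs0, hs1⟩, hps⟩ := hp'
  rcases ht0.eq_or_lt with rfl | ht0
  · exact of_vertex a (by simp [← hpt])
  rcases ht1.eq_or_lt with rfl | ht1
  · exact of_vertex b (by simp [← hpt])
  rcases hs0.eq_or_lt with rfl | hs0
  · exact of_vertex c (by simp [← hps])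
  rcases hs1.eq_or_lt with rfl | hs1
  · exact of_vertex d (by simp [← hps])
  rcases hg.crosses_or_eq_of_common_point hab.ne hcd.ne ht0 ht1 hs0 hs1 (hpt.trans hps.symm)
    with hcr | heq
  · exact absurd hcr (h a b c d hab hcd)
  · exact absurd heq hne

lemma exists_linear_injective_comp [Finite V] (hpos : Function.Injective pos) :
    ∃ ℓ : Plane →ₗ[ℝ] ℝ, Function.Injective (ℓ ∘ pos) := by
  obtain ⟨ℓ, hℓ⟩ := Module.exists_dual_forall_apply_ne_zero (K := ℝ)
    (fun p : {p : V × V // p.1 ≠ p.2} => pos p.1.1 - pos p.1.2)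
    (fun p => sub_ne_zero.2 (hpos.ne p.2))
  refine ⟨ℓ, fun a b hab => by_contra fun hne => hℓ ⟨(a, b), hne⟩ ?_⟩
  simpa [sub_eq_zero] using hab

lemma sup_edge_matching {M : SimpleGraph V} (hM : ∀ u v w, M.Adj u v → M.Adj u w → v = w)
    {a b : V} (ha : a ∉ M.support) (hb : b ∉ M.support) (u v w : V)
    (huv : (M ⊔ SimpleGraph.edge a b).Adj u v) (huw : (M ⊔ SimpleGraph.edge a b).Adj u w) :
    v = w := by
  rw [SimpleGraph.mem_support] at ha hb
  push Not at ha hb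
  simp only [SimpleGraph.sup_adj, SimpleGraph.edge_adj] at huv huw
  grind

namespace GeometricGraph

lemma IsMaximalCompatibleMatching.exists_crosses {G : GeometricGraph V}
    (hg : G.InGeneralPosition) {M : SimpleGraph V} (hM : G.IsMaximalCompatibleMatching M) {u v : V}
    (huv : u ≠ v) (hu : u ∉ M.support) (hv : v ∉ M.support) (hG : ¬ G.graph.Adj u v) :
    ∃ c d, (G.graph ⊔ M).Adj c d ∧ Crosses G.pos u v c d := by
  by_contra! hcon
  have hcomp : G.IsCompatibleMatching (M ⊔ SimpleGraph.edge u v) := by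
    refine ⟨sup_edge_matching hM.prop.matching hu hv,
      disjoint_sup_right.2 ⟨hM.prop.disjoint, (SimpleGraph.disjoint_edge _).2 hG⟩, ?_⟩
    rw [← sup_assoc]
    exact (hM.prop.noncrossing.crossingFree.sup_edge hcon).isNoncrossing hg.genPos
  have hadj : M.Adj u v :=
    hM.le_of_ge hcomp le_sup_left (.inr (by simp [SimpleGraph.edge_adj, huv]))
  exact hu ⟨v, hadj⟩

end GeometricGraph

lemma ncard_support_of_matching [Finite V] {M : SimpleGraph V}
    (hM : ∀ u v w, M.Adj u v → M.Adj u w → v = w) : M.support.ncard = 2 * M.edgeSet.ncard := by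
  classical
  have := Fintype.ofFinite V
  have hdegree : ∀ v, M.degree v = if v ∈ M.support then 1 else 0 := by
    intro v
    split_ifs with hv
    · obtain ⟨w, hw⟩ := hv
      exact (M.degree_eq_one_iff_existsUnique_adj).2 ⟨w, hw, fun x hx => hM _ _ _ hx hw⟩
    · exact (M.degree_eq_zero_iff_notMem_support v).2 hv
  rw [← SimpleGraph.coe_edgeFinset, Set.ncard_coe_finset, ← M.sum_degrees_eq_twice_card_edges]
  simp only [hdegree, Finset.sum_boole, Nat.cast_id]
  rw [← Set.ncard_coe_finset]
  simp

lemma cycleGraph_adj_iff_val {n : ℕ} (hn : 3 ≤ n) {u v : Fin n} :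
    (SimpleGraph.cycleGraph n).Adj u v ↔ u.val + 1 = v.val ∨ v.val + 1 = u.val ∨
      (u.val = 0 ∧ v.val + 1 = n) ∨ (v.val = 0 ∧ u.val + 1 = n) := by
  have hmod : ∀ a b : Fin n, (a - b).val = if b ≤ a then a.val - b.val else n + a - b := by
    intro a b
    split_ifs with h
    · exact Fin.sub_val_of_le h
    · exact Fin.coe_sub_iff_lt.2 (not_le.1 h)
  rw [SimpleGraph.cycleGraph_adj', hmod, hmod]
  grind

lemma cycleGraph_cliqueFree_three {n : ℕ} (hn : 4 ≤ n) :
    (SimpleGraph.cycleGraph n).CliqueFree 3 := by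
  intro s hs
  obtain ⟨a, b, c, hab, hac, hbc, -⟩ := SimpleGraph.is3Clique_iff.1 hs
  rw [cycleGraph_adj_iff_val (by omega)] at hab hac hbc
  omega

lemma ncard_neighborSet_cycleGraph {n : ℕ} (hn : 3 ≤ n) (v : Fin n) :
    ((SimpleGraph.cycleGraph n).neighborSet v).ncard = 2 := by
  obtain ⟨m, rfl⟩ := Nat.exists_eq_add_of_le' hn
  rw [← SimpleGraph.coe_neighborFinset, Set.ncard_coe_finset]
  exact SimpleGraph.cycleGraph_degree_three_le

lemma cycleGraph_connected_of_pos {n : ℕ} (hn : 0 < n) : (SimpleGraph.cycleGraph n).Connected := by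
  obtain ⟨m, rfl⟩ := Nat.exists_eq_add_of_le' hn
  exact SimpleGraph.cycleGraph_connected

namespace GeometricGraph

lemma polygonMatching {n : ℕ} (hn : 4 ≤ n) {P : GeometricGraph (Fin n)} (hP : P ∈ polygons n)
    {M : SimpleGraph (Fin n)} (hM : P.IsMaximalCompatibleMatching M) :
    PolygonMatching P.pos P.graph M where
  genPos := hP.2.genPos
  crossingFree := hM.prop.noncrossing.crossingFree
  matching := hM.prop.matching
  ncard_neighborSet := hP.1 ▸ ncard_neighborSet_cycleGraph (by omega)
  connected := hP.1 ▸ cycleGraph_connected_of_pos (by omega)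
  cliqueFree := hP.1 ▸ cycleGraph_cliqueFree_three hn
  maximal _ _ huv hu hv hadj := hM.exists_crosses hP.2 huv hu hv hadj

theorem card_le_seven_mul {n : ℕ} (hn : 4 ≤ n) {P : GeometricGraph (Fin n)} (hP : P ∈ polygons n)
    {M : SimpleGraph (Fin n)} (hM : P.IsMaximalCompatibleMatching M) :
    n ≤ 7 * M.edgeSet.ncard := by
  obtain ⟨ℓ, hℓ⟩ := exists_linear_injective_comp P.pos_injective
  have hcard := (polygonMatching hn hP hM).two_mul_natCard_le hℓ
  rw [ncard_support_of_matching hM.prop.matching, Nat.card_fin] at hcard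
  omega

lemma exists_isMaximalCompatibleMatching [Finite V] (G : GeometricGraph V) :
    ∃ M, G.IsMaximalCompatibleMatching M :=
  (Set.toFinite {M | G.IsCompatibleMatching M}).exists_maximal
    ⟨⊥, by simp, disjoint_bot_right, by simpa using G.noncrossing⟩

lemma le_seven_mul_mmFamily {n : ℕ} (hn : 4 ≤ n) (hne : (polygons n).Nonempty) :
    n ≤ 7 * mmFamily (polygons n) := by
  obtain ⟨P, hP, hPmm⟩ := Nat.sInf_mem (hne.image mm)
  obtain ⟨M₀, hM₀⟩ := P.exists_isMaximalCompatibleMatching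
  obtain ⟨M, hM, hMmm⟩ := Nat.sInf_mem (s := {k : ℕ | ∃ M : SimpleGraph (Fin n),
    P.IsMaximalCompatibleMatching M ∧ M.edgeSet.ncard = k}) ⟨_, M₀, hM₀, rfl⟩
  rw [mmFamily, ← hPmm, mm, ← hMmm]
  exact card_le_seven_mul hn hP hM

lemma mmFamily_polygons_le {n : ℕ} {P : GeometricGraph (Fin n)} (hP : P ∈ polygons n)
    {M : SimpleGraph (Fin n)} (hM : P.IsMaximalCompatibleMatching M) :
    mmFamily (polygons n) ≤ M.edgeSet.ncard :=
  (Nat.sInf_le (Set.mem_image_of_mem mm hP)).trans (Nat.sInf_le ⟨M, hM, rfl⟩)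

end GeometricGraph

end Bridge

section Constructions

variable {V : Type*}

namespace GeometricGraph

/-- The geometric graph on points in general position whose edges are those of a graph without
crossings. -/
def ofCrossingFree (pos : V → Plane) (G : SimpleGraph V) (hpos : Function.Injective pos)
    (hg : GenPos pos) (hG : CrossingFree pos G) : GeometricGraph V where
  pos := pos
  graph := G
  pos_injective := hpos
  noncrossing := hG.isNoncrossing hg

lemma inGeneralPosition_of_genPos {G : GeometricGraph V} (hg : GenPos G.pos) :
    G.InGeneralPosition := fun a b c hab hbc hac h =>
  hg a b c hab hbc hac (collinear_iff_orient_eq_zero.1 h)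

lemma isMaximalCompatibleMatching_of_exists_crosses {G : GeometricGraph V} (hg : GenPos G.pos)
    {M : SimpleGraph V} (hM : ∀ u v w, M.Adj u v → M.Adj u w → v = w)
    (hdisj : Disjoint G.graph M) (hGM : CrossingFree G.pos (G.graph ⊔ M))
    (hmax : ∀ u v, u ≠ v → u ∉ M.support → v ∉ M.support → ¬ G.graph.Adj u v →
      ∃ c d, (G.graph ⊔ M).Adj c d ∧ Crosses G.pos u v c d) :
    G.IsMaximalCompatibleMatching M := by
  refine ⟨⟨hM, hdisj, hGM.isNoncrossing hg⟩, fun N hN hMN u v huv => ?_⟩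
  have of_matched : ∀ {u v}, N.Adj u v → u ∈ M.support → M.Adj u v := by
    rintro u v huv ⟨w, hw⟩
    rwa [hN.matching u v w huv (hMN hw)]
  by_cases hu : u ∈ M.support
  · exact of_matched huv hu
  by_cases hv : v ∈ M.support
  · exact (of_matched huv.symm hv).symm
  obtain ⟨c, d, hcd, hcr⟩ := hmax u v huv.ne hu hv fun h =>
    SimpleGraph.disjoint_left.1 hN.disjoint u v h huv
  exact absurd hcr (hN.noncrossing.crossingFree u v c d (.inr huv) (sup_le_sup_left hMN _ hcd))

end GeometricGraph

/-- Points on the parabola `y = x ^ 2`, the vertices of a convex polygon. -/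
def parabolaPos (n : ℕ) (i : Fin n) : Plane := !₂[(i : ℝ), (i : ℝ) ^ 2]

variable {n : ℕ}

lemma parabolaPos_injective : Function.Injective (parabolaPos n) := fun a b h => by
  simpa [parabolaPos, Fin.ext_iff] using congr($h 0)

lemma orient_parabolaPos (a b c : Fin n) :
    orient (parabolaPos n) a b c = ((b : ℝ) - a) * (c - a) * (c - b) := by
  simp only [orient, parabolaPos, PiLp.toLp_apply, Matrix.cons_val_zero, Matrix.cons_val_one]
  ring

lemma genPos_parabolaPos : GenPos (parabolaPos n) := by
  intro a b c hab hbc hac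
  have hne : ∀ {a b : Fin n}, a ≠ b → (b : ℝ) - a ≠ 0 := fun h =>
    sub_ne_zero.2 fun heq => h (Fin.ext (Nat.cast_injective heq).symm)
  rw [orient_parabolaPos]
  exact mul_ne_zero (mul_ne_zero (hne hab) (hne hac)) (hne hbc)

lemma orient_parabolaPos_nonneg_of_succ {a b : Fin n} (hab : a.val + 1 = b.val) (c : Fin n) :
    0 ≤ orient (parabolaPos n) a b c := by
  have hb : (b : ℝ) = a + 1 := by exact_mod_cast hab.symm
  rw [orient_parabolaPos, hb]
  rcases Nat.lt_or_ge a.val c.val with h | h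
  · have h : (a : ℝ) + 1 ≤ c := by exact_mod_cast h
    exact mul_nonneg (mul_nonneg (by linarith) (by linarith)) (by linarith)
  · have h : (c : ℝ) ≤ a := by exact_mod_cast h
    exact mul_nonneg_of_nonpos_of_nonpos (by linarith) (by linarith)

lemma crossingFree_parabolaPos (hn : 3 ≤ n) :
    CrossingFree (parabolaPos n) (SimpleGraph.cycleGraph n) := by
  have not_crosses_of_succ : ∀ {a b c d : Fin n}, a.val + 1 = b.val →
      ¬ Crosses (parabolaPos n) a b c d := fun h hcr =>
    hcr.1.not_ge (mul_nonneg (orient_parabolaPos_nonneg_of_succ h _)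
      (orient_parabolaPos_nonneg_of_succ h _))
  intro a b c d hab hcd hcr
  have hne := hcr.ne
  simp only [ne_eq, Fin.ext_iff] at hne
  rw [cycleGraph_adj_iff_val hn] at hab hcd
  rcases hab with h | h | h
  · exact not_crosses_of_succ h hcr
  · exact not_crosses_of_succ h hcr.swap_left
  rcases hcd with h' | h' | h'
  · exact not_crosses_of_succ h' hcr.symm
  · exact not_crosses_of_succ h' hcr.symm.swap_left
  -- both edges join the first vertex to the last one
  · omega

lemma GeometricGraph.polygons_nonempty (hn : 3 ≤ n) : (polygons n).Nonempty :=
  ⟨ofCrossingFree (parabolaPos n) (SimpleGraph.cycleGraph n) parabolaPos_injective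
      genPos_parabolaPos (crossingFree_parabolaPos hn),
    rfl, inGeneralPosition_of_genPos genPos_parabolaPos⟩

end Constructions

/-! ### Polygons with small maximal compatible matchings -/

namespace TightPolygon

section Determinant

/-- The vertices of the polygon are the points `(p, p ^ 2 + height p)` for certain integers `p > 0`,
identified with `p`, and a point far up on the line `p = 0`. -/
def height (p : ℤ) : ℤ := if p % 4 = 0 then 0 else if p % 2 = 0 then 8 else 24

/-- The vertical coordinate of the vertex `p` of the polygon with `14 * t + 14` vertices. The value
at `0` puts this vertex above all lines spanned by the others, see `det_top_pos`. -/
def ordinate (t p : ℤ) : ℤ :=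
  if p = 0 then (32 * t + 32) ^ 2 + 24 * (32 * t + 32) + 25 else p ^ 2 + height p

/-- The orientation determinant of the vertices `p`, `q`, `r`. -/
def det (t p q r : ℤ) : ℤ :=
  (q - p) * (ordinate t r - ordinate t p) - (ordinate t q - ordinate t p) * (r - p)

variable {t p q r s : ℤ}

lemma height_of_mod_four_eq_zero (h : p % 4 = 0) : height p = 0 := if_pos h

lemma height_of_mod_four_eq_two (h : p % 4 = 2) : height p = 8 := by
  rw [height, if_neg (by omega), if_pos (by omega)]

lemma height_of_odd (h : p % 2 = 1) : height p = 24 := by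
  rw [height, if_neg (by omega), if_neg (by omega)]

lemma height_cases (p : ℤ) :
    (p % 4 = 0 ∧ height p = 0) ∨ (p % 4 = 2 ∧ height p = 8) ∨ (p % 2 = 1 ∧ height p = 24) := by
  rcases (by omega : p % 4 = 0 ∨ p % 4 = 2 ∨ p % 2 = 1) with h | h | h
  · exact .inl ⟨h, height_of_mod_four_eq_zero h⟩
  · exact .inr (.inl ⟨h, height_of_mod_four_eq_two h⟩)
  · exact .inr (.inr ⟨h, height_of_odd h⟩)

lemma height_nonneg (p : ℤ) : 0 ≤ height p := by
  rcases height_cases p with h | h | h <;> omega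

lemma height_le (p : ℤ) : height p ≤ 24 := by
  rcases height_cases p with h | h | h <;> omega

lemma det_rot (t p q r : ℤ) : det t q r p = det t p q r := by
  simp only [det]; ring

lemma det_swap (t p q r : ℤ) : det t q p r = -det t p q r := by
  simp only [det]; ring

lemma det_swap_right (t p q r : ℤ) : det t p r q = -det t p q r := by
  simp only [det]; ring

lemma det_eq (hp : p ≠ 0) (hq : q ≠ 0) (hr : r ≠ 0) :
    det t p q r = (q - p) * (r - p) * (r - q) + (q - p) * (height r - height p)
      - (height q - height p) * (r - p) := by
  simp only [det, ordinate, hp, hq, hr, if_false]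
  ring

lemma det_of_height_eq (hp : p ≠ 0) (hq : q ≠ 0) (hr : r ≠ 0) (h : height p = height q) :
    det t p q r = (q - p) * ((r - p) * (r - q) + (height r - height p)) := by
  rw [det_eq hp hq hr, h]
  ring

lemma det_top_pos (hp : 0 < p) (hpq : p < q) (hq : q ≤ 32 * t + 32) : 0 < det t p q 0 := by
  simp only [det, ordinate, hp.ne', (hp.trans hpq).ne', if_false, if_true]
  have hpt : p ^ 2 ≤ (32 * t + 32) ^ 2 := by nlinarith
  have hsq : p ^ 2 < q ^ 2 := by nlinarith
  have htop : 24 * p + 1 ≤ (32 * t + 32) ^ 2 + 24 * (32 * t + 32) + 25 - (p ^ 2 + height p) := by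
    linarith [height_le p]
  have hleft : 24 * p + 1 ≤ (q - p) * ((32 * t + 32) ^ 2 + 24 * (32 * t + 32) + 25
      - (p ^ 2 + height p)) := by
    nlinarith
  have hright : p * (-24) ≤ p * (q ^ 2 + height q - (p ^ 2 + height p)) :=
    mul_le_mul_of_nonneg_left (by linarith [height_le p, height_nonneg q]) hp.le
  linarith

lemma det_top_ne_zero (hp : 0 < p ∧ p ≤ 32 * t + 32) (hq : 0 < q ∧ q ≤ 32 * t + 32) (hpq : p ≠ q) :
    det t p q 0 ≠ 0 := by
  rcases hpq.lt_or_gt with h | h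
  · exact (det_top_pos hp.1 h hq.2).ne'
  · rw [det_swap, neg_ne_zero]
    exact (det_top_pos hq.1 h hp.2).ne'

lemma det_ne_zero_of_height_eq (hp : p ≠ 0) (hq : q ≠ 0) (hr : r ≠ 0) (hpq : p ≠ q) (hqr : q ≠ r)
    (hpr : p ≠ r) (h : height p = height q) : det t p q r ≠ 0 := by
  rw [det_of_height_eq hp hq hr h]
  refine mul_ne_zero (sub_ne_zero.2 hpq.symm) ?_
  by_cases hhr : height r = height p
  · rw [hhr, sub_self, add_zero]
    exact mul_ne_zero (sub_ne_zero.2 hpr.symm) (sub_ne_zero.2 hqr.symm)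
  have hdiff : height r - height p = 8 ∨ height r - height p = -8 ∨
      (r % 2 ≠ p % 2 ∧ (height r - height p) % 2 = 0) := by
    rcases height_cases p with hp | hp | hp <;> rcases height_cases r with hr | hr | hr <;> omega
  have hmod : p % 4 = q % 4 ∨ (p % 2 = 1 ∧ q % 2 = 1) := by
    rcases height_cases p with hp | hp | hp <;> rcases height_cases q with hq | hq | hq <;> omega
  by_cases hodd : r % 2 = p % 2
  -- `r - p` and `r - q` are twice odd numbers, and their product is not divisible by `8`
  · obtain ⟨a, ha⟩ : ∃ a, r - p = 2 * (2 * a + 1) := ⟨(r - p) / 4, by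
      rcases height_cases p with hp | hp | hp <;> rcases height_cases r with hr | hr | hr <;> omega⟩
    obtain ⟨b, hb⟩ : ∃ b, r - q = 2 * (2 * b + 1) := ⟨(r - q) / 4, by
      rcases height_cases p with hp | hp | hp <;> rcases height_cases r with hr | hr | hr <;> omega⟩
    have hprod : (r - p) * (r - q) = 4 * (2 * (2 * a * b + a + b) + 1) := by rw [ha, hb]; ring
    omega
  -- `r - p` and `r - q` are odd, and the heights are even
  · obtain ⟨k, hk⟩ : Odd ((r - p) * (r - q)) :=
      (Int.odd_iff.2 (by omega)).mul (Int.odd_iff.2 (by omega))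
    omega

lemma det_ne_zero_of_mod (hp : p ≠ 0) (hq : q ≠ 0) (hr : r ≠ 0) (hp4 : p % 4 = 0) (hq4 : q % 4 = 2)
    (hr2 : r % 2 = 1) : det t p q r ≠ 0 := by
  rw [det_eq hp hq hr, height_of_mod_four_eq_zero hp4, height_of_mod_four_eq_two hq4,
    height_of_odd hr2]
  obtain ⟨m, hm, hmodd⟩ : ∃ m, q - p = 2 * m ∧ Odd m :=
    ⟨(q - p) / 2, by omega, Int.odd_iff.2 (by omega)⟩
  -- the determinant is `2` modulo `4`
  obtain ⟨k, hk⟩ : Odd (m * ((r - p) * (r - q))) :=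
    hmodd.mul ((Int.odd_iff.2 (by omega)).mul (Int.odd_iff.2 (by omega)))
  have hprod : (q - p) * (r - p) * (r - q) = 2 * (2 * k + 1) := by rw [hm, ← hk]; ring
  omega

lemma det_ne_zero_of_pos (hp : 0 < p) (hq : 0 < q) (hr : 0 < r) (hpq : p ≠ q) (hqr : q ≠ r)
    (hpr : p ≠ r) : det t p q r ≠ 0 := by
  have rot : ∀ {p q r}, det t p q r ≠ 0 → det t q r p ≠ 0 := fun h => by rwa [det_rot]
  have swap : ∀ {p q r}, det t p q r ≠ 0 → det t q p r ≠ 0 := fun h => by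
    rwa [det_swap, neg_ne_zero]
  have hp := hp.ne'
  have hq := hq.ne'
  have hr := hr.ne'
  by_cases hhpq : height p = height q
  · exact det_ne_zero_of_height_eq hp hq hr hpq hqr hpr hhpq
  by_cases hhqr : height q = height r
  · exact rot (rot (det_ne_zero_of_height_eq hq hr hp hqr hpr.symm hpq.symm hhqr))
  by_cases hhpr : height r = height p
  · exact rot (det_ne_zero_of_height_eq hr hp hq hpr.symm hpq hqr.symm hhpr)
  rcases height_cases p with ⟨hp4, hhp⟩ | ⟨hp4, hhp⟩ | ⟨hp4, hhp⟩ <;>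
    rcases height_cases q with ⟨hq4, hhq⟩ | ⟨hq4, hhq⟩ | ⟨hq4, hhq⟩ <;>
    rcases height_cases r with ⟨hr4, hhr⟩ | ⟨hr4, hhr⟩ | ⟨hr4, hhr⟩ <;> try omega
  · exact det_ne_zero_of_mod hp hq hr hp4 hq4 hr4
  · exact rot (swap (det_ne_zero_of_mod hp hr hq hp4 hr4 hq4))
  · exact swap (det_ne_zero_of_mod hq hp hr hq4 hp4 hr4)
  · exact rot (det_ne_zero_of_mod hr hp hq hr4 hp4 hq4)
  · exact rot (rot (det_ne_zero_of_mod hq hr hp hq4 hr4 hp4))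
  · exact rot (rot (swap (det_ne_zero_of_mod hr hq hp hr4 hq4 hp4)))

/-- The integers that are vertices. -/
def IsVertex (t p : ℤ) : Prop :=
  p = 0 ∨ (p % 4 = 0 ∧ 4 ≤ p ∧ p ≤ 32 * t + 32) ∨ (p % 8 = 2 ∧ 10 ≤ p ∧ p ≤ 32 * t + 26) ∨
    p = 21 ∨ p = 23 ∨ ((p % 32 = 13 ∨ p % 32 = 15) ∧ 45 ≤ p ∧ p ≤ 32 * t + 15)

lemma IsVertex.bounds (ht : 0 ≤ t) (h : IsVertex t p) (hp : p ≠ 0) : 0 < p ∧ p ≤ 32 * t + 32 := by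
  unfold IsVertex at h
  omega

lemma det_ne_zero (ht : 0 ≤ t) (hp : IsVertex t p) (hq : IsVertex t q) (hr : IsVertex t r)
    (hpq : p ≠ q) (hqr : q ≠ r) (hpr : p ≠ r) : det t p q r ≠ 0 := by
  rcases eq_or_ne r 0 with rfl | hr0
  · exact det_top_ne_zero (hp.bounds ht hpr) (hq.bounds ht hqr) hpq
  rcases eq_or_ne q 0 with rfl | hq0
  · rw [← det_rot, ← det_rot]
    exact det_top_ne_zero (hr.bounds ht hr0) (hp.bounds ht hpq) hpr.symm
  rcases eq_or_ne p 0 with rfl | hp0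
  · rw [← det_rot]
    exact det_top_ne_zero (hq.bounds ht hq0) (hr.bounds ht hr0) hqr
  exact det_ne_zero_of_pos (hp.bounds ht hp0).1 (hq.bounds ht hq0).1 (hr.bounds ht hr0).1
    hpq hqr hpr

end Determinant

section Edges

/-- The segments `pq` and `rs` cross. -/
def SegCross (t p q r s : ℤ) : Prop :=
  det t p q r * det t p q s < 0 ∧ det t r s p * det t r s q < 0

/-- The number `g` starts a run `g`, `g + 3`, `g + 5`, `g + 8` of consecutive vertices of the
polygon, whose ends are matched with each other. -/
def IsBase (t g : ℤ) : Prop := g = 18 ∨ (g % 32 = 10 ∧ 42 ≤ g ∧ g ≤ 32 * t + 10)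

/-- Two neighbours, from left to right, in the run that starts at `g`. -/
def RunStep (g p q : ℤ) : Prop :=
  (p = g ∧ q = g + 3) ∨ (p = g + 3 ∧ q = g + 5) ∨ (p = g + 5 ∧ q = g + 8)

/-- The edges of the polygon along its runs. -/
def RunEdge (t p q : ℤ) : Prop := ∃ g, IsBase t g ∧ RunStep g p q

/-- The edges of the polygon between consecutive points of the parabola. -/
def LowEdge (t p q : ℤ) : Prop := p % 4 = 0 ∧ 4 ≤ p ∧ q = p + 4 ∧ q ≤ 32 * t + 32

/-- The segments between consecutive points at height `8`: matching edges below the runs and edges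
of the polygon elsewhere. -/
def MiddleEdge (t p q : ℤ) : Prop := p % 8 = 2 ∧ 10 ≤ p ∧ q = p + 8 ∧ q ≤ 32 * t + 26

/-- The edges at the vertex `0`: a matching edge to `10` and two edges of the polygon. -/
def TopEdge (t p q : ℤ) : Prop := p = 0 ∧ (q = 10 ∨ q = 32 * t + 26 ∨ q = 32 * t + 32)

/-- The matching edges that separate the runs from each other. -/
def ChordEdge (t p q : ℤ) : Prop := p % 32 = 2 ∧ 34 ≤ p ∧ q = p + 24 ∧ q ≤ 32 * t + 26

/-- The edges of the polygon, from left to right. -/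
def PolyEdge (t p q : ℤ) : Prop :=
  LowEdge t p q ∨ (MiddleEdge t p q ∧ ¬ IsBase t p) ∨ (p = 4 ∧ q = 10) ∨
    (TopEdge t p q ∧ q ≠ 10) ∨ RunEdge t p q

/-- The edges of the matching, from left to right. -/
def MatchEdge (t p q : ℤ) : Prop :=
  (p = 0 ∧ q = 10) ∨ (IsBase t p ∧ q = p + 8) ∨ ChordEdge t p q

/-- The edges of the polygon and of the matching other than the `LowEdge`s. -/
def UpperEdge (t p q : ℤ) : Prop :=
  MiddleEdge t p q ∨ (p = 4 ∧ q = 10) ∨ TopEdge t p q ∨ ChordEdge t p q ∨ RunEdge t p q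

/-- The vertices off the parabola, except `0`. -/
def IsRaised (t p : ℤ) : Prop := (p % 8 = 2 ∨ p % 2 = 1) ∧ 10 ≤ p ∧ p ≤ 32 * t + 26

/-- The vertices off the parabola and the two extreme vertices on it. -/
def IsUpper (t p : ℤ) : Prop := p = 0 ∨ p = 4 ∨ p = 32 * t + 32 ∨ IsRaised t p

variable {t g p q r s : ℤ}

lemma edge_cases (ht : 0 ≤ t) (h : PolyEdge t p q ∨ MatchEdge t p q) :
    LowEdge t p q ∨ UpperEdge t p q := by
  rcases h with (h | h | h | h | h) | (h | h | h)
  · exact .inl h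
  · exact .inr (.inl h.1)
  · exact .inr (.inr (.inl h))
  · exact .inr (.inr (.inr (.inl h.1)))
  · exact .inr (.inr (.inr (.inr (.inr h))))
  · exact .inr (.inr (.inr (.inl ⟨h.1, .inl h.2⟩)))
  · refine .inr (.inl ?_)
    unfold IsBase at h
    unfold MiddleEdge
    omega
  · exact .inr (.inr (.inr (.inr (.inl h))))

lemma middleEdge_cases (h : MiddleEdge t p q) : PolyEdge t p q ∨ MatchEdge t p q := by
  by_cases hp : IsBase t p
  · exact .inr (.inr (.inl ⟨hp, h.2.2.1⟩))
  · exact .inl (.inr (.inl ⟨h, hp⟩))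

lemma IsRaised.eight_le_height (h : IsRaised t p) : 8 ≤ height p := by
  rcases h.1 with h | h
  · rw [height_of_mod_four_eq_two (by omega)]
  · rw [height_of_odd h]; norm_num

lemma ChordEdge.isRaised (h : ChordEdge t p q) : IsRaised t p ∧ IsRaised t q := by
  unfold ChordEdge at h
  unfold IsRaised
  omega

lemma RunEdge.isRaised (ht : 0 ≤ t) (h : RunEdge t p q) : IsRaised t p ∧ IsRaised t q := by
  obtain ⟨g, hg, h⟩ := h
  unfold IsBase at hg
  unfold RunStep at h
  unfold IsRaised
  omega

lemma UpperEdge.isUpper (ht : 0 ≤ t) (h : UpperEdge t p q) : IsUpper t p ∧ IsUpper t q := by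
  rcases h with h | h | h | h | h
  · unfold MiddleEdge at h
    unfold IsUpper IsRaised
    omega
  · unfold IsUpper IsRaised
    omega
  · unfold TopEdge at h
    unfold IsUpper IsRaised
    omega
  · exact ⟨.inr (.inr (.inr h.isRaised.1)), .inr (.inr (.inr h.isRaised.2))⟩
  · exact ⟨.inr (.inr (.inr (h.isRaised ht).1)), .inr (.inr (.inr (h.isRaised ht).2))⟩

lemma LowEdge.det_nonneg (h : LowEdge t p q) (r : ℤ) : 0 ≤ det t p q r := by
  obtain ⟨hp4, hp, rfl, hq⟩ := h
  rcases eq_or_ne r 0 with rfl | hr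
  · exact (det_top_pos (by omega) (by omega) hq).le
  have hhp := height_of_mod_four_eq_zero hp4
  rw [det_of_height_eq (by omega) (by omega) hr
    (by rw [hhp, height_of_mod_four_eq_zero (by omega : (p + 4) % 4 = 0)]), hhp]
  refine mul_nonneg (by omega) ?_
  rcases height_cases r with ⟨hr4, hhr⟩ | ⟨-, hhr⟩ | ⟨-, hhr⟩
  · rcases (by omega : r ≤ p ∨ p + 4 ≤ r) with h | h <;> nlinarith
  · nlinarith [sq_nonneg (r - p - 2)]
  · nlinarith [sq_nonneg (r - p - 2)]

lemma MiddleEdge.det_eq (h : MiddleEdge t p q) (hr : r ≠ 0) :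
    det t p q r = 8 * ((r - p) * (r - q) + (height r - 8)) := by
  obtain ⟨hp8, hp, rfl, -⟩ := h
  have hhp : height p = 8 := height_of_mod_four_eq_two (by omega)
  rw [det_of_height_eq (by omega) (by omega) hr
    (by rw [hhp, height_of_mod_four_eq_two (by omega : (p + 8) % 4 = 2)]), hhp, add_sub_cancel_left]

lemma MiddleEdge.det_nonneg (h : MiddleEdge t p q) (hr : IsUpper t r) : 0 ≤ det t p q r := by
  have ⟨hp8, hp, hpq, hq⟩ := h
  rcases eq_or_ne r 0 with rfl | hr0
  · exact (det_top_pos (by omega) (by omega) (by omega)).le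
  rw [h.det_eq hr0]
  refine mul_nonneg (by norm_num) ?_
  rcases hr with hr | hr | hr | ⟨hr | hr, -⟩
  · contradiction
  · nlinarith [height_nonneg r]
  · nlinarith [height_nonneg r]
  · rw [height_of_mod_four_eq_two (by omega)]
    rcases (by omega : r ≤ p ∨ q ≤ r) with h | h <;> nlinarith
  · rw [height_of_odd hr]
    rw [hpq]
    nlinarith [sq_nonneg (r - p - 4)]

lemma left_det_nonneg (ht : 0 ≤ t) (hr : IsUpper t r) : 0 ≤ det t 4 10 r := by
  rcases eq_or_ne r 0 with rfl | hr0
  · exact (det_top_pos (by omega) (by omega) (by omega)).le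
  have hh4 : height 4 = 0 := by decide
  have hh10 : height 10 = 8 := by decide
  rw [det_eq (by omega) (by omega) hr0, hh4, hh10]
  rcases (by unfold IsUpper IsRaised at hr; omega : r = 4 ∨ r = 10 ∨ 12 ≤ r ∨ r = 11)
    with rfl | rfl | hr | rfl
  · norm_num [hh4]
  · norm_num [hh10]
  · nlinarith [height_nonneg r]
  · decide

lemma det_top_right_nonneg (hp : 0 < p) (hpr : p ≤ r) (hr : r ≤ 32 * t + 32) :
    0 ≤ det t 0 p r := by
  rcases hpr.eq_or_lt with rfl | hpr
  · simp only [det]; ring_nf; rfl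
  · rw [← det_rot]; exact (det_top_pos hp hpr hr).le

lemma det_top_left_nonpos (hr : 0 < r) (hrp : r ≤ p) (hp : p ≤ 32 * t + 32) :
    det t 0 p r ≤ 0 := by
  rw [det_swap_right, neg_nonpos]
  exact det_top_right_nonneg hr hrp hp

lemma TopEdge.mul_nonneg (h : TopEdge t p q) (hrs : r = 0 ∨ (IsRaised t r ∧ IsRaised t s)) :
    0 ≤ det t p q r * det t p q s := by
  obtain ⟨rfl, hq⟩ := h
  rcases hrs with rfl | ⟨⟨-, hr⟩, ⟨-, hs⟩⟩
  · rw [show det t 0 q 0 = 0 by simp only [det]; ring, zero_mul]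
  rcases hq with rfl | hq
  · exact Int.mul_nonneg (det_top_right_nonneg (by omega) (by omega) (by omega))
      (det_top_right_nonneg (by omega) (by omega) (by omega))
  · exact mul_nonneg_of_nonpos_of_nonpos (det_top_left_nonpos (by omega) (by omega) (by omega))
      (det_top_left_nonpos (by omega) (by omega) (by omega))

lemma ChordEdge.det_eq (h : ChordEdge t p q) (hr : r ≠ 0) :
    det t p q r = 24 * ((r - p) * (r - q) + (height r - 8)) := by
  obtain ⟨hp32, hp, rfl, -⟩ := h
  have hhp : height p = 8 := height_of_mod_four_eq_two (by omega)
  rw [det_of_height_eq (by omega) (by omega) hr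
    (by rw [hhp, height_of_mod_four_eq_two (by omega : (p + 24) % 4 = 2)]), hhp,
    add_sub_cancel_left]

lemma ChordEdge.det_nonneg (h : ChordEdge t p q) (hr : IsRaised t r) (hrpq : r ≤ p ∨ q ≤ r) :
    0 ≤ det t p q r := by
  have hq := h.2.2.1
  rw [h.det_eq (by have := hr.2; omega)]
  have := hr.eight_le_height
  rcases hrpq with h | h <;> nlinarith

lemma ChordEdge.det_nonpos (h : ChordEdge t p q) (hpr : p + 8 ≤ r) (hrq : r ≤ p + 16) :
    det t p q r ≤ 0 := by
  have hp := h.2.1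
  have hq := h.2.2.1
  rw [h.det_eq (by omega)]
  nlinarith [height_le r]

lemma ChordEdge.mul_nonneg (ht : 0 ≤ t) (h : ChordEdge t p q)
    (hrs : ChordEdge t r s ∨ RunEdge t r s) : 0 ≤ det t p q r * det t p q s := by
  rcases hrs with hrs | hrs
  · have houter : (r ≤ p ∨ q ≤ r) ∧ (s ≤ p ∨ q ≤ s) := by
      unfold ChordEdge at h hrs
      omega
    exact Int.mul_nonneg (h.det_nonneg hrs.isRaised.1 houter.1)
      (h.det_nonneg hrs.isRaised.2 houter.2)
  · have ⟨hr, hs⟩ := hrs.isRaised ht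
    have hinner_or_outer : (p + 8 ≤ r ∧ r ≤ p + 16) ∧ (p + 8 ≤ s ∧ s ≤ p + 16) ∨
        (r ≤ p ∨ q ≤ r) ∧ (s ≤ p ∨ q ≤ s) := by
      obtain ⟨g, hg, hrs⟩ := hrs
      unfold ChordEdge at h
      unfold IsBase at hg
      unfold RunStep at hrs
      omega
    rcases hinner_or_outer with ⟨hr', hs'⟩ | ⟨hr', hs'⟩
    · exact mul_nonneg_of_nonpos_of_nonpos (h.det_nonpos hr'.1 hr'.2) (h.det_nonpos hs'.1 hs'.2)
    · exact Int.mul_nonneg (h.det_nonneg hr hr') (h.det_nonneg hs hs')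

lemma IsBase.pos (hg : IsBase t g) : 0 < g := by
  unfold IsBase at hg
  omega

lemma IsBase.height_run (hg : IsBase t g) :
    height g = 8 ∧ height (g + 3) = 24 ∧ height (g + 5) = 24 ∧ height (g + 8) = 8 := by
  have hg8 : g % 8 = 2 := by unfold IsBase at hg; omega
  exact ⟨height_of_mod_four_eq_two (by omega), height_of_odd (by omega), height_of_odd (by omega),
    height_of_mod_four_eq_two (by omega)⟩

lemma RunStep.det_nonneg (hg : IsBase t g) (h : RunStep g p q) (hr : IsRaised t r)
    (hfar : r ≤ g - 16 ∨ g + 24 ≤ r) : 0 ≤ det t p q r := by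
  obtain ⟨h0, h3, h5, h8⟩ := hg.height_run
  have hg0 := hg.pos
  have hr0 : r ≠ 0 := by have := hr.2; omega
  have := hr.eight_le_height
  rcases h with ⟨rfl, rfl⟩ | ⟨rfl, rfl⟩ | ⟨rfl, rfl⟩ <;>
    rw [TightPolygon.det_eq (by omega) (by omega) hr0] <;>
    simp only [h0, h3, h5, h8] <;>
    rcases hfar with h | h <;> nlinarith

lemma RunStep.mul_nonneg (hg : IsBase t g) (h : RunStep g p q) (hrs : RunStep g r s) :
    0 ≤ det t p q r * det t p q s := by
  obtain ⟨h0, h3, h5, h8⟩ := hg.height_run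
  have hg0 := hg.pos
  rcases h with ⟨rfl, rfl⟩ | ⟨rfl, rfl⟩ | ⟨rfl, rfl⟩ <;>
    rcases hrs with ⟨rfl, rfl⟩ | ⟨rfl, rfl⟩ | ⟨rfl, rfl⟩ <;>
    rw [TightPolygon.det_eq (by omega) (by omega) (by omega),
      TightPolygon.det_eq (by omega) (by omega) (by omega)] <;>
    simp only [h0, h3, h5, h8] <;> ring_nf <;> norm_num

lemma RunEdge.mul_nonneg (ht : 0 ≤ t) (h : RunEdge t p q) (hrs : RunEdge t r s) :
    0 ≤ det t p q r * det t p q s := by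
  have ⟨hr, hs⟩ := hrs.isRaised ht
  obtain ⟨g, hg, h⟩ := h
  obtain ⟨g', hg', hrs⟩ := hrs
  rcases eq_or_ne g g' with rfl | hne
  · exact h.mul_nonneg hg hrs
  · have hfar : (r ≤ g - 16 ∨ g + 24 ≤ r) ∧ (s ≤ g - 16 ∨ g + 24 ≤ s) := by
      unfold IsBase at hg hg'
      unfold RunStep at hrs
      omega
    exact Int.mul_nonneg (h.det_nonneg hg hr hfar.1) (h.det_nonneg hg hs hfar.2)

lemma not_segCross_of_or {E F : ℤ → ℤ → Prop}
    (hE : ∀ ⦃p q r s⦄, E p q → E r s ∨ F r s → 0 ≤ det t p q r * det t p q s)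
    (hF : ∀ ⦃p q r s⦄, F p q → F r s → ¬ SegCross t p q r s) ⦃p q r s : ℤ⦄
    (h : E p q ∨ F p q) (h' : E r s ∨ F r s) : ¬ SegCross t p q r s := by
  rcases h with hpq | hpq
  · exact fun hcr => hcr.1.not_ge (hE hpq h')
  rcases h' with hrs | hrs
  · exact fun hcr => hcr.2.not_ge (hE hrs (.inr hpq))
  · exact hF hpq hrs

-- Take the edges in the order of `UpperEdge`, starting with the `LowEdge`s: the ends of a later
-- edge never lie strictly on different sides of an earlier one.
lemma not_segCross (ht : 0 ≤ t) (h : PolyEdge t p q ∨ MatchEdge t p q)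
    (h' : PolyEdge t r s ∨ MatchEdge t r s) : ¬ SegCross t p q r s := by
  have run : ∀ ⦃p q r s⦄, RunEdge t p q → RunEdge t r s → ¬ SegCross t p q r s :=
    fun _ _ _ _ h hrs hcr => hcr.1.not_ge (h.mul_nonneg ht hrs)
  have chord := not_segCross_of_or (E := ChordEdge t)
    (fun _ _ _ _ h hrs => h.mul_nonneg ht (hrs.imp_left id)) run
  have top := not_segCross_of_or (E := TopEdge t) (fun _ _ _ _ h hrs => h.mul_nonneg <| by
    rcases hrs with hrs | hrs | hrs
    exacts [.inl hrs.1, .inr hrs.isRaised, .inr (hrs.isRaised ht)]) chord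
  have left := not_segCross_of_or (E := fun p q => p = 4 ∧ q = 10) (fun p q r s h hrs => by
    obtain ⟨rfl, rfl⟩ := h
    have ⟨hr, hs⟩ := UpperEdge.isUpper ht (.inr hrs)
    exact mul_nonneg (left_det_nonneg ht hr) (left_det_nonneg ht hs)) top
  have middle := not_segCross_of_or (E := MiddleEdge t) (fun p q r s h hrs => by
    have ⟨hr, hs⟩ := UpperEdge.isUpper ht hrs
    exact mul_nonneg (h.det_nonneg hr) (h.det_nonneg hs)) left
  exact not_segCross_of_or (E := LowEdge t) (F := UpperEdge t)
    (fun _ _ _ _ h _ => mul_nonneg (h.det_nonneg _) (h.det_nonneg _)) middle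
    (edge_cases ht h) (edge_cases ht h')

end Edges

section FreeVertices

/-- The unmatched vertices: those on the parabola and those inside the runs. -/
def IsFree (t p : ℤ) : Prop :=
  (p % 4 = 0 ∧ 4 ≤ p ∧ p ≤ 32 * t + 32) ∨
    p = 21 ∨ p = 23 ∨ ((p % 32 = 13 ∨ p % 32 = 15) ∧ 45 ≤ p ∧ p ≤ 32 * t + 15)

variable {t d p q r s : ℤ}

lemma det_of_mod_four_eq_zero (hp : p ≠ 0) (hq : q ≠ 0) (hr : r ≠ 0) (hq4 : q % 4 = 0) :
    det t p q r = (q - p) * ((r - p) * (r - q) + height r) + height p * (r - q) := by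
  rw [det_eq hp hq hr, height_of_mod_four_eq_zero hq4]
  ring

lemma det_pos_of_low_between (hp : 0 < p) (hpq : p < q) (hqr : q < r) (hq4 : q % 4 = 0) :
    0 < det t p q r := by
  rw [det_of_mod_four_eq_zero (by omega) (by omega) (by omega) hq4]
  have := sub_pos.2 hpq
  have := sub_pos.2 hqr
  have : 0 < r - p := by omega
  have := height_nonneg p
  have := height_nonneg r
  positivity

lemma far_end_inequality (hd : d = 2 ∨ d = 6) {D h : ℤ} (hDh : h = 24 ∨ (h = 0 ∧ 8 ≤ D)) :
    D * (8 - (D - d) * d) < h * d := by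
  rcases hDh with rfl | ⟨rfl, hD⟩
  · rcases hd with rfl | rfl
    · nlinarith [sq_nonneg (D - 3)]
    · nlinarith [sq_nonneg (D - 4)]
  · rcases hd with rfl | rfl <;> nlinarith

lemma height_of_odd_or_far (h : p % 2 = 1 ∨ (p % 4 = 0 ∧ q + 8 ≤ r)) :
    height p = 24 ∨ (height p = 0 ∧ 8 ≤ r - q) :=
  h.imp height_of_odd fun h => ⟨height_of_mod_four_eq_zero h.1, by omega⟩

lemma det_neg_of_low_right (hd : d = 2 ∨ d = 6) (hp : 0 < p) (hq4 : q % 4 = 0) (hdq : d < q)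
    (h : p % 2 = 1 ∨ (p % 4 = 0 ∧ p + 8 ≤ q)) : det t p q (q - d) < 0 := by
  rw [det_of_mod_four_eq_zero (by omega) (by omega) (by omega) hq4,
    height_of_mod_four_eq_two (by omega : (q - d) % 4 = 2)]
  linarith [far_end_inequality hd (height_of_odd_or_far h)]

lemma det_neg_of_low_left (hd : d = 2 ∨ d = 6) (hp : 0 < p) (hp4 : p % 4 = 0)
    (h : q % 2 = 1) : det t p q (p + d) < 0 := by
  rw [← neg_pos, ← det_swap, det_of_mod_four_eq_zero (by omega) (by omega) (by omega) hp4,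
    height_of_mod_four_eq_two (by omega : (p + d) % 4 = 2)]
  linarith [far_end_inequality (D := q - p) hd (.inl (height_of_odd h))]

lemma MiddleEdge.det_neg (h : MiddleEdge t r s) (hp4 : p % 4 = 0) (hrp : r < p) (hps : p < s) :
    det t r s p < 0 := by
  have ⟨hr8, hr, hrs, _⟩ := h
  rw [h.det_eq (by omega), height_of_mod_four_eq_zero hp4]
  nlinarith

lemma MiddleEdge.det_pos (h : MiddleEdge t r s) (hp : 0 < p)
    (hfar : p % 2 = 1 ∨ (p % 4 = 0 ∧ p < r)) : 0 < det t r s p := by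
  have ⟨hr8, _, hrs, _⟩ := h
  rw [h.det_eq hp.ne']
  rcases hfar with hp2 | ⟨hp4, hpr⟩
  · have : 0 < (p - r - 4) ^ 2 := by
      have : p - r - 4 ≠ 0 := by omega
      positivity
    rw [height_of_odd hp2, hrs]
    linarith
  · rw [height_of_mod_four_eq_zero hp4]
    have : p + 2 ≤ r := by omega
    nlinarith

lemma segCross_top (hp : 0 < p) (hpr : p < r) (hrq : r < q) (hq : q ≤ 32 * t + 32)
    (h : det t p q r < 0) : SegCross t p q 0 r := by
  refine ⟨mul_neg_of_pos_of_neg (det_top_pos hp (by omega) hq) h, mul_neg_of_neg_of_pos ?_ ?_⟩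
  · rw [det_swap_right, neg_neg_iff_pos, ← det_rot]
    exact det_top_pos hp hpr (by omega)
  · rw [← det_rot]
    exact det_top_pos (by omega) hrq hq

lemma exists_segCross_of_right_low (hp : IsFree t p) (hq : IsFree t q) (hq4 : q % 4 = 0)
    (hpq : p < q) (hadj : q ≠ p + 4) :
    ∃ r s, (PolyEdge t r s ∨ MatchEdge t r s) ∧ SegCross t p q r s := by
  unfold IsFree at hp hq
  obtain ⟨d, hd, hqd⟩ : ∃ d : ℤ, (d = 2 ∨ d = 6) ∧ (q - d) % 8 = 2 := by
    rcases (by omega : q % 8 = 4 ∨ q % 8 = 0) with h | h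
    exacts [⟨2, by omega⟩, ⟨6, by omega⟩]
  have hfar : p % 2 = 1 ∨ (p % 4 = 0 ∧ p + 8 ≤ q) := by omega
  have hbelow : det t p q (q - d) < 0 := det_neg_of_low_right hd (by omega) hq4 (by omega) hfar
  by_cases hlast : q - d + 8 ≤ 32 * t + 26
  · have hedge : MiddleEdge t (q - d) (q - d + 8) := ⟨hqd, by omega, rfl, hlast⟩
    exact ⟨_, _, middleEdge_cases hedge,
      mul_neg_of_neg_of_pos hbelow (det_pos_of_low_between (by omega) hpq (by omega) hq4),
      mul_neg_of_pos_of_neg (hedge.det_pos (by omega) (by omega))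
        (hedge.det_neg hq4 (by omega) (by omega))⟩
  · exact ⟨0, q - d, .inl (.inr (.inr (.inr (.inl ⟨⟨rfl, by omega⟩, by omega⟩)))),
      segCross_top (by omega) (by omega) (by omega) (by omega) hbelow⟩

lemma exists_segCross_of_left_low (hp : IsFree t p) (hq : IsFree t q) (hp4 : p % 4 = 0)
    (hq2 : q % 2 = 1) (hpq : p < q) :
    ∃ r s, (PolyEdge t r s ∨ MatchEdge t r s) ∧ SegCross t p q r s := by
  unfold IsFree at hp hq
  obtain ⟨d, hd, hpd⟩ : ∃ d : ℤ, (d = 2 ∨ d = 6) ∧ (p + d) % 8 = 2 := by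
    rcases (by omega : p % 8 = 0 ∨ p % 8 = 4) with h | h
    exacts [⟨2, by omega⟩, ⟨6, by omega⟩]
  have hbelow : det t p q (p + d) < 0 := det_neg_of_low_left hd (by omega) hp4 hq2
  by_cases hfirst : p + d = 10
  · rw [hfirst] at hbelow
    exact ⟨0, 10, .inr (.inl ⟨rfl, rfl⟩),
      segCross_top (by omega) (by omega) (by omega) (by omega) hbelow⟩
  · have hedge : MiddleEdge t (p + d - 8) (p + d) := by
      unfold MiddleEdge
      omega
    refine ⟨_, _, middleEdge_cases hedge, mul_neg_of_pos_of_neg ?_ hbelow,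
      mul_neg_of_neg_of_pos (hedge.det_neg hp4 (by omega) (by omega))
        (hedge.det_pos (by omega) (.inl hq2))⟩
    rw [det_rot]
    exact det_pos_of_low_between (by omega) (by omega) hpq hp4

lemma exists_segCross_of_odd (hp : IsFree t p) (hq : IsFree t q) (hp2 : p % 2 = 1)
    (hq2 : q % 2 = 1) (hpq : p < q) (hadj : q ≠ p + 2) :
    ∃ r s, (PolyEdge t r s ∨ MatchEdge t r s) ∧ SegCross t p q r s := by
  unfold IsFree at hp hq
  have hp24 := height_of_odd hp2
  have hq24 := height_of_odd hq2
  -- the chord below the run of `q`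
  obtain ⟨r, hr, hrq, hqr⟩ : ∃ r, r % 32 = 2 ∧ r + 11 ≤ q ∧ q ≤ r + 13 :=
    ⟨q - q % 32 + 2, by omega, by omega, by omega⟩
  have hpr : p + 11 ≤ r := by omega
  have hedge : ChordEdge t r (r + 24) := ⟨hr, by omega, rfl, by omega⟩
  have hdet : ∀ {c}, c ≠ 0 → c % 4 = 2 → det t p q c = (q - p) * ((c - p) * (c - q) - 16) := by
    intro c hc hc4
    rw [det_of_height_eq (by omega) (by omega) hc (by rw [hp24, hq24]),
      height_of_mod_four_eq_two hc4, hp24]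
    ring
  refine ⟨r, r + 24, .inr (.inr (.inr hedge)), mul_neg_of_neg_of_pos ?_ ?_,
    mul_neg_of_pos_of_neg ?_ ?_⟩
  · rw [hdet (by omega) (by omega)]
    exact mul_neg_of_pos_of_neg (by omega) (by nlinarith)
  · rw [hdet (by omega) (by omega)]
    exact mul_pos (by omega) (by nlinarith)
  · rw [hedge.det_eq (by omega), hp24]
    nlinarith
  · rw [hedge.det_eq (by omega), hq24]
    nlinarith

lemma exists_segCross (hp : IsFree t p) (hq : IsFree t q) (hpq : p < q)
    (hadj : ¬ PolyEdge t p q) : ∃ r s, (PolyEdge t r s ∨ MatchEdge t r s) ∧ SegCross t p q r s := by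
  by_cases hq4 : q % 4 = 0
  · refine exists_segCross_of_right_low hp hq hq4 hpq fun h => hadj (.inl ?_)
    unfold IsFree at hp hq
    unfold LowEdge
    omega
  have hq2 : q % 2 = 1 := by unfold IsFree at hq; omega
  by_cases hp4 : p % 4 = 0
  · exact exists_segCross_of_left_low hp hq hp4 hq2 hpq
  have hp2 : p % 2 = 1 := by unfold IsFree at hp; omega
  refine exists_segCross_of_odd hp hq hp2 hq2 hpq fun h => hadj ?_
  refine .inr (.inr (.inr (.inr ⟨p - 3, ?_, .inr (.inl ⟨by ring, by omega⟩)⟩)))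
  unfold IsFree at hp hq
  unfold IsBase
  omega

end FreeVertices

section CyclicOrder

/-- The vertices of the polygon in cyclic order: first the vertices at positive height and then,
after `0`, the points of the parabola from right to left. -/
def abscissa (t i : ℕ) : ℤ :=
  if i < 5 then [10, 18, 21, 23, 26].getD i 0
  else if i < 6 * t + 5 then 32 * ((i + 1) / 6 : ℕ) + [2, 10, 13, 15, 18, 26].getD ((i + 1) % 6) 0
  else if i = 6 * t + 5 then 0
  else 4 * (14 * t + 14 - i)

/-- The vertex `p` has index `i` in the enumeration `abscissa`. -/
def HasIndex (t p i : ℤ) : Prop :=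
  (p = 18 ∧ i = 1) ∨ (p = 21 ∧ i = 2) ∨ (p = 23 ∧ i = 3) ∨
    (∃ j, 0 ≤ j ∧ j ≤ t ∧ ((p = 32 * j + 10 ∧ i = 6 * j) ∨ (p = 32 * j + 26 ∧ i = 6 * j + 4))) ∨
    (∃ j, 1 ≤ j ∧ j ≤ t ∧ ((p = 32 * j + 2 ∧ i = 6 * j - 1) ∨ (p = 32 * j + 13 ∧ i = 6 * j + 1) ∨
      (p = 32 * j + 15 ∧ i = 6 * j + 2) ∨ (p = 32 * j + 18 ∧ i = 6 * j + 3))) ∨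
    (p = 0 ∧ i = 6 * t + 5) ∨ (4 ≤ p ∧ p ≤ 32 * t + 32 ∧ p = 4 * (14 * t + 14 - i))

variable {t i i' j p q : ℤ}

lemma hasIndex_outer (h : 0 ≤ j ∧ j ≤ t ∧ ((p = 32 * j + 10 ∧ i = 6 * j) ∨
    (p = 32 * j + 26 ∧ i = 6 * j + 4))) : HasIndex t p i :=
  .inr (.inr (.inr (.inl ⟨j, h⟩)))

lemma hasIndex_inner (h : 1 ≤ j ∧ j ≤ t ∧ ((p = 32 * j + 2 ∧ i = 6 * j - 1) ∨
    (p = 32 * j + 13 ∧ i = 6 * j + 1) ∨ (p = 32 * j + 15 ∧ i = 6 * j + 2) ∨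
    (p = 32 * j + 18 ∧ i = 6 * j + 3))) : HasIndex t p i :=
  .inr (.inr (.inr (.inr (.inl ⟨j, h⟩))))

lemma hasIndex_zero (h : i = 6 * t + 5) : HasIndex t 0 i :=
  .inr (.inr (.inr (.inr (.inr (.inl ⟨rfl, h⟩)))))

lemma hasIndex_low (h : 4 ≤ p ∧ p ≤ 32 * t + 32 ∧ p = 4 * (14 * t + 14 - i)) : HasIndex t p i :=
  .inr (.inr (.inr (.inr (.inr (.inr h)))))

lemma hasIndex_abscissa {t i : ℕ} (hi : i < 14 * t + 14) : HasIndex t (abscissa t i) i := by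
  unfold abscissa
  split_ifs with h5 hrun htop
  · interval_cases i
    exacts [hasIndex_outer (j := 0) (by simp), .inl (by simp), .inr (.inl (by simp)),
      .inr (.inr (.inl (by simp))), hasIndex_outer (j := 0) (by simp)]
  · have hk := Nat.mod_lt (i + 1) (by norm_num : 0 < 6)
    have hdiv := Nat.div_add_mod (i + 1) 6
    generalize (i + 1) / 6 = j at *
    generalize (i + 1) % 6 = k at *
    interval_cases k
    exacts [hasIndex_inner (j := j) (by simp; omega), hasIndex_outer (j := j) (by simp; omega),
      hasIndex_inner (j := j) (by simp; omega), hasIndex_inner (j := j) (by simp; omega),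
      hasIndex_inner (j := j) (by simp; omega), hasIndex_outer (j := j) (by simp; omega)]
  · exact hasIndex_zero (by omega)
  · exact hasIndex_low (by omega)

lemma HasIndex.isVertex (ht : 0 ≤ t) (h : HasIndex t p i) : IsVertex t p := by
  unfold IsVertex
  rcases h with h | h | h | ⟨j, h⟩ | ⟨j, h⟩ | h | h <;> omega

lemma HasIndex.bounds (ht : 0 ≤ t) (h : HasIndex t p i) : 0 ≤ i ∧ i < 14 * t + 14 := by
  rcases h with h | h | h | ⟨j, h⟩ | ⟨j, h⟩ | h | h <;> omega

lemma HasIndex.vertex_unique (hp : HasIndex t p i) (hq : HasIndex t q i) : p = q := by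
  rcases hp with h | h | h | ⟨j, h⟩ | ⟨j, h⟩ | h | h <;>
    rcases hq with h' | h' | h' | ⟨j', h'⟩ | ⟨j', h'⟩ | h' | h' <;> omega

lemma HasIndex.index_unique (h : HasIndex t p i) (h' : HasIndex t p i') : i = i' := by
  rcases h with h | h | h | ⟨j, h⟩ | ⟨j, h⟩ | h | h <;>
    rcases h' with h' | h' | h' | ⟨j', h'⟩ | ⟨j', h'⟩ | h' | h' <;> omega

lemma IsVertex.exists_hasIndex (h : IsVertex t p) : ∃ i, HasIndex t p i := by
  rcases h with rfl | h | h | h | h | h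
  · exact ⟨_, hasIndex_zero rfl⟩
  · exact ⟨14 * t + 14 - p / 4, hasIndex_low (by omega)⟩
  · rcases (by omega : p = 18 ∨ (p % 32 = 10 ∨ p % 32 = 26) ∨ p % 32 = 2 ∨ (p % 32 = 18 ∧ p ≠ 18))
      with h' | (h' | h') | h' | h'
    exacts [⟨1, .inl ⟨h', rfl⟩⟩,
      ⟨6 * (p / 32), hasIndex_outer (j := p / 32) (by omega)⟩,
      ⟨6 * (p / 32) + 4, hasIndex_outer (j := p / 32) (by omega)⟩,
      ⟨6 * (p / 32) - 1, hasIndex_inner (j := p / 32) (by omega)⟩,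
      ⟨6 * (p / 32) + 3, hasIndex_inner (j := p / 32) (by omega)⟩]
  · exact ⟨2, .inr (.inl ⟨h, rfl⟩)⟩
  · exact ⟨3, .inr (.inr (.inl ⟨h, rfl⟩))⟩
  · exact ⟨6 * (p / 32) + (p % 32 - 11) / 2, hasIndex_inner (j := p / 32) (by omega)⟩

lemma HasIndex.polyEdge_succ (ht : 0 ≤ t) (hp : HasIndex t p i) (hq : HasIndex t q (i + 1)) :
    PolyEdge t p q ∨ PolyEdge t q p := by
  have middle : p % 8 = 2 ∧ ¬ IsBase t p ∧ 10 ≤ p ∧ p + 8 ≤ 32 * t + 26 → q = p + 8 →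
      PolyEdge t p q ∨ PolyEdge t q p := fun h hq =>
    .inl (.inr (.inl ⟨⟨h.1, h.2.2.1, hq, by omega⟩, h.2.1⟩))
  have run : ∀ g, IsBase t g → RunStep g p q → PolyEdge t p q ∨ PolyEdge t q p := fun g hg h =>
    .inl (.inr (.inr (.inr (.inr ⟨g, hg, h⟩))))
  unfold IsBase at middle run
  unfold RunStep at run
  rcases hp with h | h | h | ⟨j, hj, hjt, h | h⟩ | ⟨j, hj, hjt, h | h | h | h⟩ | h | h
  · have : q = 21 := hq.vertex_unique (.inr (.inl (by omega)))
    exact run 18 (by omega) (by omega)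
  · have : q = 23 := hq.vertex_unique (.inr (.inr (.inl (by omega))))
    exact run 18 (by omega) (by omega)
  · have : q = 26 := hq.vertex_unique (hasIndex_outer (j := 0) (by omega))
    exact run 18 (by omega) (by omega)
  · rcases hj.eq_or_lt with rfl | hj
    · exact middle (by omega) (hq.vertex_unique (.inl (by omega)))
    · have : q = p + 3 := hq.vertex_unique (hasIndex_inner (j := j) (by omega))
      exact run p (by omega) (by omega)
  · rcases hjt.eq_or_lt with rfl | hjt
    · have : q = 0 := hq.vertex_unique (hasIndex_zero (by omega))
      exact .inr (.inr (.inr (.inr (.inl ⟨⟨this, .inr (.inl h.1)⟩, by omega⟩))))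
    · exact middle (by omega) (hq.vertex_unique (hasIndex_inner (j := j + 1) (by omega)))
  · exact middle (by omega) (hq.vertex_unique (hasIndex_outer (j := j) (by omega)))
  · have : q = p + 2 := hq.vertex_unique (hasIndex_inner (j := j) (by omega))
    exact run (p - 3) (by omega) (by omega)
  · have : q = p + 3 := hq.vertex_unique (hasIndex_inner (j := j) (by omega))
    exact run (p - 5) (by omega) (by omega)
  · exact middle (by omega) (hq.vertex_unique (hasIndex_outer (j := j) (by omega)))
  · have : q = 32 * t + 32 := hq.vertex_unique (hasIndex_low (by omega))
    exact .inl (.inr (.inr (.inr (.inl ⟨⟨h.1, .inr (.inr this)⟩, by omega⟩))))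
  · have := (hq.bounds ht).2
    have : q = p - 4 := hq.vertex_unique (hasIndex_low (by omega))
    exact .inr (.inl ⟨by omega, by omega, by omega, by omega⟩)

lemma RunEdge.exists_hasIndex (ht : 0 ≤ t) (h : RunEdge t p q) :
    ∃ i, HasIndex t p i ∧ HasIndex t q (i + 1) := by
  obtain ⟨g, hg | hg, h | h | h⟩ := h
  · exact ⟨1, .inl (by omega), .inr (.inl (by omega))⟩
  · exact ⟨2, .inr (.inl (by omega)), .inr (.inr (.inl (by omega)))⟩
  · exact ⟨3, .inr (.inr (.inl (by omega))), hasIndex_outer (j := 0) (by omega)⟩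
  · exact ⟨6 * (g / 32), hasIndex_outer (j := g / 32) (by omega),
      hasIndex_inner (j := g / 32) (by omega)⟩
  · exact ⟨6 * (g / 32) + 1, hasIndex_inner (j := g / 32) (by omega),
      hasIndex_inner (j := g / 32) (by omega)⟩
  · exact ⟨6 * (g / 32) + 2, hasIndex_inner (j := g / 32) (by omega),
      hasIndex_inner (j := g / 32) (by omega)⟩

lemma MiddleEdge.exists_hasIndex (h : MiddleEdge t p q) (hp : ¬ IsBase t p) :
    ∃ i, HasIndex t p i ∧ HasIndex t q (i + 1) := by
  unfold MiddleEdge at h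
  unfold IsBase at hp
  rcases (by omega : p % 32 = 2 ∨ p = 10 ∨ p % 32 = 18 ∨ p % 32 = 26) with hp | hp | hp | hp
  · exact ⟨6 * (p / 32) - 1, hasIndex_inner (j := p / 32) (by omega),
      hasIndex_outer (j := p / 32) (by omega)⟩
  · exact ⟨0, hasIndex_outer (j := 0) (by omega), .inl (by omega)⟩
  · exact ⟨6 * (p / 32) + 3, hasIndex_inner (j := p / 32) (by omega),
      hasIndex_outer (j := p / 32) (by omega)⟩
  · exact ⟨6 * (p / 32) + 4, hasIndex_outer (j := p / 32) (by omega),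
      hasIndex_inner (j := p / 32 + 1) (by omega)⟩

lemma PolyEdge.exists_hasIndex (ht : 0 ≤ t) (h : PolyEdge t p q) :
    (∃ i, HasIndex t p i ∧ HasIndex t q (i + 1)) ∨ (∃ i, HasIndex t q i ∧ HasIndex t p (i + 1)) ∨
      (p = 4 ∧ q = 10) := by
  rcases h with h | ⟨h, hp⟩ | h | ⟨⟨rfl, hq⟩, hq10⟩ | h
  · unfold LowEdge at h
    exact .inr (.inl ⟨14 * t + 14 - q / 4, hasIndex_low (by omega), hasIndex_low (by omega)⟩)
  · exact .inl (h.exists_hasIndex hp)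
  · exact .inr (.inr h)
  · rcases hq with hq | hq | hq
    · contradiction
    · exact .inr (.inl ⟨6 * t + 4, hasIndex_outer (j := t) (by omega), hasIndex_zero (by ring)⟩)
    · exact .inl ⟨6 * t + 5, hasIndex_zero rfl, hasIndex_low (by omega)⟩
  · exact .inl (h.exists_hasIndex ht)

lemma hasIndex_four (ht : 0 ≤ t) : HasIndex t 4 (14 * t + 13) :=
  hasIndex_low (by omega)

lemma hasIndex_ten (ht : 0 ≤ t) : HasIndex t 10 0 :=
  hasIndex_outer (j := 0) (by omega)

lemma polyEdge_iff_hasIndex (ht : 0 ≤ t) (hp : HasIndex t p i) (hq : HasIndex t q i') :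
    PolyEdge t p q ∨ PolyEdge t q p ↔ i + 1 = i' ∨ i' + 1 = i ∨ (i = 0 ∧ i' + 1 = 14 * t + 14) ∨
      (i' = 0 ∧ i + 1 = 14 * t + 14) := by
  have succ_of_polyEdge : ∀ {p q i i'}, HasIndex t p i → HasIndex t q i' → PolyEdge t p q →
      i + 1 = i' ∨ i' + 1 = i ∨ (i' = 0 ∧ i + 1 = 14 * t + 14) := by
    intro p q i i' hp hq h
    rcases h.exists_hasIndex ht with ⟨k, hpk, hqk⟩ | ⟨k, hqk, hpk⟩ | ⟨rfl, rfl⟩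
    · exact .inl (by rw [hp.index_unique hpk, hq.index_unique hqk])
    · exact .inr (.inl (by rw [hp.index_unique hpk, hq.index_unique hqk]))
    · rw [hp.index_unique (hasIndex_four ht), hq.index_unique (hasIndex_ten ht)]
      omega
  have polyEdge_of_ends : ∀ {p q i i'}, HasIndex t p i → HasIndex t q i' →
      i' = 0 ∧ i + 1 = 14 * t + 14 → PolyEdge t p q := by
    rintro p q i i' hp hq ⟨rfl, hi⟩
    obtain rfl : i = 14 * t + 13 := by omega
    exact .inr (.inr (.inl ⟨hp.vertex_unique (hasIndex_four ht),
      hq.vertex_unique (hasIndex_ten ht)⟩))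
  constructor
  · rintro (h | h)
    · have := succ_of_polyEdge hp hq h
      tauto
    · have := succ_of_polyEdge hq hp h
      tauto
  · rintro (rfl | rfl | h | h)
    · exact hp.polyEdge_succ ht hq
    · exact (hq.polyEdge_succ ht hp).symm
    · exact .inr (polyEdge_of_ends hq hp h)
    · exact .inl (polyEdge_of_ends hp hq h)

end CyclicOrder

section MatchedVertices

/-- The matched vertices: `0` and those at height `8`. -/
def IsMatched (t p : ℤ) : Prop := p = 0 ∨ (p % 8 = 2 ∧ 10 ≤ p ∧ p ≤ 32 * t + 26)

variable {t p q r : ℤ}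

lemma isVertex_iff : IsVertex t p ↔ IsMatched t p ∨ IsFree t p := by
  unfold IsVertex IsMatched IsFree
  tauto

lemma MatchEdge.lt (h : MatchEdge t p q) : p < q := by
  rcases h with h | h | h
  · omega
  · omega
  · unfold ChordEdge at h
    omega

lemma MatchEdge.isMatched (ht : 0 ≤ t) (h : MatchEdge t p q) :
    IsMatched t p ∧ IsMatched t q := by
  unfold IsMatched
  rcases h with h | ⟨h | h, h'⟩ | h
  · omega
  · omega
  · omega
  · unfold ChordEdge at h
    omega

lemma IsMatched.exists_matchEdge (h : IsMatched t p) :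
    ∃ q, MatchEdge t p q ∨ MatchEdge t q p := by
  unfold MatchEdge IsBase ChordEdge
  rcases h with rfl | ⟨hp8, hp, hpt⟩
  · exact ⟨10, by simp⟩
  rcases (by omega : p = 10 ∨ p = 18 ∨ p = 26 ∨ 32 ≤ p) with rfl | rfl | rfl | h32
  · exact ⟨0, by simp⟩
  · exact ⟨26, by simp⟩
  · exact ⟨18, by simp⟩
  rcases (by omega : p % 32 = 2 ∨ p % 32 = 10 ∨ p % 32 = 18 ∨ p % 32 = 26) with h | h | h | h
  · exact ⟨p + 24, .inl (.inr (.inr (by omega)))⟩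
  · exact ⟨p + 8, .inl (.inr (.inl (by omega)))⟩
  · exact ⟨p - 8, .inr (.inr (.inl (by omega)))⟩
  · exact ⟨p - 24, .inr (.inr (.inr (by omega)))⟩

lemma MatchEdge.unique (hq : MatchEdge t p q ∨ MatchEdge t q p)
    (hr : MatchEdge t p r ∨ MatchEdge t r p) : q = r := by
  unfold MatchEdge IsBase ChordEdge at hq hr
  rcases hq with (h | h | h) | (h | h | h) <;> rcases hr with (h' | h' | h') | (h' | h' | h') <;>
    omega

lemma PolyEdge.lt (ht : 0 ≤ t) (h : PolyEdge t p q) : p < q := by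
  unfold PolyEdge LowEdge MiddleEdge TopEdge at h
  rcases h with h | h | h | h | ⟨g, -, h | h | h⟩ <;> omega

lemma MatchEdge.not_polyEdge (h : MatchEdge t p q) : ¬ PolyEdge t p q := by
  unfold MatchEdge ChordEdge at h
  rintro (h' | ⟨h', hp⟩ | h' | ⟨h', hq⟩ | ⟨g, -, h' | h' | h'⟩)
  · unfold LowEdge at h'
    omega
  · unfold MiddleEdge at h'
    rcases h with h | h | h
    · omega
    · exact hp h.1
    · omega
  · omega
  · unfold TopEdge at h'
    omega
  all_goals
    omega

lemma PolyEdge.isVertex (ht : 0 ≤ t) (h : PolyEdge t p q) : IsVertex t p ∧ IsVertex t q := by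
  rcases h.exists_hasIndex ht with ⟨i, hp, hq⟩ | ⟨i, hq, hp⟩ | ⟨rfl, rfl⟩
  · exact ⟨hp.isVertex ht, hq.isVertex ht⟩
  · exact ⟨hp.isVertex ht, hq.isVertex ht⟩
  · exact ⟨(hasIndex_four ht).isVertex ht, (hasIndex_ten ht).isVertex ht⟩

end MatchedVertices

section Drawing

variable {t : ℕ} {a b c d i j : Fin (14 * t + 14)} {p : ℤ}

lemma abscissa_injective (t : ℕ) :
    Function.Injective fun i : Fin (14 * t + 14) => abscissa t i := fun i j h => by
  have hi := hasIndex_abscissa i.isLt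
  rw [show abscissa t i = abscissa t j from h] at hi
  exact Fin.ext (Nat.cast_injective (hi.index_unique (hasIndex_abscissa j.isLt)))

lemma isVertex_abscissa (i : Fin (14 * t + 14)) : IsVertex t (abscissa t i) :=
  (hasIndex_abscissa i.isLt).isVertex t.cast_nonneg

lemma exists_abscissa_eq (hp : IsVertex t p) : ∃ i : Fin (14 * t + 14), abscissa t i = p := by
  obtain ⟨i, hi⟩ := hp.exists_hasIndex
  obtain ⟨hi0, hit⟩ := hi.bounds t.cast_nonneg
  lift i to ℕ using hi0
  have hit : i < 14 * t + 14 := by exact_mod_cast hit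
  exact ⟨⟨i, hit⟩, (hasIndex_abscissa hit).vertex_unique hi⟩

/-- The vertices of the polygon as points of the plane, in cyclic order. -/
def pos (t : ℕ) (i : Fin (14 * t + 14)) : Plane :=
  !₂[(abscissa t i : ℝ), (ordinate t (abscissa t i) : ℝ)]

lemma pos_injective (t : ℕ) : Function.Injective (pos t) := fun i j h =>
  abscissa_injective t (by simpa [pos] using congr($h 0))

lemma orient_pos (a b c : Fin (14 * t + 14)) :
    orient (pos t) a b c = det t (abscissa t a) (abscissa t b) (abscissa t c) := by
  simp only [orient, pos, PiLp.toLp_apply, Matrix.cons_val_zero, Matrix.cons_val_one, det]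
  push_cast
  ring

lemma crosses_iff_segCross : Crosses (pos t) a b c d ↔
    SegCross t (abscissa t a) (abscissa t b) (abscissa t c) (abscissa t d) := by
  simp only [Crosses, SegCross, orient_pos]
  norm_cast

lemma genPos_pos (t : ℕ) : GenPos (pos t) := by
  intro a b c hab hbc hac
  rw [orient_pos]
  exact_mod_cast det_ne_zero t.cast_nonneg (isVertex_abscissa a) (isVertex_abscissa b)
    (isVertex_abscissa c) ((abscissa_injective t).ne hab) ((abscissa_injective t).ne hbc)
    ((abscissa_injective t).ne hac)

/-- A maximal compatible matching of the polygon with `2 * t + 2` edges. -/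
def matching (t : ℕ) : SimpleGraph (Fin (14 * t + 14)) where
  Adj i j := MatchEdge t (abscissa t i) (abscissa t j) ∨ MatchEdge t (abscissa t j) (abscissa t i)
  symm := ⟨fun _ _ h => h.symm⟩
  loopless := ⟨fun _ h => h.elim (fun h => h.lt.false) fun h => h.lt.false⟩

lemma matching_adj : (matching t).Adj i j ↔
    MatchEdge t (abscissa t i) (abscissa t j) ∨ MatchEdge t (abscissa t j) (abscissa t i) := .rfl

lemma cycleGraph_adj_iff : (SimpleGraph.cycleGraph (14 * t + 14)).Adj i j ↔
    PolyEdge t (abscissa t i) (abscissa t j) ∨ PolyEdge t (abscissa t j) (abscissa t i) := by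
  rw [cycleGraph_adj_iff_val (by omega), polyEdge_iff_hasIndex t.cast_nonneg
    (hasIndex_abscissa i.isLt) (hasIndex_abscissa j.isLt)]
  norm_cast

lemma sup_adj_iff : (SimpleGraph.cycleGraph (14 * t + 14) ⊔ matching t).Adj i j ↔
    (PolyEdge t (abscissa t i) (abscissa t j) ∨ MatchEdge t (abscissa t i) (abscissa t j)) ∨
      PolyEdge t (abscissa t j) (abscissa t i) ∨ MatchEdge t (abscissa t j) (abscissa t i) := by
  rw [SimpleGraph.sup_adj, cycleGraph_adj_iff, matching_adj, or_or_or_comm]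

lemma crossingFree_sup (t : ℕ) :
    CrossingFree (pos t) (SimpleGraph.cycleGraph (14 * t + 14) ⊔ matching t) := by
  intro a b c d hab hcd h
  have ht : (0 : ℤ) ≤ t := t.cast_nonneg
  rcases sup_adj_iff.1 hab with hab | hab <;> rcases sup_adj_iff.1 hcd with hcd | hcd
  · exact not_segCross ht hab hcd (crosses_iff_segCross.1 h)
  · exact not_segCross ht hab hcd (crosses_iff_segCross.1 h.swap_right)
  · exact not_segCross ht hab hcd (crosses_iff_segCross.1 h.swap_left)
  · exact not_segCross ht hab hcd (crosses_iff_segCross.1 h.swap_left.swap_right)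

/-- A polygon with `14 * t + 14` vertices and a maximal compatible matching of a seventh that
size. -/
noncomputable def polygon (t : ℕ) : GeometricGraph (Fin (14 * t + 14)) :=
  .ofCrossingFree (pos t) (SimpleGraph.cycleGraph (14 * t + 14)) (pos_injective t) (genPos_pos t)
    ((crossingFree_sup t).mono le_sup_left)

lemma polygon_mem_polygons (t : ℕ) : polygon t ∈ GeometricGraph.polygons (14 * t + 14) :=
  ⟨rfl, GeometricGraph.inGeneralPosition_of_genPos (genPos_pos t)⟩

lemma disjoint_cycleGraph_matching (t : ℕ) :
    Disjoint (SimpleGraph.cycleGraph (14 * t + 14)) (matching t) := by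
  refine SimpleGraph.disjoint_left.2 fun i j hP hM => ?_
  have ht : (0 : ℤ) ≤ t := t.cast_nonneg
  rcases cycleGraph_adj_iff.1 hP with hP | hP <;> rcases matching_adj.1 hM with hM | hM
  · exact hM.not_polyEdge hP
  · exact hM.lt.asymm (hP.lt ht)
  · exact hM.lt.asymm (hP.lt ht)
  · exact hM.not_polyEdge hP

lemma mem_support_matching : i ∈ (matching t).support ↔ IsMatched t (abscissa t i) := by
  have ht : (0 : ℤ) ≤ t := t.cast_nonneg
  constructor
  · rintro ⟨j, h | h⟩
    · exact (h.isMatched ht).1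
    · exact (h.isMatched ht).2
  · intro h
    obtain ⟨q, hq⟩ := h.exists_matchEdge
    have hq' : IsMatched t q :=
      hq.elim (fun h => (h.isMatched ht).2) fun h => (h.isMatched ht).1
    obtain ⟨j, rfl⟩ := exists_abscissa_eq (isVertex_iff.2 (.inl hq'))
    exact ⟨j, hq⟩

lemma exists_crosses_of_lt (hi : IsFree t (abscissa t i)) (hj : IsFree t (abscissa t j))
    (hij : abscissa t i < abscissa t j) (hadj : ¬ PolyEdge t (abscissa t i) (abscissa t j)) :
    ∃ c d, (SimpleGraph.cycleGraph (14 * t + 14) ⊔ matching t).Adj c d ∧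
      Crosses (pos t) i j c d := by
  have ht : (0 : ℤ) ≤ t := t.cast_nonneg
  obtain ⟨r, s, hrs, hcr⟩ := exists_segCross hi hj hij hadj
  have ⟨hr, hs⟩ : IsVertex t r ∧ IsVertex t s := hrs.elim (fun h => h.isVertex ht) fun h =>
    (h.isMatched ht).imp (fun h => isVertex_iff.2 (.inl h)) fun h => isVertex_iff.2 (.inl h)
  obtain ⟨c, rfl⟩ := exists_abscissa_eq hr
  obtain ⟨d, rfl⟩ := exists_abscissa_eq hs
  exact ⟨c, d, sup_adj_iff.2 (.inl hrs), crosses_iff_segCross.2 hcr⟩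

lemma isMaximalCompatibleMatching_matching (t : ℕ) :
    (polygon t).IsMaximalCompatibleMatching (matching t) := by
  have isFree : ∀ {i : Fin (14 * t + 14)}, i ∉ (matching t).support → IsFree t (abscissa t i) :=
    fun {i} hi => (isVertex_iff.1 (isVertex_abscissa i)).resolve_left
      fun h => hi (mem_support_matching.2 h)
  refine GeometricGraph.isMaximalCompatibleMatching_of_exists_crosses (genPos_pos t)
    (fun u v w h h' => abscissa_injective t (MatchEdge.unique h h'))
    (disjoint_cycleGraph_matching t) (crossingFree_sup t) fun i j hij hi hj hadj => ?_
  rcases ((abscissa_injective t).ne hij).lt_or_gt with h | h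
  · exact exists_crosses_of_lt (isFree hi) (isFree hj) h fun hP =>
      hadj (cycleGraph_adj_iff.2 (.inl hP))
  · obtain ⟨c, d, hcd, hcr⟩ := exists_crosses_of_lt (isFree hj) (isFree hi) h fun hP =>
      hadj (cycleGraph_adj_iff.2 (.inr hP))
    exact ⟨c, d, hcd, hcr.swap_left⟩

lemma ncard_support_matching_le (t : ℕ) : (matching t).support.ncard ≤ 4 * t + 4 := by
  rw [← Set.ncard_Iio_nat (4 * t + 4)]
  refine Set.ncard_le_ncard_of_injOn (fun i => (abscissa t i / 8).toNat) (fun i hi => ?_)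
    (fun i hi j hj hij => abscissa_injective t ?_) (Set.finite_Iio _)
  · have hi := mem_support_matching.1 hi
    unfold IsMatched at hi
    simp only [Set.mem_Iio]
    omega
  · have hi := mem_support_matching.1 hi
    have hj := mem_support_matching.1 hj
    unfold IsMatched at hi hj
    simp only at hij ⊢
    omega

lemma ncard_edgeSet_matching (t : ℕ) : (matching t).edgeSet.ncard = 2 * t + 2 := by
  have hM := isMaximalCompatibleMatching_matching t
  have hge := GeometricGraph.card_le_seven_mul (by omega) (polygon_mem_polygons t) hM
  have hle := ncard_support_matching_le t
  rw [ncard_support_of_matching hM.prop.matching] at hle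
  omega

lemma mmFamily_polygons_eq (t : ℕ) :
    GeometricGraph.mmFamily (GeometricGraph.polygons (14 * t + 14)) = 2 * t + 2 := by
  have hle := GeometricGraph.mmFamily_polygons_le (polygon_mem_polygons t)
    (isMaximalCompatibleMatching_matching t)
  have hge := GeometricGraph.le_seven_mul_mmFamily (n := 14 * t + 14) (by omega)
    ⟨_, polygon_mem_polygons t⟩
  rw [ncard_edgeSet_matching] at hle
  omega

end Drawing

end TightPolygon

theorem theorem3 :
    (∀ n : ℕ, 4 ≤ n →
      (∀ P ∈ GeometricGraph.polygons n, ∀ M : SimpleGraph (Fin n),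
        P.IsMaximalCompatibleMatching M → (n : ℝ) / 7 ≤ (M.edgeSet.ncard : ℝ)) ∧
      (n : ℝ) / 7 ≤ (GeometricGraph.mmFamily (GeometricGraph.polygons n) : ℝ)) ∧
    {n : ℕ | 4 ≤ n ∧
      (GeometricGraph.mmFamily (GeometricGraph.polygons n) : ℝ) = (n : ℝ) / 7 ∧
      ∃ P ∈ GeometricGraph.polygons n, ∃ M : SimpleGraph (Fin n),
        P.IsMaximalCompatibleMatching M ∧ (M.edgeSet.ncard : ℝ) = (n : ℝ) / 7}.Infinite := by
  have div_le_cast : ∀ {n k : ℕ}, n ≤ 7 * k → (n : ℝ) / 7 ≤ k := fun h => by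
    rw [div_le_iff₀' (by norm_num)]
    exact_mod_cast h
  refine ⟨fun n hn => ⟨fun P hP M hM => div_le_cast (GeometricGraph.card_le_seven_mul hn hP hM),
    div_le_cast (GeometricGraph.le_seven_mul_mmFamily hn
      (GeometricGraph.polygons_nonempty (by omega)))⟩, ?_⟩
  refine Set.infinite_of_injective_forall_mem (f := fun t : ℕ => 14 * t + 14)
    (fun s t h => by simpa using h) fun t => ?_
  have cast_div : ((14 * t + 14 : ℕ) : ℝ) / 7 = (2 * t + 2 : ℕ) := by
    push_cast
    ring
  rw [Set.mem_ofPred_eq, cast_div, TightPolygon.mmFamily_polygons_eq]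
  exact ⟨by omega, rfl, _, TightPolygon.polygon_mem_polygons t, _,
    TightPolygon.isMaximalCompatibleMatching_matching t,
    congrArg _ (TightPolygon.ncard_edgeSet_matching t)⟩
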